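/- Fix a finite alphabet $A$ and write $A^*$ for the set of words over $A$. A class of languages is a set of subsets of $A^*$. It is a Boolean algebra if it contains $\emptyset$ and $A^*$ and is closed under union, intersection and complement in $A^*$. It is quotienting if for every language $L$ in it and every $w\in A^*$ it also contains $w^{-1}L=\{u\in A^*\mid wu\in L\}$ and $Lw^{-1}=\{u\in A^*\mid uw\in L\}$. For a class $\mathcal{D}$, the Boolean closure $\mathrm{Bool}(\mathcal{D})$ is the least Boolean algebra containing $\mathcal{D}$, and the polynomial closure $\mathrm{Pol}(\mathcal{D})$ is the least class containing $\mathcal{D}$ and closed under union, $(K,L)\mapsto K\cup L$, and under marked concatenation, $(K,L)\mapsto KaL=\{uav\mid u\in K,\ v\in L\}$ for each letter $a\in A$. For a class $\mathcal{D}$, the $\mathcal{D}$-separation problem is: given two regular languages $L_1,L_2\subseteq A^*$ (each by a nondeterministic finite automaton), is there $K\in\mathcal{D}$ with $L_1\subseteq K$ and $K\cap L_2=\emptyset$? The $\mathcal{D}$-covering problem is: given a regular language $L\subseteq A^*$ and a finite set $\mathbf{L}$ of regular languages over $A$ (each by a nondeterministic finite automaton), is there a finite set $\mathbf{K}\subseteq\mathcal{D}$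 such that $L\subseteq\bigcup_{K\in\mathbf{K}}K$ and such that for every $K\in\mathbf{K}$ there is $L'\in\mathbf{L}$ with $K\cap L'=\emptyset$? **Theorem.** Let $\mathcal{C}$ be a finite quotienting Boolean algebra of regular languages over $A$. Then the covering problem and the separation problem are both decidable for $\mathrm{Pol}(\mathcal{C})$, and both decidable for $\mathrm{Pol}(\mathrm{Bool}(\mathrm{Pol}(\mathcal{C})))$ (these two classes are the levels $1/2$ and $3/2$ of the concatenation hierarchy with basis $\mathcal{C}$). -/

import Mathlib

namespace LangClass

variable {A : Type*}

/-- The right quotient `L w⁻¹ = {u | u w ∈ L}` (the left quotient `w⁻¹ L` is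
`Language.leftQuotient`). -/
def rightQuotient (L : Language A) (w : List A) : Language A := {u | u ++ w ∈ L}

/-- A lattice of languages: contains `∅` and `A*`, closed under union and intersection. -/
structure IsLattice (C : Set (Language A)) : Prop where
  empty_mem : (⊥ : Language A) ∈ C
  univ_mem : (⊤ : Language A) ∈ C
  union_mem : ∀ K ∈ C, ∀ L ∈ C, K ⊔ L ∈ C
  inter_mem : ∀ K ∈ C, ∀ L ∈ C, K ⊓ L ∈ C

/-- A Boolean algebra of languages: a lattice closed under complement. -/
structure IsBooleanAlgebra (C : Set (Language A)) : Prop extends IsLattice C where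
  compl_mem : ∀ L ∈ C, Lᶜ ∈ C

/-- A class of languages closed under left and right quotients by words. -/
structure IsQuotienting (C : Set (Language A)) : Prop where
  left_mem : ∀ L ∈ C, ∀ w : List A, L.leftQuotient w ∈ C
  right_mem : ∀ L ∈ C, ∀ w : List A, rightQuotient L w ∈ C

/-- Membership in the Boolean closure of `C`. -/
inductive BoolClosureMem (C : Set (Language A)) : Language A → Prop
  | base (L : Language A) (hL : L ∈ C) : BoolClosureMem C L
  | empty : BoolClosureMem C ⊥
  | univ : BoolClosureMem C ⊤
  | union (K L : Language A) (hK : BoolClosureMem C K) (hL : BoolClosureMem C L) :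
      BoolClosureMem C (K ⊔ L)
  | inter (K L : Language A) (hK : BoolClosureMem C K) (hL : BoolClosureMem C L) :
      BoolClosureMem C (K ⊓ L)
  | compl (L : Language A) (hL : BoolClosureMem C L) : BoolClosureMem C Lᶜ

/-- The Boolean closure `Bool(C)`: the least Boolean algebra of languages containing `C`. -/
def BoolClosure (C : Set (Language A)) : Set (Language A) := {L | BoolClosureMem C L}

/-- Membership in the polynomial closure of `C`. -/
inductive PolMem (C : Set (Language A)) : Language A → Prop
  | base (L : Language A) (hL : L ∈ C) : PolMem C L
  | union (K L : Language A) (hK : PolMem C K) (hL : PolMem C L) : PolMem C (K ⊔ L)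
  | marked (K L : Language A) (a : A) (hK : PolMem C K) (hL : PolMem C L) :
      PolMem C (K * {[a]} * L)

/-- The polynomial closure `Pol(C)`: the least class containing `C` and closed under union and
marked concatenation `K, L ↦ K a L`, for letters `a`. -/
def Pol (C : Set (Language A)) : Set (Language A) := {L | PolMem C L}

/-- `Pol(Bool(Pol(C)))`. -/
def PBPol (C : Set (Language A)) : Set (Language A) := Pol (BoolClosure (Pol C))

/-- `L₁` is `C`-separable from `L₂`: some `K ∈ C` has `L₁ ⊆ K` and `L₂ ∩ K = ∅`. -/
def Separable (C : Set (Language A)) (L₁ L₂ : Language A) : Prop :=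
  ∃ K ∈ C, L₁ ≤ K ∧ L₂ ⊓ K = ⊥

/-- `Ks` is a `C`-cover of `L`: a finite set of languages of `C` whose union contains `L`. -/
def IsCover (C : Set (Language A)) (L : Language A) (Ks : Set (Language A)) : Prop :=
  Ks.Finite ∧ Ks ⊆ C ∧ ∀ w ∈ L, ∃ K ∈ Ks, w ∈ K

/-- `(L, Ls)` is `C`-coverable: there is a `C`-cover `Ks` of `L` such that every `K ∈ Ks` is
disjoint from some `L' ∈ Ls`. -/
def Coverable (C : Set (Language A)) (L : Language A) (Ls : Set (Language A)) : Prop :=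
  ∃ Ks, IsCover C L Ks ∧ ∀ K ∈ Ks, ∃ L' ∈ Ls, K ⊓ L' = ⊥

/-- Finite presentation of a nondeterministic finite automaton whose states are natural numbers:
the list of transitions `(p, a, q)`, the list of initial states, the list of final states. -/
abbrev NFACode (A : Type*) : Type _ := List (ℕ × A × ℕ) × List ℕ × List ℕ

/-- The automaton presented by a code. -/
def NFACode.toNFA (c : NFACode A) : NFA A ℕ where
  step p a := {q | (p, a, q) ∈ c.1}
  start := {q | q ∈ c.2.1}
  accept := {q | q ∈ c.2.2}

/-- The regular language presented by a code. -/
def NFACode.lang (c : NFACode A) : Language A := (NFACode.toNFA c).accepts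

/-- Decidability of `C`-separation. Input: two regular languages, given by automata. -/
def SeparationDecidable [Primcodable A] (C : Set (Language A)) : Prop :=
  ComputablePred fun x : NFACode A × NFACode A => Separable C x.1.lang x.2.lang

/-- Decidability of `C`-covering. Input: a regular language and a finite set of regular
languages, given by an automaton and a list of automata. -/
def CoveringDecidable [Primcodable A] (C : Set (Language A)) : Prop :=
  ComputablePred fun x : NFACode A × List (NFACode A) =>
    Coverable C x.1.lang {L | ∃ c ∈ x.2, L = c.lang}

/-- Over a finite alphabet the languages presented by codes are exactly the regular ones. -/
theorem isRegular_iff_exists_code [Finite A] (L : Language A) :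
    L.IsRegular ↔ ∃ c : NFACode A, NFACode.lang c = L := by
  constructor
  · rintro ⟨σ, _, M, rfl⟩
    classical
    have := Fintype.ofFinite A
    let e : σ → ℕ := fun s => Fintype.equivFin σ s
    have he : Function.Injective e := fun s t h =>
      (Fintype.equivFin σ).injective (Fin.ext h)
    let c : NFACode A :=
      ((Finset.univ : Finset (σ × A)).toList.map fun x => (e x.1, x.2, e (M.step x.1 x.2)),
        [e M.start], ((Finset.univ : Finset σ).filter (· ∈ M.accept)).toList.map e)
    have hstep : ∀ s a, (NFACode.toNFA c).stepSet {e s} a = {e (M.step s a)} := by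
      intro s a
      ext q
      simp only [NFA.stepSet_singleton, NFACode.toNFA, c, Set.mem_ofPred_eq, List.mem_map,
        Finset.mem_toList, Finset.mem_univ, true_and, Prod.mk.injEq, Prod.exists,
        Set.mem_singleton_iff]
      constructor
      · rintro ⟨s', a', h1, rfl, rfl⟩
        rw [he h1]
      · rintro rfl
        exact ⟨s, a, rfl, rfl, rfl⟩
    have heval : ∀ (w : List A) s,
        (NFACode.toNFA c).evalFrom {e s} w = {e (M.evalFrom s w)} := by
      intro w
      induction w with
      | nil => intro s; rfl
      | cons a w ih => intro s; rw [NFA.evalFrom_cons, hstep, ih, DFA.evalFrom_cons]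
    have hstart : (NFACode.toNFA c).start = {e M.start} := by
      ext q
      simp [NFACode.toNFA, c]
    refine ⟨c, ?_⟩
    ext w
    rw [NFACode.lang, NFA.mem_accepts, hstart, heval, DFA.mem_accepts]
    constructor
    · rintro ⟨q, hq, rfl⟩
      simp only [NFACode.toNFA, c, Set.mem_ofPred_eq, List.mem_map, Finset.mem_toList,
        Finset.mem_filter, Finset.mem_univ, true_and] at hq
      obtain ⟨s, hs, h⟩ := hq
      rwa [he h] at hs
    · intro h
      refine ⟨_, ?_, rfl⟩
      simp only [NFACode.toNFA, c, Set.mem_ofPred_eq, List.mem_map, Finset.mem_toList,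
        Finset.mem_filter, Finset.mem_univ, true_and]
      exact ⟨_, h, rfl⟩
  · rintro ⟨c, rfl⟩
    rw [Language.isRegular_iff_finite_range_leftQuotient]
    let F : Set ℕ := {q | q ∈ c.2.1} ∪ {q | q ∈ c.1.map fun t => t.2.2}
    have hF : F.Finite := (List.finite_toSet _).union (List.finite_toSet _)
    have hsub : ∀ (w : List A) (S : Set ℕ), S ⊆ F → (NFACode.toNFA c).evalFrom S w ⊆ F := by
      intro w
      induction w with
      | nil => intro S h; exact h
      | cons a w ih =>
        intro S _
        refine ih _ fun q hq => ?_
        obtain ⟨p, _, hp⟩ := NFA.mem_stepSet.1 hq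
        exact Or.inr (List.mem_map.2 ⟨_, hp, rfl⟩)
    refine (hF.finite_subsets.image (NFACode.toNFA c).acceptsFrom).subset ?_
    rintro _ ⟨w, rfl⟩
    refine ⟨_, hsub w _ fun q hq => Or.inl hq, ?_⟩
    ext v
    rw [Language.mem_leftQuotient, NFACode.lang, NFA.mem_accepts, NFA.mem_acceptsFrom,
      NFA.evalFrom_append]
    rfl

end LangClass

/-! Write x ≤_n y for `cutLe (classEquiv C) n x y`: the two words lie in the same languages of C,
and every cut of x at a letter is answered by a cut of y at the same letter, with n-1 rounds left on
both sides. A language of Pol(C) is an up-set of some ≤_n, because a marked concatenation costs one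
cut (`exists_cutLe_of_mem_pol`). Conversely ≤_n has finitely many principal up-sets, and all of them
lie in Pol(C) (`up_cutLe_mem_pol`). Hence L is coverable against a family iff there is an n such
that every x in L has a target missed by all y with x ≤_n y (`coverable_pol_iff`). For
Pol(Bool(Pol(C))) the same holds with the base relation replaced by the reverse of ≤_k: its up-sets
are complements of languages of Pol(C), and nested cuts over it recover ≤_k in the forward direction
as well, so Boolean combinations are seen too (`coverable_pbPol_iff`). Separation reduces to
covering because Pol is closed under finite unions.

It remains to decide whether some level suffices, with no bound on the level given in advance. Let α
be the joint transition morphism of all automata involved, including automata for C, into a finite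
monoid M. At a fixed level a word y yields finite data: its value, together with the set of values
of the words above it. For the second class the data are pairs (m, T), governed by a set S, and
pairs (m, Θ) with Θ made of such pairs, governed by a set P; the two sets refer to each other. The
data realized at every level are closed under finitely many inference rules: unit, letters,
products, passing to smaller sets, and a pumping rule at idempotents.

Soundness of pumping rests on `cutLe_wpow_insert`: n nested cuts cannot notice a word v inserted in
a long power of z, if z is idempotent for the base relation and below v for it. Completeness says
that any closed system already contains the data of all words at one fixed level; it follows from
Simon's factorization forests through `exists_forall_saturated`. Together: a sufficient level exists
iff some closed system contains no datum that defeats all the targets. The second condition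
quantifies over finitely many systems, and it is primitive recursive in the input automata once M is
coded by lists. -/

namespace LangClass

/-! ### Preorders on words given by cuts -/

section CutLe

variable {A : Type*}

/-- `cutLe B n x y`: `B` relates `x` to `y`, and (recursively, `n` times) every cut of `x` at a
letter can be answered by a cut of `y` at the same letter. -/
def cutLe (B : List A → List A → Prop) : ℕ → List A → List A → Prop
  | 0, x, y => B x y
  | n + 1, x, y => B x y ∧ ∀ x₁ a x₂, x = x₁ ++ a :: x₂ →
      ∃ y₁ y₂, y = y₁ ++ a :: y₂ ∧ cutLe B n x₁ y₁ ∧ cutLe B n x₂ y₂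

/-- A precongruence on words. -/
structure IsPrecongruence (B : List A → List A → Prop) : Prop where
  refl : ∀ x, B x x
  trans : ∀ x y z, B x y → B y z → B x z
  append : ∀ x y x' y', B x y → B x' y' → B (x ++ x') (y ++ y')

variable {B : List A → List A → Prop}

theorem cutLe.base {n : ℕ} {x y : List A} (h : cutLe B n x y) : B x y := by
  cases n with
  | zero => exact h
  | succ n => exact h.1

theorem cutLe.of_succ {n : ℕ} : ∀ {x y : List A}, cutLe B (n + 1) x y → cutLe B n x y := by
  induction n with
  | zero => intro x y h; exact h.1
  | succ n ih =>
    intro x y h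
    refine ⟨h.1, fun x₁ a x₂ hx => ?_⟩
    obtain ⟨y₁, y₂, hy, h₁, h₂⟩ := h.2 x₁ a x₂ hx
    exact ⟨y₁, y₂, hy, ih h₁, ih h₂⟩

theorem cutLe.mono {m n : ℕ} (hmn : m ≤ n) {x y : List A} (h : cutLe B n x y) :
    cutLe B m x y := by
  induction hmn with
  | refl => exact h
  | step _ ih => exact ih h.of_succ

theorem cutLe.mono_base {B' : List A → List A → Prop} (hB : ∀ x y, B x y → B' x y) {n : ℕ} :
    ∀ {x y : List A}, cutLe B n x y → cutLe B' n x y := by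
  induction n with
  | zero => intro x y h; exact hB _ _ h
  | succ n ih =>
    intro x y h
    refine ⟨hB _ _ h.1, fun x₁ a x₂ hx => ?_⟩
    obtain ⟨y₁, y₂, hy, h₁, h₂⟩ := h.2 x₁ a x₂ hx
    exact ⟨y₁, y₂, hy, ih h₁, ih h₂⟩

theorem IsPrecongruence.cutLe (hB : IsPrecongruence B) (n : ℕ) :
    IsPrecongruence (cutLe B n) := by
  induction n with
  | zero => exact hB
  | succ n ih =>
    refine ⟨fun x => ⟨hB.refl x, fun x₁ a x₂ hx => ⟨x₁, x₂, hx, ih.refl _, ih.refl _⟩⟩,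
      fun x y z hxy hyz => ⟨hB.trans _ _ _ hxy.1 hyz.1, fun x₁ a x₂ hx => ?_⟩,
      fun x y x' y' h h' => ⟨hB.append _ _ _ _ h.1 h'.1, fun x₁ a x₂ hx => ?_⟩⟩
    · obtain ⟨y₁, y₂, hy, h₁, h₂⟩ := hxy.2 x₁ a x₂ hx
      obtain ⟨z₁, z₂, hz, h₁', h₂'⟩ := hyz.2 y₁ a y₂ hy
      exact ⟨z₁, z₂, hz, ih.trans _ _ _ h₁ h₁', ih.trans _ _ _ h₂ h₂'⟩
    · rw [List.append_eq_append_iff] at hx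
      obtain ⟨t, rfl, ht⟩ | ⟨t, hx, ht⟩ := hx
      · obtain ⟨y₁, y₂, rfl, h₁, h₂⟩ := h'.2 t a x₂ ht
        exact ⟨y ++ y₁, y₂, by simp, ih.append _ _ _ _ h.of_succ h₁, h₂⟩
      · cases t with
        | nil =>
          obtain rfl : x₁ = x := by simpa using hx.symm
          obtain ⟨y₁, y₂, rfl, h₁, h₂⟩ := h'.2 [] a x₂ (by simpa using ht.symm)
          exact ⟨y ++ y₁, y₂, by simp, by simpa using ih.append _ _ _ _ h.of_succ h₁, h₂⟩
        | cons b t =>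
          obtain ⟨rfl, rfl⟩ : a = b ∧ x₂ = t ++ x' := by simpa using ht
          obtain ⟨y₁, y₂, rfl, h₁, h₂⟩ := h.2 x₁ a t hx
          exact ⟨y₁, y₂ ++ y', by simp, h₁, ih.append _ _ _ _ h₂ h'.of_succ⟩

/-- Cut at the first letter of x' and then give that letter back to the right half. A split at an
arbitrary place thus costs one level. -/
theorem cutLe.split (hB : IsPrecongruence B) {n : ℕ} {x x' y : List A}
    (h : cutLe B (n + 1) (x ++ x') y) :
    ∃ y₁ y₂, y = y₁ ++ y₂ ∧ cutLe B n x y₁ ∧ cutLe B n x' y₂ := by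
  cases x' with
  | nil => exact ⟨y, [], by simp, by simpa using h.of_succ, (hB.cutLe n).refl _⟩
  | cons a x' =>
    obtain ⟨y₁, y₂, rfl, h₁, h₂⟩ := h.2 x a x' rfl
    exact ⟨y₁, a :: y₂, rfl, h₁, (hB.cutLe n).append [a] [a] _ _ ((hB.cutLe n).refl _) h₂⟩

/-- The power of a word. -/
def wpow (z : List A) (n : ℕ) : List A := (List.replicate n z).flatten

@[simp] theorem wpow_zero (z : List A) : wpow z 0 = [] := rfl

theorem wpow_succ (z : List A) (n : ℕ) : wpow z (n + 1) = z ++ wpow z n := by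
  simp [wpow, List.replicate_succ]

theorem wpow_one (z : List A) : wpow z 1 = z := by simp [wpow_succ]

theorem wpow_add (z : List A) (m n : ℕ) : wpow z (m + n) = wpow z m ++ wpow z n := by
  simp only [wpow, List.replicate_add, List.flatten_append]

theorem wpow_eq_append_cons {z : List A} {n : ℕ} : ∀ {x₁ : List A} {a : A} {x₂ : List A},
    wpow z n = x₁ ++ a :: x₂ →
    ∃ i j z₁ z₂, i + j + 1 = n ∧ z = z₁ ++ a :: z₂ ∧ x₁ = wpow z i ++ z₁ ∧
      x₂ = z₂ ++ wpow z j := by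
  induction n with
  | zero => intro x₁ a x₂ h; simp at h
  | succ n ih =>
    intro x₁ a x₂ h
    have aux : ∀ t, x₁ = z ++ t → wpow z n = t ++ a :: x₂ →
        ∃ i j z₁ z₂, i + j + 1 = n + 1 ∧ z = z₁ ++ a :: z₂ ∧ x₁ = wpow z i ++ z₁ ∧
          x₂ = z₂ ++ wpow z j := by
      rintro t rfl ht
      obtain ⟨i, j, z₁, z₂, hij, hz, rfl, rfl⟩ := ih ht
      exact ⟨i + 1, j, z₁, z₂, by omega, hz, by rw [wpow_succ, List.append_assoc], rfl⟩
    rw [wpow_succ, List.append_eq_append_iff] at h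
    obtain ⟨t, hx, ht⟩ | ⟨t, hx, ht⟩ := h
    · exact aux t hx ht
    · cases t with
      | nil => exact aux [] (by simpa using hx.symm) (by simpa using ht.symm)
      | cons b t =>
        obtain ⟨rfl, rfl⟩ : a = b ∧ x₂ = t ++ wpow z n := by simpa using ht
        exact ⟨0, n, x₁, t, by omega, hx, by simp, rfl⟩

/-- The number of repetitions of a word that `n` nested cuts cannot distinguish. -/
def pumpBound : ℕ → ℕ
  | 0 => 1
  | n + 1 => 2 * pumpBound n + 1

theorem one_le_pumpBound (n : ℕ) : 1 ≤ pumpBound n := by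
  cases n <;> simp [pumpBound]

theorem IsPrecongruence.wpow_of_idem (hB : IsPrecongruence B) {z : List A} (h₁ : B z (z ++ z))
    (h₂ : B (z ++ z) z) {m n : ℕ} (hm : 1 ≤ m) (hn : 1 ≤ n) : B (wpow z m) (wpow z n) := by
  have key : ∀ n, 1 ≤ n → B (wpow z n) z ∧ B z (wpow z n) := by
    intro n hn
    induction n, hn using Nat.le_induction with
    | base => rw [wpow_one]; exact ⟨hB.refl _, hB.refl _⟩
    | succ n _ ih =>
      rw [wpow_succ]
      exact ⟨hB.trans _ _ _ (hB.append _ _ _ _ (hB.refl z) ih.1) h₂,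
        hB.trans _ _ _ h₁ (hB.append _ _ _ _ (hB.refl z) ih.2)⟩
  exact hB.trans _ _ _ (key m hm).1 (key n hn).2

/-- A cut falls inside one copy of z and leaves i copies on its left and j on its right. A short
side is copied exactly; a side that is long in both powers is handled by induction. The recursion
for `pumpBound` ensures that i and j cannot both be short. -/
theorem cutLe_wpow_wpow (hB : IsPrecongruence B) {z : List A} (h₁ : B z (z ++ z))
    (h₂ : B (z ++ z) z) (n : ℕ) : ∀ {p q : ℕ}, pumpBound n ≤ p → pumpBound n ≤ q →
    cutLe B n (wpow z p) (wpow z q) := by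
  induction n with
  | zero => intro p q hp hq; exact hB.wpow_of_idem h₁ h₂ hp hq
  | succ n ih =>
    intro p q hp hq
    have hP := hB.cutLe n
    have hb := one_le_pumpBound n
    simp only [pumpBound] at hp hq
    refine ⟨hB.wpow_of_idem h₁ h₂ (by omega) (by omega), fun x₁ a x₂ hx => ?_⟩
    obtain ⟨i, j, z₁, z₂, hij, hz, rfl, rfl⟩ := wpow_eq_append_cons hx
    have main : ∀ i' j', i' + j' + 1 = q → cutLe B n (wpow z i) (wpow z i') →
        cutLe B n (wpow z j) (wpow z j') →
        ∃ y₁ y₂, wpow z q = y₁ ++ a :: y₂ ∧ cutLe B n (wpow z i ++ z₁) y₁ ∧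
          cutLe B n (z₂ ++ wpow z j) y₂ := by
      intro i' j' hq' hi hj
      refine ⟨wpow z i' ++ z₁, z₂ ++ wpow z j', ?_, hP.append _ _ _ _ hi (hP.refl _),
        hP.append _ _ _ _ (hP.refl _) hj⟩
      rw [show q = i' + (1 + j') by omega, wpow_add, wpow_add, wpow_one]
      nth_rewrite 2 [hz]
      simp
    by_cases hi : i < pumpBound n
    · exact main i (q - i - 1) (by omega) (hP.refl _) (ih (by omega) (by omega))
    · by_cases hj : j < pumpBound n
      · exact main (q - j - 1) j (by omega) (ih (by omega) (by omega)) (hP.refl _)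
      · exact main (pumpBound n) (q - pumpBound n - 1) (by omega) (ih (by omega) le_rfl)
          (ih (by omega) (by omega))

/-- The source of all pumping. A cut with few copies of z on its left is answered in the left block,
any other cut in the right block; either way v ends up in a half whose two surrounding powers are
still long. Only the base relation ever compares z with v. -/
theorem cutLe_wpow_insert (hB : IsPrecongruence B) {z v : List A} (h₁ : B z (z ++ z))
    (h₂ : B (z ++ z) z) (hv : B z v) (n : ℕ) : ∀ {p q r : ℕ}, pumpBound n ≤ p →
    pumpBound n ≤ q → pumpBound n ≤ r →
    cutLe B n (wpow z p) (wpow z q ++ v ++ wpow z r) := by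
  have base : ∀ {p q r : ℕ}, 1 ≤ p → B (wpow z p) (wpow z q ++ v ++ wpow z r) := by
    intro p q r hp
    refine hB.trans _ _ _ (hB.wpow_of_idem h₁ h₂ hp (n := q + 1 + r) (by omega)) ?_
    rw [wpow_add, wpow_add, wpow_one]
    exact hB.append _ _ _ _ (hB.append _ _ _ _ (hB.refl _) hv) (hB.refl _)
  induction n with
  | zero => intro p q r hp hq hr; exact base hp
  | succ n ih =>
    intro p q r hp hq hr
    have hP := hB.cutLe n
    have hb := one_le_pumpBound n
    simp only [pumpBound] at hp hq hr
    refine ⟨base (by omega), fun x₁ a x₂ hx => ?_⟩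
    obtain ⟨i, j, z₁, z₂, hij, hz, rfl, rfl⟩ := wpow_eq_append_cons hx
    have hsplit : ∀ i' j', wpow z (i' + (1 + j')) =
        (wpow z i' ++ z₁) ++ a :: (z₂ ++ wpow z j') := by
      intro i' j'
      rw [wpow_add, wpow_add, wpow_one]
      nth_rewrite 2 [hz]
      simp
    have right : ∀ i' j', i' + j' + 1 = r →
        cutLe B n (wpow z i) (wpow z q ++ v ++ wpow z i') →
        cutLe B n (wpow z j) (wpow z j') →
        ∃ y₁ y₂, wpow z q ++ v ++ wpow z r = y₁ ++ a :: y₂ ∧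
          cutLe B n (wpow z i ++ z₁) y₁ ∧ cutLe B n (z₂ ++ wpow z j) y₂ := by
      intro i' j' hr' hi hj
      refine ⟨(wpow z q ++ v ++ wpow z i') ++ z₁, z₂ ++ wpow z j', ?_,
        hP.append _ _ _ _ hi (hP.refl _), hP.append _ _ _ _ (hP.refl _) hj⟩
      rw [show r = i' + (1 + j') by omega, hsplit]
      simp
    by_cases hi : i < pumpBound n
    · refine ⟨wpow z i ++ z₁, z₂ ++ (wpow z (q - i - 1) ++ v ++ wpow z r), ?_, hP.refl _,
        hP.append _ _ _ _ (hP.refl _) (ih (by omega) (by omega) (by omega))⟩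
      rw [show q = i + (1 + (q - i - 1)) by omega, hsplit]
      simp
    · by_cases hj : j < pumpBound n
      · exact right (r - j - 1) j (by omega) (ih (by omega) (by omega) (by omega)) (hP.refl _)
      · exact right (pumpBound n) (r - pumpBound n - 1) (by omega)
          (ih (by omega) (by omega) le_rfl)
          (cutLe_wpow_wpow hB h₁ h₂ n (by omega) (by omega))

/-- The up-set of a word. -/
def up (R : List A → List A → Prop) (x : List A) : Set (List A) := {y | R x y}

/-- The up-set at level n+1 depends only on the base up-set and on the set of triples (letter, left
up-set, right up-set) given by the cuts, and there are finitely many such data. -/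
theorem finite_range_up_cutLe [Finite A] (hfin : (Set.range (up B)).Finite) (n : ℕ) :
    (Set.range (up (cutLe B n))).Finite := by
  induction n with
  | zero => exact hfin
  | succ n ih =>
    have := hfin.to_subtype
    have := ih.to_subtype
    let T := A × Set.range (up (cutLe B n)) × Set.range (up (cutLe B n))
    let φ : List A → Set.range (up B) × Set T := fun x =>
      (⟨up B x, x, rfl⟩, {t | ∃ x₁ a x₂, x = x₁ ++ a :: x₂ ∧
        t = (a, ⟨up (cutLe B n) x₁, x₁, rfl⟩, ⟨up (cutLe B n) x₂, x₂, rfl⟩)})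
    have key : ∀ x x', φ x = φ x' → up (cutLe B (n + 1)) x ⊆ up (cutLe B (n + 1)) x' := by
      intro x x' h y hy
      obtain ⟨h1, h2⟩ := Prod.mk.inj h
      refine ⟨?_, fun x₁ a x₂ hx => ?_⟩
      · have : y ∈ up B x := hy.1
        rw [Subtype.mk.inj h1] at this
        exact this
      · have hmem : (⟨a, ⟨up (cutLe B n) x₁, x₁, rfl⟩, ⟨up (cutLe B n) x₂, x₂, rfl⟩⟩ : T) ∈
            (φ x').2 := ⟨x₁, a, x₂, hx, rfl⟩
        rw [← h] at hmem
        obtain ⟨u₁, b, u₂, hu, he⟩ := hmem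
        obtain ⟨e0, e12⟩ := Prod.mk.inj he
        obtain ⟨e1, e2⟩ := Prod.mk.inj e12
        subst e0
        obtain ⟨y₁, y₂, hyy, h₁, h₂⟩ := hy.2 u₁ a u₂ hu
        refine ⟨y₁, y₂, hyy, ?_, ?_⟩
        · have : y₁ ∈ up (cutLe B n) u₁ := h₁
          rw [← Subtype.mk.inj e1] at this
          exact this
        · have : y₂ ∈ up (cutLe B n) u₂ := h₂
          rw [← Subtype.mk.inj e2] at this
          exact this
    refine (Set.toFinite (Set.range φ)).of_surjOn (fun t => ⋃ x ∈ φ ⁻¹' {t},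
      up (cutLe B (n + 1)) x) ?_
    rintro _ ⟨x, rfl⟩
    refine ⟨φ x, ⟨x, rfl⟩, ?_⟩
    refine subset_antisymm (Set.iUnion₂_subset fun x' hx' => key _ _ hx') ?_
    exact Set.subset_biUnion_of_mem (u := fun x => up (cutLe B (n + 1)) x)
      (Set.mem_preimage.2 rfl)

end CutLe

/-! ### Factorization forests, as an induction principle for families of languages -/

section Simon

variable {A M : Type*} [Monoid M]

/-- `α` is a monoid morphism from the words over `A` to `M`. -/
structure IsWordHom (α : List A → M) : Prop where
  nil : α [] = 1
  append : ∀ x y, α (x ++ y) = α x * α y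

/-- A family of languages closed under subsets, union, product, and star of languages that `α` maps
to a single idempotent, and which contains the letters. -/
structure IsForestFamily (α : List A → M) (F : Language A → Prop) : Prop where
  mono : ∀ X Y, X ≤ Y → F Y → F X
  union : ∀ X Y, F X → F Y → F (X + Y)
  mul : ∀ X Y, F X → F Y → F (X * Y)
  nil : F 1
  letter : ∀ a : A, F {[a]}
  star : ∀ e X, e * e = e → (∀ x ∈ X, α x = e) → F X → F (KStar.kstar X)

variable {α : List A → M} {F : Language A → Prop}

theorem IsForestFamily.iUnion (hF : IsForestFamily α F) {ι : Type*} [Finite ι]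
    (X : ι → Language A) (h : ∀ i, F (X i)) : F {w | ∃ i, w ∈ X i} := by
  classical
  have := Fintype.ofFinite ι
  have key : ∀ s : Finset ι, F {w | ∃ i ∈ s, w ∈ X i} := by
    intro s
    induction s using Finset.induction_on with
    | empty => exact hF.mono _ 1 (fun w hw => by obtain ⟨i, hi, -⟩ := hw; simp at hi) hF.nil
    | insert i s _ ih =>
      refine hF.mono _ _ ?_ (hF.union _ _ (h i) ih)
      rintro w ⟨j, hj, hw⟩
      rcases Finset.mem_insert.1 hj with rfl | hj
      · exact Or.inl hw
      · exact Or.inr ⟨j, hj, hw⟩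
  refine hF.mono _ _ ?_ (key Finset.univ)
  rintro w ⟨i, hw⟩
  exact ⟨i, Finset.mem_univ i, hw⟩

/-- Words that are products of elements of `X`, read by right multiplication from state `q` to
state `r`, with all intermediate states in `P`. -/
inductive Run (α : List A → M) (X : Language A) (P : Set M) : M → M → List A → Prop
  | nil (q : M) : Run α X P q q []
  | single (q : M) (x : List A) (hx : x ∈ X) : Run α X P q (q * α x) x
  | cons (q r : M) (x w : List A) (hx : x ∈ X) (hq : q * α x ∈ P)
      (h : Run α X P (q * α x) r w) : Run α X P q r (x ++ w)

/-- The language of the runs from `q` to `r`. -/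
def runLang (α : List A → M) (X : Language A) (P : Set M) (q r : M) : Language A :=
  {w | Run α X P q r w}

theorem Run.mul_eq (hα : IsWordHom α) {X : Language A} {P : Set M} {q r : M} {w : List A}
    (h : Run α X P q r w) : q * α w = r := by
  induction h with
  | nil q => rw [hα.nil, mul_one]
  | single q x hx => rfl
  | cons q r x w hx hq h ih => rw [hα.append, ← mul_assoc, ih]

theorem Run.mem_kstar {X : Language A} {P : Set M} {q r : M} {w : List A}
    (h : Run α X P q r w) : w ∈ KStar.kstar X := by
  induction h with
  | nil q => exact Language.nil_mem_kstar _
  | single q x hx => exact Language.mem_kstar.2 ⟨[x], by simp, by simpa using hx⟩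
  | cons q r x w hx hq h ih =>
    obtain ⟨l, rfl, hl⟩ := Language.mem_kstar.1 ih
    exact Language.mem_kstar.2 ⟨x :: l, by simp, by simpa using ⟨hx, hl⟩⟩

theorem append_mem_kstar {X : Language A} {x w : List A} (hx : x ∈ X)
    (hw : w ∈ KStar.kstar X) : x ++ w ∈ KStar.kstar X := by
  obtain ⟨l, rfl, hl⟩ := Language.mem_kstar.1 hw
  exact Language.mem_kstar.2 ⟨x :: l, by simp, by simpa using ⟨hx, hl⟩⟩

@[elab_as_elim]
theorem kstar_induction {X : Language A} {p : ∀ w, w ∈ KStar.kstar X → Prop}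
    (hnil : p [] (Language.nil_mem_kstar X))
    (hcons : ∀ x (hx : x ∈ X) w (hw : w ∈ KStar.kstar X), p w hw →
      p (x ++ w) (append_mem_kstar hx hw)) {w : List A}
    (hw : w ∈ KStar.kstar X) : p w hw := by
  obtain ⟨l, rfl, hl⟩ := Language.mem_kstar.1 hw
  induction l with
  | nil => exact hnil
  | cons x l ih =>
    have hl' := fun y hy => hl y (List.mem_cons_of_mem _ hy)
    have hw' := Language.mem_kstar.2 ⟨l, rfl, hl'⟩
    exact hcons x (hl x (by simp)) _ hw' (ih hl' hw')

theorem kstar_add_le (X Y : Language A) :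
    KStar.kstar (X + Y) ≤ KStar.kstar X * KStar.kstar (Y * KStar.kstar X) := by
  intro w hw
  induction hw using kstar_induction with
  | hnil => exact ⟨[], Language.nil_mem_kstar _, [], Language.nil_mem_kstar _, rfl⟩
  | hcons x hx w _ ih =>
    obtain ⟨u, hu, v, hv, rfl⟩ := ih
    rcases hx with hx | hx
    · exact ⟨x ++ u, append_mem_kstar hx hu, v, hv, by simp⟩
    · exact ⟨[], Language.nil_mem_kstar _, (x ++ u) ++ v,
        append_mem_kstar ⟨x, hx, u, hu, rfl⟩ hv, by simp⟩

/-- Kleene's elimination of a state: either the run never stops at p, or it is cut at its first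
visit to p, its returns to p, and its last departure. -/
theorem Run.insert {X : Language A} {P : Set M} {p q r : M} {w : List A}
    (h : Run α X (insert p P) q r w) :
    w ∈ runLang α X P q r + runLang α X P q p *
      (KStar.kstar (runLang α X P p p) * runLang α X P p r) := by
  induction h with
  | nil q => exact Or.inl (Run.nil q)
  | single q x hx => exact Or.inl (Run.single q x hx)
  | cons q r x w hx hq h ih =>
    rcases hq with hq | hq
    · rw [hq] at ih
      refine Or.inr ⟨x, ?_, w, ?_, rfl⟩
      · rw [← hq]; exact Run.single q x hx
      · rcases ih with ih | ⟨u, hu, _, ⟨v, hv, t, ht, rfl⟩, rfl⟩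
        · exact ⟨[], Language.nil_mem_kstar _, w, ih, rfl⟩
        · exact ⟨u ++ v, append_mem_kstar hu hv, t, ht, by simp⟩
    · rcases ih with ih | ⟨u, hu, v, hv, rfl⟩
      · exact Or.inl (Run.cons q r x w hx hq ih)
      · exact Or.inr ⟨x ++ u, Run.cons q p x u hx hq hu, v, hv, by simp⟩

/-- Isolate the part Y of X with value j, the rest being Z. Then X* is contained in Z*(YZ*)*, and
since j absorbs everything on its right, all of YZ* has the single idempotent value j. -/
theorem IsForestFamily.kstar_leftZero (hα : IsWordHom α) (hF : IsForestFamily α F)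
    (X : Language A) (hX : F X) (J : Finset M)
    (hJ : ∀ i ∈ J, ∀ j ∈ J, i * j = i) (h : ∀ x ∈ X, α x ∈ J) : F (KStar.kstar X) := by
  classical
  induction J using Finset.induction_on generalizing X with
  | empty =>
    refine hF.mono _ 1 (fun w hw => ?_) hF.nil
    induction hw using kstar_induction with
    | hnil => exact Language.nil_mem_one
    | hcons x hx => exact absurd (h x hx) (by simp)
  | insert j J _ ih =>
    let Y : Language A := {x | x ∈ X ∧ α x = j}
    let Z : Language A := {x | x ∈ X ∧ α x ∈ J}
    have hZ : F (KStar.kstar Z) := ih Z (hF.mono _ _ (fun x hx => hx.1) hX)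
      (fun i hi k hk => hJ i (Finset.mem_insert_of_mem hi) k (Finset.mem_insert_of_mem hk))
      (fun x hx => hx.2)
    have hY : F Y := hF.mono _ _ (fun x hx => hx.1) hX
    have hle : X ≤ Z + Y := by
      intro x hx
      rcases Finset.mem_insert.1 (h x hx) with h' | h'
      · exact Or.inr ⟨hx, h'⟩
      · exact Or.inl ⟨hx, h'⟩
    refine hF.mono _ _ ((kstar_mono hle).trans (kstar_add_le Z Y)) (hF.mul _ _ hZ ?_)
    refine hF.star j _ (hJ j (by simp) j (by simp)) ?_ (hF.mul _ _ hY hZ)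
    rintro _ ⟨y, hy, z, hz, rfl⟩
    induction hz using kstar_induction with
    | hnil => simpa using hy.2
    | hcons x hx w _ ihw =>
      simp only [hα.append] at ihw ⊢
      rw [hy.2] at ihw ⊢
      rw [← mul_assoc, hJ j (by simp) _ (Finset.mem_insert_of_mem hx.2), ihw]

/-- Induction on the size of a submonoid N containing the values of X. A word of X* is read as a run
by right multiplication on N. -/
theorem IsForestFamily.kstar_of_finset (hα : IsWordHom α) (hF : IsForestFamily α F)
    (c : ℕ) : ∀ (N : Finset M), N.card ≤ c → 1 ∈ N → (∀ m ∈ N, ∀ n ∈ N, m * n ∈ N) →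
    ∀ X : Language A, F X → (∀ x ∈ X, α x ∈ N) → F (KStar.kstar X) := by
  classical
  induction c with
  | zero =>
    intro N hN h1
    rw [Nat.le_zero, Finset.card_eq_zero] at hN
    simp [hN] at h1
  | succ c ih =>
    intro N hN h1 hmul X hX hXN
    have hstarN : ∀ w ∈ KStar.kstar X, α w ∈ N := by
      intro w hw
      induction hw using kstar_induction with
      | hnil => rwa [hα.nil]
      | hcons x hx w _ ihw => rw [hα.append]; exact hmul _ (hXN x hx) _ ihw
    -- The states of I are fixed by right multiplication by N, so I consists of left zeros. For p in
    -- N outside I the stabilizer of p is a proper submonoid, so loops at p fall under the induction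
    -- hypothesis, and the states outside I can be eliminated one at a time.
    let I : Finset M := N.filter fun q => ∀ m ∈ N, q * m = q
    have hrun : ∀ P : Finset M, P ⊆ N \ I → ∀ q r, F (runLang α X P q r) := by
      intro P
      induction P using Finset.induction_on with
      | empty =>
        intro _ q r
        refine hF.mono _ _ ?_ (hF.union _ _ hF.nil hX)
        intro w hw
        cases hw with
        | nil => exact Or.inl Language.nil_mem_one
        | single _ _ hx => exact Or.inr hx
        | cons => simp_all
      | insert p P _ ihP =>
        intro hP q r
        have hP' : P ⊆ N \ I := fun x hx => hP (Finset.mem_insert_of_mem hx)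
        have hp : p ∈ N \ I := hP (Finset.mem_insert_self _ _)
        have hloop : F (KStar.kstar (runLang α X P p p)) := by
          refine ih (N.filter fun m => p * m = p) ?_ ?_ ?_ _ (ihP hP' p p) ?_
          · have : N.filter (fun m => p * m = p) ⊂ N := by
              refine Finset.filter_ssubset.2 ?_
              by_contra hcon
              push Not at hcon
              exact (Finset.mem_sdiff.1 hp).2
                (Finset.mem_filter.2 ⟨(Finset.mem_sdiff.1 hp).1, hcon⟩)
            have := Finset.card_lt_card this
            omega
          · simp [h1]
          · intro m hm n hn
            rw [Finset.mem_filter] at hm hn ⊢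
            exact ⟨hmul _ hm.1 _ hn.1, by rw [← mul_assoc, hm.2, hn.2]⟩
          · intro w hw
            exact Finset.mem_filter.2 ⟨hstarN w hw.mem_kstar, hw.mul_eq hα⟩
        refine hF.mono _ _ ?_ (hF.union _ _ (ihP hP' q r)
          (hF.mul _ _ (ihP hP' q p) (hF.mul _ _ hloop (ihP hP' p r))))
        intro w hw
        rw [runLang, Finset.coe_insert] at hw
        exact Run.insert hw
    let P : Finset M := N \ I
    have hto : ∀ q, ∀ S : Finset M, F {w | ∃ r ∈ S, w ∈ runLang α X P q r} := by
      intro q S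
      refine hF.mono _ _ ?_ (hF.iUnion (fun r : S => runLang α X P q r)
        (fun r => hrun P subset_rfl q r))
      rintro w ⟨r, hr, hw⟩
      exact ⟨⟨r, hr⟩, hw⟩
    -- W collects the runs with all intermediate states outside I, Z those that moreover end in I.
    let W : M → Language A := fun q => {w | ∃ r ∈ N, w ∈ runLang α X P q r}
    let Z : M → Language A := fun q => {w | ∃ r ∈ I, w ∈ runLang α X P q r}
    have hZstar : F (KStar.kstar (Z 1)) := by
      refine hF.kstar_leftZero hα _ (hto 1 I) I ?_ ?_
      · intro i hi j hj
        exact (Finset.mem_filter.1 hi).2 j (Finset.mem_filter.1 hj).1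
      · rintro w ⟨r, hr, hw⟩
        have := Run.mul_eq hα hw
        rw [one_mul] at this
        rwa [this]
    -- Whenever the run reaches I it is restarted from the state 1. The factors between restarts
    -- have value in I, so their star is covered by the left zero case.
    have hdec : ∀ w ∈ KStar.kstar X, ∀ q ∈ N, w ∈ W q + Z q * (KStar.kstar (Z 1) * W 1) := by
      intro w hw
      induction hw using kstar_induction with
      | hnil => intro q hq; exact Or.inl ⟨q, hq, Run.nil q⟩
      | hcons x hx w _ ihw =>
        intro q hq
        have hqx : q * α x ∈ N := hmul _ hq _ (hXN x hx)
        by_cases hI : q * α x ∈ I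
        · refine Or.inr ⟨x, ⟨_, hI, Run.single q x hx⟩, w, ?_, rfl⟩
          rcases ihw 1 h1 with h | ⟨u, hu, _, ⟨v, hv, t, ht, rfl⟩, rfl⟩
          · exact ⟨[], Language.nil_mem_kstar _, w, h, rfl⟩
          · exact ⟨u ++ v, append_mem_kstar hu hv, t, ht, by simp⟩
        · have hP : q * α x ∈ (P : Set M) := by
            rw [Finset.mem_coe, Finset.mem_sdiff]; exact ⟨hqx, hI⟩
          rcases ihw _ hqx with ⟨r, hr, h⟩ | ⟨u, ⟨r, hr, hu⟩, v, hv, rfl⟩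
          · exact Or.inl ⟨r, hr, Run.cons q r x w hx hP h⟩
          · exact Or.inr ⟨x ++ u, ⟨r, hr, Run.cons q r x u hx hP hu⟩, v, hv, by simp⟩
    exact hF.mono _ _ (fun w hw => hdec w hw 1 h1)
      (hF.union _ _ (hto 1 N) (hF.mul _ _ (hto 1 I) (hF.mul _ _ hZstar (hto 1 N))))

/-- Simon's factorization forest theorem, as an induction principle. -/
theorem IsForestFamily.top [Finite A] [Finite M] (hα : IsWordHom α)
    (hF : IsForestFamily α F) : F ⊤ := by
  classical
  have := Fintype.ofFinite M
  have hX : F {w | ∃ a : A, w ∈ ({[a]} : Language A)} := hF.iUnion _ hF.letter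
  refine hF.mono _ _ (fun w hw => ?_) (hF.kstar_of_finset hα _ Finset.univ le_rfl (by simp)
    (by simp) _ hX (by simp))
  clear hw
  induction w with
  | nil => exact Language.nil_mem_kstar _
  | cons a w ih => exact append_mem_kstar (x := [a]) ⟨a, rfl⟩ ih

theorem isWordHom_prod : IsWordHom (List.prod : List M → M) :=
  ⟨List.prod_nil, fun _ _ => List.prod_append⟩

/-- A long enough word over a finite monoid has a nonempty factor with idempotent value. -/
theorem exists_infix_idempotent (V : Type*) [Monoid V] [Finite V] :
    ∃ R : ℕ, ∀ l : List V, R ≤ l.length →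
      ∃ b, b ≠ [] ∧ b <:+: l ∧ b.prod * b.prod = b.prod := by
  let F : Language V → Prop := fun X => ∃ R : ℕ, ∀ l ∈ X, R ≤ l.length →
      ∃ b, b ≠ [] ∧ b <:+: l ∧ b.prod * b.prod = b.prod
  have hF : IsForestFamily (List.prod : List V → V) F := by
    refine ⟨fun X Y h ⟨R, hR⟩ => ⟨R, fun l hl => hR l (h hl)⟩, ?_, ?_, ⟨1, ?_⟩,
      fun a => ⟨2, ?_⟩, ?_⟩
    · rintro X Y ⟨R, hR⟩ ⟨R', hR'⟩
      refine ⟨max R R', ?_⟩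
      rintro l (hl | hl) h
      · exact hR l hl (le_trans (le_max_left _ _) h)
      · exact hR' l hl (le_trans (le_max_right _ _) h)
    · rintro X Y ⟨R, hR⟩ ⟨R', hR'⟩
      refine ⟨R + R', ?_⟩
      rintro _ ⟨u, hu, v, hv, rfl⟩ h
      simp only [List.length_append] at h
      by_cases hlu : R ≤ u.length
      · obtain ⟨b, h1, h2, h3⟩ := hR u hu hlu
        exact ⟨b, h1, h2.trans (List.prefix_append u v).isInfix, h3⟩
      · obtain ⟨b, h1, h2, h3⟩ := hR' v hv (by omega)
        exact ⟨b, h1, h2.trans (List.suffix_append u v).isInfix, h3⟩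
    · intro l hl h
      rw [(Language.mem_one _).1 hl] at h
      simp at h
    · intro l hl h
      rw [show l = [a] from hl] at h
      simp at h
    -- A single nonempty block of X already has idempotent value, so R = 1 works.
    · rintro e X he hX -
      refine ⟨1, ?_⟩
      intro w hw
      induction hw using kstar_induction with
      | hnil => intro h; simp at h
      | hcons x hx w _ ih =>
        intro h
        by_cases hx' : x = []
        · subst hx'
          simpa using ih (by simpa using h)
        · exact ⟨x, hx', (List.prefix_append x w).isInfix, by rw [hX x hx, he]⟩
  obtain ⟨R, hR⟩ := hF.top isWordHom_prod
  exact ⟨R, fun l => hR l trivial⟩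

end Simon

/-! ### Completeness of saturated sets -/

section ListInfix

variable {A : Type*}

theorem infix_append_cases {x u v : List A} (h : x <:+: u ++ v) :
    x <:+: u ∨ x <:+: v ∨ ∃ u' v', x = u' ++ v' ∧ u' <:+ u ∧ v' <+: v := by
  obtain ⟨s, t, h⟩ := h
  rw [List.append_assoc, List.append_eq_append_iff] at h
  obtain ⟨w, hw, h'⟩ | ⟨w, rfl, h'⟩ := h
  · rw [List.append_eq_append_iff] at h'
    obtain ⟨z, rfl, -⟩ | ⟨z, rfl, hz⟩ := h'
    · exact Or.inl ⟨s, z, by rw [hw]; simp⟩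
    · exact Or.inr (Or.inr ⟨w, z, rfl, ⟨s, hw.symm⟩, ⟨t, hz.symm⟩⟩)
  · exact Or.inr (Or.inl ⟨w, t, by rw [h']; simp⟩)

theorem prefix_append_cases {x u v : List A} (h : x <+: u ++ v) :
    x <+: u ∨ ∃ v', x = u ++ v' ∧ v' <+: v := by
  obtain ⟨t, h⟩ := h
  rw [List.append_eq_append_iff] at h
  obtain ⟨w, rfl, -⟩ | ⟨w, rfl, h⟩ := h
  · exact Or.inl ⟨w, rfl⟩
  · exact Or.inr ⟨w, rfl, t, h.symm⟩

theorem prefix_flatten {x : List A} : ∀ {l : List (List A)}, x <+: l.flatten →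
    ∃ l' v, x = l'.flatten ++ v ∧ l' ⊆ l ∧ (v = [] ∨ ∃ y ∈ l, v <:+: y) := by
  intro l
  induction l generalizing x with
  | nil => intro h; exact ⟨[], [], by simpa using h, by simp, Or.inl rfl⟩
  | cons y l ih =>
    intro h
    rw [List.flatten_cons] at h
    rcases prefix_append_cases h with h | ⟨v', rfl, h'⟩
    · exact ⟨[], x, rfl, by simp, Or.inr ⟨y, by simp, h.isInfix⟩⟩
    · obtain ⟨l', v, rfl, hl, hv⟩ := ih h'
      refine ⟨y :: l', v, by simp, List.cons_subset_cons _ hl, ?_⟩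
      rcases hv with hv | ⟨z, hz, hv⟩
      · exact Or.inl hv
      · exact Or.inr ⟨z, List.mem_cons_of_mem _ hz, hv⟩

theorem infix_flatten {x : List A} : ∀ {l : List (List A)}, x <:+: l.flatten →
    ∃ u l' v, x = u ++ (l'.flatten ++ v) ∧ l' ⊆ l ∧ (u = [] ∨ ∃ y ∈ l, u <:+: y) ∧
      (v = [] ∨ ∃ y ∈ l, v <:+: y) := by
  intro l
  induction l with
  | nil => intro h; exact ⟨[], [], [], by simpa using h, by simp, Or.inl rfl, Or.inl rfl⟩
  | cons y l ih =>
    intro h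
    have lift : ∀ {v : List A}, (v = [] ∨ ∃ y ∈ l, v <:+: y) →
        (v = [] ∨ ∃ z ∈ y :: l, v <:+: z) := by
      rintro v (hv | ⟨z, hz, hv⟩)
      · exact Or.inl hv
      · exact Or.inr ⟨z, List.mem_cons_of_mem _ hz, hv⟩
    rw [List.flatten_cons] at h
    rcases infix_append_cases h with h | h | ⟨u, v', rfl, hu, hv'⟩
    · exact ⟨x, [], [], by simp, by simp, Or.inr ⟨y, by simp, h⟩, Or.inl rfl⟩
    · obtain ⟨u, l', v, rfl, hl, hu, hv⟩ := ih h
      exact ⟨u, l', v, rfl, fun z hz => List.mem_cons_of_mem _ (hl hz), lift hu, lift hv⟩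
    · obtain ⟨l', v, rfl, hl, hv⟩ := prefix_flatten hv'
      exact ⟨u, l', v, rfl, fun z hz => List.mem_cons_of_mem _ (hl hz),
        Or.inr ⟨y, by simp, hu.isInfix⟩, lift hv⟩

/-- Splitting a list at the first factor with property `Q`. -/
theorem exists_first_infix (Q : List A → Prop) (l : List A) (h : ∃ b, Q b ∧ b <:+: l) :
    ∃ p b r, l = p ++ (b ++ r) ∧ Q b ∧ (b ≠ [] → ∀ b', Q b' → ¬ b' <:+: p) := by
  induction l using List.reverseRecOn with
  | nil =>
    obtain ⟨b, hb, hl⟩ := h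
    obtain rfl : b = [] := by simpa using hl
    exact ⟨[], [], [], rfl, hb, by simp⟩
  | append_singleton l x ih =>
    by_cases hl : ∃ b, Q b ∧ b <:+: l
    · obtain ⟨p, b, r, rfl, hb, hp⟩ := ih hl
      exact ⟨p, b, r ++ [x], by simp, hb, hp⟩
    · push Not at hl
      obtain ⟨b, hb, p, s, hs⟩ := h
      rcases List.eq_nil_or_concat s with rfl | ⟨s', y, rfl⟩
      · refine ⟨p, b, [], by simpa using hs.symm, hb, fun hne b' hb' hp => ?_⟩
        rcases List.eq_nil_or_concat b with rfl | ⟨b₁, y, rfl⟩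
        · exact hne rfl
        · have hs' : (p ++ b₁) ++ [y] = l ++ [x] := by simpa using hs
          have := List.append_inj_left' hs' rfl
          exact hl b' hb' (hp.trans ⟨[], b₁, by simpa using this⟩)
      · have hs' : (p ++ b ++ s') ++ [y] = l ++ [x] := by simpa using hs
        have := List.append_inj_left' hs' rfl
        exact absurd ⟨p, s', this⟩ (hl b hb)

/-- Splitting a list at the last factor with property `Q`. -/
theorem exists_last_infix (Q : List A → Prop) (l : List A) (h : ∃ b, Q b ∧ b <:+: l) :
    ∃ p b r, l = p ++ (b ++ r) ∧ Q b ∧ (b ≠ [] → ∀ b', Q b' → ¬ b' <:+: r) := by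
  obtain ⟨b, hb, hl⟩ := h
  obtain ⟨p, b, r, h₁, h₂, h₃⟩ := exists_first_infix (fun b => Q b.reverse) l.reverse
    ⟨b.reverse, by simpa using hb, List.reverse_infix.2 hl⟩
  refine ⟨r.reverse, b.reverse, p.reverse, ?_, h₂, fun hne b' hb' hp => ?_⟩
  · rw [← List.reverse_reverse l, h₁]; simp
  · refine h₃ (by simpa using hne) b'.reverse (by simpa using hb') ?_
    rw [← List.reverse_reverse p]
    exact List.reverse_infix.2 hp

theorem exists_infix_of_infix_map {B : Type*} {f : A → B} {l : List A} {c : List B}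
    (h : c <:+: l.map f) : ∃ b, b <:+: l ∧ c = b.map f := by
  obtain ⟨s, t, h⟩ := h
  obtain ⟨l₁, l₂, rfl, h₁, h₂⟩ := List.map_eq_append_iff.1 h.symm
  obtain ⟨l₃, l₄, rfl, h₃, h₄⟩ := List.map_eq_append_iff.1 h₁
  exact ⟨l₄, ⟨l₃, l₂, rfl⟩, h₄.symm⟩

end ListInfix

/-! ### From factorization forests to a uniform level of approximation -/

section Saturation

variable {A G V : Type*} [Finite A] [Monoid G] [Finite G] [Monoid V] [Finite V]

/-- The common core of both completeness proofs. The approximations τ n decrease with n and are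
submultiplicative at the cost of one level, so unions and products in a factorization forest are
harmless. Only the star is hard: its blocks share the value g under γ but may have many values under
τ, and their number is unbounded. There `pump` absorbs an arbitrary middle part between two factors
with the same idempotent τ-value. -/
theorem exists_forall_saturated {γ : List A → G} (hγ : IsWordHom γ) {le : V → V → Prop}
    (le_refl : ∀ a, le a a) (le_trans : ∀ a b c, le a b → le b c → le a c)
    (le_mul : ∀ a b a' b', le a b → le a' b' → le (a * a') (b * b'))
    {Sat : V → Prop} (down : ∀ a b, le a b → Sat b → Sat a)
    (mul : ∀ a b, Sat a → Sat b → Sat (a * b)) {τ : ℕ → List A → V}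
    (anti : ∀ n x, le (τ (n + 1) x) (τ n x))
    (split : ∀ n x y, le (τ (n + 1) (x ++ y)) (τ n x * τ n y)) (n₀ : ℕ)
    (hnil : Sat (τ n₀ [])) (hletter : ∀ a, Sat (τ n₀ [a]))
    (pump : ∀ n, ∃ n', n ≤ n' ∧ ∀ g, g * g = g → ∀ l : List (List A), l ≠ [] →
      (∀ x ∈ l, γ x = g ∧ ∀ x', x' <:+: x → Sat (τ n x')) →
      (l.map (τ n')).prod * (l.map (τ n')).prod = (l.map (τ n')).prod →
      ∀ mid, γ mid = g → Sat ((l.map (τ n')).prod * τ n' mid * (l.map (τ n')).prod)) :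
    ∃ n, ∀ x, Sat (τ n x) := by
  classical
  have anti' : ∀ {m n}, m ≤ n → ∀ x, le (τ n x) (τ m x) := by
    intro m n hmn x
    induction hmn with
    | refl => exact le_refl _
    | step _ ih => exact le_trans _ _ _ (anti _ _) ih
  have satmono : ∀ {m n}, m ≤ n → ∀ {x}, Sat (τ m x) → Sat (τ n x) :=
    fun hmn x h => down _ _ (anti' hmn x) h
  have satappend : ∀ {n x y}, Sat (τ n x) → Sat (τ n y) → Sat (τ (n + 1) (x ++ y)) :=
    fun hx hy => down _ _ (split _ _ _) (mul _ _ hx hy)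
  -- All infixes are required to be saturated, because factors of a starred word may begin and end
  -- inside blocks.
  let F : Language A → Prop := fun X => ∃ n, n₀ ≤ n ∧ ∀ x ∈ X, ∀ x', x' <:+: x → Sat (τ n x')
  have hF : IsForestFamily γ F := by
    refine ⟨?_, ?_, ?_, ⟨n₀, le_rfl, ?_⟩, fun a => ⟨n₀, le_rfl, ?_⟩, ?_⟩
    · rintro X Y h ⟨n, hn, hR⟩
      exact ⟨n, hn, fun x hx => hR x (h hx)⟩
    · rintro X Y ⟨m, hm, hX⟩ ⟨n, hn, hY⟩
      refine ⟨max m n, hm.trans (le_max_left _ _), ?_⟩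
      rintro x (hx | hx) x' hx'
      · exact satmono (le_max_left _ _) (hX x hx x' hx')
      · exact satmono (le_max_right _ _) (hY x hx x' hx')
    · rintro X Y ⟨m, hm, hX⟩ ⟨n, hn, hY⟩
      refine ⟨max m n + 1, hm.trans ((le_max_left _ _).trans (Nat.le_succ _)), ?_⟩
      rintro _ ⟨x, hx, y, hy, rfl⟩ z hz
      rcases infix_append_cases hz with h | h | ⟨u, v, rfl, hu, hv⟩
      · exact satmono ((le_max_left _ _).trans (Nat.le_succ _)) (hX x hx z h)
      · exact satmono ((le_max_right _ _).trans (Nat.le_succ _)) (hY y hy z h)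
      · exact satappend (satmono (le_max_left _ _) (hX x hx u hu.isInfix))
          (satmono (le_max_right _ _) (hY y hy v hv.isInfix))
    · intro x hx x' hx'
      rw [(Language.mem_one _).1 hx, List.infix_nil] at hx'
      rwa [hx']
    · intro x hx x' hx'
      rw [show x = [a] from hx] at hx'
      obtain ⟨s, t, h⟩ := hx'
      have hlen := congrArg List.length h
      simp only [List.length_append, List.length_cons, List.length_nil] at hlen
      rcases x' with _ | ⟨b, x'⟩
      · exact hnil
      · simp only [List.length_cons] at hlen
        obtain rfl : s = [] := List.eq_nil_of_length_eq_zero (by omega)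
        obtain rfl : x' = [] := List.eq_nil_of_length_eq_zero (by omega)
        obtain rfl : b = a := by simpa using (List.cons.inj h).1
        exact hletter b
    · rintro g X hg hXg ⟨n, hn, hX⟩
      obtain ⟨n', hnn', hpump⟩ := pump n
      obtain ⟨R, hR⟩ := exists_infix_idempotent V
      let val : List (List A) → V := fun l => (l.map (τ n')).prod
      have hX1 : ∀ x ∈ X, Sat (τ n' x) := fun x hx =>
        satmono hnn' (hX x hx x List.infix_rfl)
      have hshort : ∀ b : List (List A), b ≠ [] →
          le (τ (n' + b.length) b.flatten) (val b) := by
        intro b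
        induction b with
        | nil => intro h; exact absurd rfl h
        | cons x b ih =>
          intro _
          by_cases hb : b = []
          · subst hb
            simpa [val] using anti' (Nat.le_add_right n' 1) x
          · have h1 := split (n' + b.length) x b.flatten
            refine le_trans _ _ _ h1 ?_
            simp only [val, List.map_cons, List.prod_cons]
            exact le_mul _ _ _ _ (anti' (Nat.le_add_right _ _) _) (ih hb)
      have hval : ∀ b : List (List A), b ≠ [] → (∀ x ∈ b, x ∈ X) → Sat (val b) := by
        intro b
        induction b with
        | nil => intro h; exact absurd rfl h
        | cons x b ih =>
          intro _ hb
          by_cases hb' : b = []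
          · subst hb'
            simpa [val] using hX1 x (hb x (by simp))
          · simp only [val, List.map_cons, List.prod_cons]
            exact mul _ _ (hX1 x (hb x (by simp)))
              (ih hb' fun y hy => hb y (List.mem_cons_of_mem _ hy))
      have hγl : ∀ b : List (List A), b ≠ [] → (∀ x ∈ b, x ∈ X) → γ b.flatten = g := by
        intro b
        induction b with
        | nil => intro h; exact absurd rfl h
        | cons x b ih =>
          intro _ hb
          have hx := hXg x (hb x (by simp))
          by_cases hb' : b = []
          · subst hb'; simpa using hx
          · rw [List.flatten_cons, hγ.append, hx,
              ih hb' fun y hy => hb y (List.mem_cons_of_mem _ hy), hg]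
      -- Splitting off the blocks one by one would cost a level per block. The induction is instead
      -- on a set J containing the idempotent values of the factors of length at most R. If J is
      -- empty the list has at most R blocks. Otherwise remove f from J: before the first and after
      -- the last factor of value f the smaller set suffices, and what lies between is pumped. Each
      -- removal costs four levels.
      have main : ∀ J : Finset V, ∃ N, n' + R ≤ N ∧ n₀ ≤ N ∧ ∀ l : List (List A),
          (∀ x ∈ l, x ∈ X) →
          (∀ b, b ≠ [] → b.length ≤ R → b <:+: l → val b * val b = val b → val b ∈ J) →
          Sat (τ N l.flatten) := by
        intro J
        induction J using Finset.induction_on with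
        | empty =>
          refine ⟨max (n' + R) n₀, le_max_left _ _, le_max_right _ _, fun l hl hJ => ?_⟩
          have hlen : l.length ≤ R := by
            by_contra hcon
            push Not at hcon
            obtain ⟨c, hc, hcl, hcc⟩ := hR ((l.take R).map (τ n')) (by simp; omega)
            obtain ⟨b, hb, rfl⟩ := exists_infix_of_infix_map hcl
            have := hJ b (by simpa using hc) (hb.length_le.trans (by simp))
              (hb.trans (List.take_prefix _ _).isInfix) hcc
            simp at this
          by_cases hl0 : l = []
          · subst hl0
            exact satmono (le_max_right _ _) hnil
          · exact satmono ((Nat.add_le_add_left hlen n').trans (le_max_left _ _))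
              (down _ _ (hshort l hl0) (hval l hl0 hl))
        | insert f J _ ih =>
          obtain ⟨N, hN₁, hN₂, hN⟩ := ih
          refine ⟨N + 4, by omega, by omega, fun l hl hJ => ?_⟩
          let Q : List (List A) → Prop := fun b =>
            b ≠ [] ∧ b.length ≤ R ∧ val b = f ∧ f * f = f
          have hfree : ∀ k, k <:+: l → (∀ b, Q b → ¬ b <:+: k) → Sat (τ N k.flatten) := by
            intro k hk hQ
            refine hN k (fun x hx => hl x (hk.subset hx)) fun b hb hbR hbk hbb => ?_
            rcases Finset.mem_insert.1 (hJ b hb hbR (hbk.trans hk) hbb) with h | h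
            · exact absurd hbk (hQ b ⟨hb, hbR, h, by rw [← h, hbb]⟩)
            · exact h
          have hQle : ∀ b, Q b → le (τ N b.flatten) f := by
            intro b hb
            rw [← hb.2.2.1]
            exact le_trans _ _ _ (anti' (by have := hb.2.1; omega) _) (hshort b hb.1)
          by_cases h1 : ∃ b, Q b ∧ b <:+: l
          · obtain ⟨p, b, r, rfl, hb, hp⟩ := exists_first_infix Q l h1
            have hp' := hfree p (List.prefix_append _ _).isInfix (hp hb.1)
            have hbl : ∀ x ∈ b, x ∈ X := fun x hx => hl x (by simp [hx])
            have hbf : Sat f := hb.2.2.1 ▸ hval b hb.1 hbl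
            by_cases h2 : ∃ b, Q b ∧ b <:+: r
            · obtain ⟨m, b', s, rfl, hb', hs⟩ := exists_last_infix Q r h2
              have hs' := hfree s ⟨p ++ (b ++ (m ++ b')), [], by simp⟩ (hs hb'.1)
              simp only [List.flatten_append]
              have e1 := split (N + 3) p.flatten
                (b.flatten ++ (m.flatten ++ (b'.flatten ++ s.flatten)))
              have e2 := split (N + 2) b.flatten (m.flatten ++ (b'.flatten ++ s.flatten))
              have e3 := split (N + 1) m.flatten (b'.flatten ++ s.flatten)
              have e4 := split N b'.flatten s.flatten
              -- The empty word need not have value g under γ, so `pump` is not available here; the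
              -- product f * f suffices.
              by_cases hm : m = []
              · subst hm
                simp only [List.flatten_nil, List.nil_append] at e2 ⊢
                have e2' := split (N + 2) b.flatten (b'.flatten ++ s.flatten)
                refine down _ _ (le_trans _ _ _ (split (N + 3) _ _) (le_mul _ _ _ _
                  (anti' (by omega : N ≤ N + 3) _)
                  (le_trans _ _ _ e2' (le_mul _ _ _ _ (le_trans _ _ _ (anti' (by omega) _)
                    (hQle b hb)) (le_trans _ _ _ (anti' (by omega : N + 1 ≤ N + 2) _)
                    (le_trans _ _ _ e4 (le_mul _ _ _ _ (hQle b' hb') (le_refl _)))))))) ?_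
                exact mul _ _ hp' (mul _ _ hbf (mul _ _ hbf hs'))
              · have hml : ∀ x ∈ m, x ∈ X := fun x hx => hl x (by simp [hx])
                have hP := hpump g hg b hb.1
                  (fun x hx => ⟨hXg x (hbl x hx), hX x (hbl x hx)⟩)
                  (by have := hb.2.2; simp only [val] at this; rw [this.1, this.2])
                  m.flatten (hγl m hm hml)
                rw [show (b.map (τ n')).prod = f from hb.2.2.1] at hP
                refine down _ _ (le_trans _ _ _ e1 (le_mul _ _ _ _ (anti' (by omega : N ≤ N + 3) _)
                  (le_trans _ _ _ e2 (le_mul _ _ _ _ (le_trans _ _ _ (anti' (by omega) _)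
                    (hQle b hb)) (le_trans _ _ _ e3 (le_mul _ _ _ _
                    (anti' (by omega : n' ≤ N + 1) _)
                    (le_trans _ _ _ e4 (le_mul _ _ _ _ (hQle b' hb') (le_refl _))))))))) ?_
                have hfin := mul _ _ hp' (mul _ _ hP hs')
                simpa only [mul_assoc] using hfin
            · push Not at h2
              have hr' := hfree r ⟨p ++ b, [], by simp⟩ h2
              simp only [List.flatten_append]
              refine satmono (by omega : N + 2 ≤ N + 4) (satappend (satmono (Nat.le_succ N) hp')
                (satappend (down _ _ (hQle b hb) hbf) hr'))
          · push Not at h1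
            exact satmono (by omega) (hfree l List.infix_rfl h1)
      have := Fintype.ofFinite V
      obtain ⟨N, hN₁, hN₂, hN⟩ := main Finset.univ
      refine ⟨N + 2, by omega, ?_⟩
      intro w hw x' hx'
      obtain ⟨l, rfl, hl⟩ := Language.mem_kstar.1 hw
      obtain ⟨u, l', v, rfl, hl', hu, hv⟩ := infix_flatten hx'
      have hpart : ∀ u, (u = [] ∨ ∃ y ∈ l, u <:+: y) → Sat (τ N u) := by
        rintro u (rfl | ⟨y, hy, hu⟩)
        · exact satmono hN₂ hnil
        · exact satmono (by omega) (hX y (hl y hy) u hu)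
      exact satappend (satmono (Nat.le_succ N) (hpart u hu))
        (satappend (hN l' (fun x hx => hl x (hl' hx)) (by simp)) (hpart v hv))
  obtain ⟨n, -, hn⟩ := hF.top hγ
  exact ⟨n, fun x => hn x trivial x List.infix_rfl⟩

end Saturation

open scoped Pointwise

/-! ### Saturated sets for one polynomial closure -/

section PolClosed

variable {A M W : Type*} [Monoid M] [Monoid W]

/-- Every element of `Θ` lies below some element of `Ξ`. -/
def Dom (le : W → W → Prop) (Θ Ξ : Set W) : Prop := ∀ w ∈ Θ, ∃ u ∈ Ξ, le w u

/-- Sets of pairs in `M × Set W` closed under the inference rules for polynomial closure. -/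
structure PolClosed (α : List A → M) (val : A → W) (le : W → W → Prop) (gap : M → Set W)
    (P : M → Set W → Prop) : Prop where
  one : P 1 {1}
  letter : ∀ a, P (α [a]) {val a}
  mul : ∀ m Θ m' Θ', P m Θ → P m' Θ' → P (m * m') (Θ * Θ')
  down : ∀ m Θ Θ', P m Θ → Dom le Θ' Θ → P m Θ'
  pump : ∀ e Θ, P e Θ → e * e = e → Dom le Θ (Θ * Θ) → P e (Θ * gap e * Θ)

/-- A monoid preorder. -/
structure IsMonoidPreorder (le : W → W → Prop) : Prop where
  refl : ∀ a, le a a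
  trans : ∀ a b c, le a b → le b c → le a c
  mul : ∀ a b a' b', le a b → le a' b' → le (a * a') (b * b')

variable {α : List A → M} {val : A → W} {le : W → W → Prop} {gap : M → Set W}
  {E : List A → List A → Prop}

theorem Dom.mul (hle : IsMonoidPreorder le) {Θ₁ Θ₂ Θ₁' Θ₂' : Set W} (h₁ : Dom le Θ₁ Θ₁')
    (h₂ : Dom le Θ₂ Θ₂') : Dom le (Θ₁ * Θ₂) (Θ₁' * Θ₂') := by
  rintro _ ⟨a, ha, b, hb, rfl⟩
  obtain ⟨a', ha', haa⟩ := h₁ a ha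
  obtain ⟨b', hb', hbb⟩ := h₂ b hb
  exact ⟨a' * b', Set.mul_mem_mul ha' hb', hle.mul _ _ _ _ haa hbb⟩

theorem Dom.trans (hle : IsMonoidPreorder le) {Θ₁ Θ₂ Θ₃ : Set W} (h₁ : Dom le Θ₁ Θ₂)
    (h₂ : Dom le Θ₂ Θ₃) : Dom le Θ₁ Θ₃ := by
  intro a ha
  obtain ⟨b, hb, hab⟩ := h₁ a ha
  obtain ⟨c, hc, hbc⟩ := h₂ b hb
  exact ⟨c, hc, hle.trans _ _ _ hab hbc⟩

theorem Dom.of_subset (hle : IsMonoidPreorder le) {Θ₁ Θ₂ : Set W} (h : Θ₁ ⊆ Θ₂) :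
    Dom le Θ₁ Θ₂ := fun a ha => ⟨a, h ha, hle.refl a⟩

theorem wordHom_wpow (hα : IsWordHom α) {x : List A} {e : M} (hx : α x = e) (he : e * e = e)
    {n : ℕ} (hn : 1 ≤ n) : α (wpow x n) = e := by
  induction n, hn using Nat.le_induction with
  | base => rwa [wpow_one]
  | succ n _ ih => rw [wpow_succ, hα.append, hx, ih, he]

/-- The set of pairs realized by arbitrarily good approximations is closed. -/
theorem polClosed_semantic {ι : Type*} (κ : ι → ℕ) (D : ι → List A → W → Prop)
    (hα : IsWordHom α) (hE : IsPrecongruence E) (hEα : ∀ x y, α x = α y → E x y)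
    (hDnil : ∀ i, D i [] 1) (hDletter : ∀ i a, D i [a] (val a))
    (hDmul : ∀ i x y u v, D i x u → D i y v → D i (x ++ y) (u * v))
    (hDdown : ∀ i x u v, le u v → D i x v → D i x u)
    (hgap : ∀ y, ∀ w ∈ gap (α y), ∀ i, ∃ z, E y z ∧ D i z w) :
    PolClosed α val le gap
      (fun m Θ => ∀ i, ∃ y, α y = m ∧ ∀ w ∈ Θ, ∃ x, cutLe E (κ i) y x ∧ D i x w) := by
  refine ⟨fun i => ⟨[], hα.nil, ?_⟩, fun a i => ⟨[a], rfl, ?_⟩, ?_, ?_, ?_⟩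
  · rintro w rfl
    exact ⟨[], (hE.cutLe _).refl _, hDnil i⟩
  · rintro w rfl
    exact ⟨[a], (hE.cutLe _).refl _, hDletter i a⟩
  · intro m Θ m' Θ' h h' i
    obtain ⟨y, hy, hΘ⟩ := h i
    obtain ⟨y', hy', hΘ'⟩ := h' i
    refine ⟨y ++ y', by rw [hα.append, hy, hy'], ?_⟩
    rintro _ ⟨u, hu, v, hv, rfl⟩
    obtain ⟨x, hx, hxu⟩ := hΘ u hu
    obtain ⟨x', hx', hxv⟩ := hΘ' v hv
    exact ⟨x ++ x', (hE.cutLe _).append _ _ _ _ hx hx', hDmul _ _ _ _ _ hxu hxv⟩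
  · intro m Θ Θ' h hd i
    obtain ⟨y, hy, hΘ⟩ := h i
    refine ⟨y, hy, fun w hw => ?_⟩
    obtain ⟨w', hw', hww⟩ := hd w hw
    obtain ⟨x, hx, hxw⟩ := hΘ w' hw'
    exact ⟨x, hx, hDdown _ _ _ _ hww hxw⟩
  · intro e Θ h he hd i
    obtain ⟨y, hy, hΘ⟩ := h i
    -- Since Θ lies below Θ * Θ, each of its elements can be factored again and again inside Θ, so
    -- every power of y realizes Θ as well.
    have hpow : ∀ N, 1 ≤ N → ∀ w ∈ Θ, ∃ x, cutLe E (κ i) (wpow y N) x ∧ D i x w := by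
      intro N hN
      induction N, hN using Nat.le_induction with
      | base => simpa only [wpow_one] using hΘ
      | succ N _ ih =>
        intro w hw
        obtain ⟨_, ⟨u, hu, v, hv, rfl⟩, hle⟩ := hd w hw
        obtain ⟨x, hx, hxu⟩ := hΘ u hu
        obtain ⟨x', hx', hxv⟩ := ih v hv
        refine ⟨x ++ x', ?_, hDdown _ _ _ _ hle (hDmul _ _ _ _ _ hxu hxv)⟩
        rw [wpow_succ]
        exact (hE.cutLe _).append _ _ _ _ hx hx'
    have hN := one_le_pumpBound (κ i)
    have hyy : α y = α (y ++ y) := by rw [hα.append, hy, he]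
    -- With N the pump bound, y^N lies below y^N z y^N, where z realizes the gap element. The outer
    -- powers are then replaced by words above them that realize the two elements of Θ.
    refine ⟨wpow y (pumpBound (κ i)), wordHom_wpow hα hy he hN, ?_⟩
    rintro _ ⟨_, ⟨u, hu, g, hg, rfl⟩, v, hv, rfl⟩
    obtain ⟨x, hx, hxu⟩ := hpow _ hN u hu
    obtain ⟨x', hx', hxv⟩ := hpow _ hN v hv
    rw [← hy] at hg
    obtain ⟨z, hz, hzg⟩ := hgap y g hg i
    refine ⟨x ++ z ++ x', ?_, hDmul _ _ _ _ _ (hDmul _ _ _ _ _ hxu hzg) hxv⟩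
    refine (hE.cutLe _).trans _ _ _ (cutLe_wpow_insert hE (hEα _ _ hyy) (hEα _ _ hyy.symm) hz _
      le_rfl le_rfl le_rfl) ?_
    exact (hE.cutLe _).append _ _ _ _ ((hE.cutLe _).append _ _ _ _ hx ((hE.cutLe _).refl _)) hx'

theorem prod_map_fst_of_idempotent {V : Type*} [Monoid V] {g : M} (hg : g * g = g)
    (f : List A → M × V) (l : List (List A)) (hl : l ≠ []) (h : ∀ x ∈ l, (f x).1 = g) :
    (l.map f).prod.1 = g := by
  induction l with
  | nil => exact absurd rfl hl
  | cons x l ih =>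
    by_cases hl' : l = []
    · subst hl'; simpa using h x (by simp)
    · simp only [List.map_cons, List.prod_cons, Prod.fst_mul]
      rw [h x (by simp), ih hl' fun y hy => h y (List.mem_cons_of_mem _ hy), hg]

theorem prod_map_of_mul {V : Type*} [Monoid V] {Sat : V → Prop}
    (mul : ∀ a b, Sat a → Sat b → Sat (a * b))
    (f : List A → V) (l : List (List A)) (hl : l ≠ []) (h : ∀ x ∈ l, Sat (f x)) :
    Sat (l.map f).prod := by
  induction l with
  | nil => exact absurd rfl hl
  | cons x l ih =>
    by_cases hl' : l = []
    · subst hl'; simpa using h x (by simp)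
    · simp only [List.map_cons, List.prod_cons]
      exact mul _ _ (h x (by simp)) (ih hl' fun y hy => h y (List.mem_cons_of_mem _ hy))

/-- A closed set contains the pairs realized by some fixed approximation. -/
theorem PolClosed.exists_level [Finite A] [Finite M] [Finite W] {P : M → Set W → Prop}
    (hP : PolClosed α val le gap P) (hle : IsMonoidPreorder le) (hα : IsWordHom α)
    (hE : IsPrecongruence E) (D : ℕ → List A → W → Prop)
    (hDanti : ∀ n x w, D (n + 1) x w → D n x w)
    (hDsplit : ∀ n x x' w, D (n + 1) (x ++ x') w →
      ∃ u u', le w (u * u') ∧ D n x u ∧ D n x' u')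
    (hDletter : ∀ a w, D 0 [a] w → le w (val a))
    (hDgap : ∀ y x w, E y x → D 0 x w → ∃ w' ∈ gap (α y), le w w') :
    ∃ n, ∀ y, P (α y) {w | ∃ x, cutLe E n y x ∧ D n x w} := by
  let V := M × Set W
  let τ : ℕ → List A → V := fun n y => (α y, {w | ∃ x, cutLe E n y x ∧ D n x w})
  let le' : V → V → Prop := fun a b => a.1 = b.1 ∧ Dom le a.2 b.2
  have hD0 : ∀ n x w, D n x w → D 0 x w := by
    intro n
    induction n with
    | zero => exact fun _ _ h => h
    | succ n ih => exact fun x w h => ih x w (hDanti n x w h)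
  -- Pumping the unit puts the gap between two trivial factors.
  have hone : P 1 (gap 1) := by
    have h := hP.pump 1 {1} hP.one (one_mul 1) (Dom.of_subset hle (by simp))
    refine hP.down _ _ _ h (Dom.of_subset hle fun w hw => ?_)
    exact ⟨1 * w, ⟨1, rfl, w, hw, rfl⟩, 1, rfl, by simp⟩
  have hnil : ∀ x w, E [] x → D 0 x w → ∃ w' ∈ gap 1, le w w' := by
    intro x w hx hw
    have := hDgap [] x w hx hw
    rwa [hα.nil] at this
  obtain ⟨n, hn⟩ := exists_forall_saturated (le := le') (Sat := fun v : V => P v.1 v.2) (τ := τ)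
    hα (fun a => ⟨rfl, Dom.of_subset hle subset_rfl⟩)
    (fun a b c h h' => ⟨h.1.trans h'.1, h.2.trans hle h'.2⟩)
    (fun a b a' b' h h' => ⟨congrArg₂ (· * ·) h.1 h'.1, h.2.mul hle h'.2⟩)
    (fun a b h hb => by
      have := hP.down _ _ _ hb h.2
      rwa [← h.1] at this)
    (fun a b ha hb => hP.mul _ _ _ _ ha hb)
    (fun n x => ⟨rfl, Dom.of_subset hle fun w ⟨y, hy, hw⟩ => ⟨y, hy.of_succ, hDanti _ _ _ hw⟩⟩)
    (fun n x y => ⟨hα.append x y, by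
      rintro w ⟨z, hz, hw⟩
      obtain ⟨z₁, z₂, rfl, h₁, h₂⟩ := hz.split hE
      obtain ⟨u, u', hle', hu, hu'⟩ := hDsplit _ _ _ _ hw
      exact ⟨u * u', ⟨u, ⟨z₁, h₁, hu⟩, u', ⟨z₂, h₂, hu'⟩, rfl⟩, hle'⟩⟩)
    2
    (by
      change P (α []) _
      rw [hα.nil]
      refine hP.down _ _ _ hone ?_
      rintro w ⟨x, hx, hw⟩
      exact hnil x w hx.base (hD0 _ _ _ hw))
    -- A word above the letter a has the form x₀ a x₁ with both sides in the gap of 1. Isolating the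
    -- three factors applies `hDsplit` twice, hence the starting level 2.
    (fun a => by
      have h := hP.mul _ _ _ _ hone (hP.mul _ _ _ _ (hP.letter a) hone)
      rw [one_mul, mul_one] at h
      refine hP.down _ _ _ h ?_
      rintro w ⟨x, hx, hw⟩
      obtain ⟨x₀, x₁, rfl, h₀, h₁⟩ := hx.2 [] a [] rfl
      obtain ⟨u, u', hle', hu, hu'⟩ := hDsplit _ _ _ _ hw
      obtain ⟨v, v', hle'', hv, hv'⟩ := hDsplit 0 [a] x₁ u' hu'
      obtain ⟨b, hb, hub⟩ := hnil x₀ u h₀.base (hD0 _ _ _ hu)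
      obtain ⟨c, hc, hvc⟩ := hnil x₁ v' h₁.base hv'
      exact ⟨b * (val a * c), ⟨b, hb, _, ⟨val a, rfl, c, hc, rfl⟩, rfl⟩,
        hle.trans _ _ _ hle' (hle.mul _ _ _ _ hub
          (hle.trans _ _ _ hle'' (hle.mul _ _ _ _ (hDletter a v hv) hvc)))⟩)
    -- Idempotence of f gives the premise of the pumping rule with equality. The middle word matters
    -- only through the base relation, which places everything above it below the gap.
    (fun n => ⟨n, le_rfl, fun g hg l hl hx hf mid hmid => by
      set f := (l.map (τ n)).prod with hfdef
      have hf1 : f.1 = g := prod_map_fst_of_idempotent hg (τ n) l hl fun x hxl => (hx x hxl).1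
      have hfS : P f.1 f.2 := prod_map_of_mul (Sat := fun v : V => P v.1 v.2)
        (fun a b ha hb => hP.mul _ _ _ _ ha hb) (τ n) l hl
        fun x hxl => (hx x hxl).2 x List.infix_rfl
      have hf2 : f.2 * f.2 = f.2 := congrArg Prod.snd hf
      rw [hf1] at hfS
      have h := hP.pump g f.2 hfS hg (by rw [hf2]; exact Dom.of_subset hle subset_rfl)
      change P (f.1 * α mid * f.1) (f.2 * {w | ∃ x, cutLe E n mid x ∧ D n x w} * f.2)
      rw [hf1, hmid, hg, hg]
      refine hP.down _ _ _ h (Dom.mul hle (Dom.mul hle (Dom.of_subset hle subset_rfl) ?_)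
        (Dom.of_subset hle subset_rfl))
      rintro w ⟨x, hx, hw⟩
      rw [← hmid]
      exact hDgap mid x w hx.base (hD0 _ _ _ hw)⟩)
  exact ⟨n, hn⟩

end PolClosed

universe u

open scoped Pointwise

/-! ### Saturated sets for two nested polynomial closures -/

section PBClosed

variable {A M : Type*} [Monoid M]

/-- The order on `M × Set M`: equality on `M`, inclusion on `Set M`. -/
def ratedLe (u v : M × Set M) : Prop := u.1 = v.1 ∧ u.2 ⊆ v.2

theorem isMonoidPreorder_ratedLe : IsMonoidPreorder (ratedLe : M × Set M → M × Set M → Prop) :=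
  ⟨fun _ => ⟨rfl, subset_rfl⟩, fun _ _ _ h h' => ⟨h.1.trans h'.1, h.2.trans h'.2⟩,
    fun _ _ _ _ h hk => ⟨congrArg₂ (· * ·) h.1 hk.1, Set.mul_subset_mul h.2 hk.2⟩⟩

/-- Pairs of sets closed under the inference rules for nested polynomial closure. -/
structure PBClosed (α : List A → M) (same : M → M → Prop) (S : M → Set M → Prop)
    (P : M → Set (M × Set M) → Prop) : Prop where
  pol : PolClosed α (fun a => (α [a], {α [a]})) ratedLe
    (fun e => {w | S w.1 w.2 ∧ same w.1 e}) P
  one : S 1 {1}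
  letter : ∀ a, S (α [a]) {α [a]}
  mul : ∀ m T m' T', S m T → S m' T' → S (m * m') (T * T')
  down : ∀ m T T', S m T → T' ⊆ T → S m T'
  pump : ∀ e T, S e T → e * e = e → T ⊆ T * T →
    S e (T * {m | ∃ Θ, P m Θ ∧ ∃ T', (e, T') ∈ Θ ∧ T ⊆ T'} * T)

variable {α : List A → M} {same : M → M → Prop} {E : List A → List A → Prop}

/-- The base relation of the upper level. -/
def cutGe (E : List A → List A → Prop) (k : ℕ) (x y : List A) : Prop := cutLe E k y x

theorem isPrecongruence_cutGe (hE : IsPrecongruence E) (k : ℕ) :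
    IsPrecongruence (cutGe E k) :=
  ⟨fun x => (hE.cutLe k).refl x, fun _ _ _ h h' => (hE.cutLe k).trans _ _ _ h' h,
    fun _ _ _ _ h hk => (hE.cutLe k).append _ _ _ _ h hk⟩

/-- The preorder of the upper level. -/
def sqLe (E : List A → List A → Prop) (k n : ℕ) : List A → List A → Prop := cutLe (cutGe E k) n

theorem isPrecongruence_sqLe (hE : IsPrecongruence E) (k n : ℕ) :
    IsPrecongruence (sqLe E k n) := (isPrecongruence_cutGe hE k).cutLe n

/-- The values realized by arbitrarily good approximations. -/
def semS (α : List A → M) (E : List A → List A → Prop) (m : M) (T : Set M) : Prop :=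
  ∀ k n, ∃ x, α x = m ∧ T ⊆ α '' up (sqLe E k n) x

/-- The pairs realized by arbitrarily good approximations. -/
def semP (α : List A → M) (E : List A → List A → Prop) (m : M) (Θ : Set (M × Set M)) : Prop :=
  ∀ i : ℕ × ℕ, ∃ y, α y = m ∧ ∀ w ∈ Θ, ∃ x, cutLe E i.1 y x ∧
    (α x = w.1 ∧ w.2 ⊆ α '' up (sqLe E i.1 i.2) x)

theorem image_up_append (hα : IsWordHom α) {R : List A → List A → Prop} (hR : IsPrecongruence R)
    {x y : List A} {T T' : Set M} (hx : T ⊆ α '' up R x) (hy : T' ⊆ α '' up R y) :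
    T * T' ⊆ α '' up R (x ++ y) := by
  rintro _ ⟨t, ht, t', ht', rfl⟩
  obtain ⟨u, hu, rfl⟩ := hx ht
  obtain ⟨v, hv, rfl⟩ := hy ht'
  exact ⟨u ++ v, hR.append _ _ _ _ hu hv, hα.append _ _⟩

/-- One word of value e has to realize T m T for all admissible m at once. Each m comes with a word
y_m below some x_m in ≤_k, where x_m has value e and realizes T. Since the upper base relation
reverses ≤_k, a factor may be replaced by one below it, so y_m can be inserted in a long power of a
word that contains enough copies of x_m. -/
theorem semS_pump [Finite M] (hα : IsWordHom α) (hE : IsPrecongruence E)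
    (hEα : ∀ x y, α x = α y → E x y) {e : M} {T : Set M} (hS : semS α E e T) (he : e * e = e)
    (hT : T ⊆ T * T) :
    semS α E e (T * {m | ∃ Θ, semP α E m Θ ∧ ∃ T', (e, T') ∈ Θ ∧ T ⊆ T'} * T) := by
  classical
  set V : Set M := {m | ∃ Θ, semP α E m Θ ∧ ∃ T', (e, T') ∈ Θ ∧ T ⊆ T'} with hV
  intro k n
  have hle := hE.cutLe k
  have hsq := isPrecongruence_sqLe hE k n
  let Up : List A → Prop := fun x => T ⊆ α '' up (sqLe E k n) x
  have hUp : ∀ {x y}, Up x → Up y → Up (x ++ y) := fun hx hy =>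
    hT.trans (image_up_append hα hsq hx hy)
  have hUpPow : ∀ {x}, Up x → ∀ {N}, 1 ≤ N → Up (wpow x N) := by
    intro x hx N hN
    induction N, hN using Nat.le_induction with
    | base => rwa [wpow_one]
    | succ N _ ih => rw [wpow_succ]; exact hUp hx ih
  have hUpPow' : ∀ {x y}, Up x → Up y → ∀ N, Up (wpow x N ++ y) := by
    intro x y hx hy N
    induction N with
    | zero => simpa using hy
    | succ N ih => rw [wpow_succ, List.append_assoc]; exact hUp hx ih
  have hchoose : ∀ m : M, ∃ p : List A × List A, m ∈ V →
      (α p.1 = m ∧ cutLe E k p.1 p.2 ∧ α p.2 = e ∧ Up p.2) := by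
    intro m
    by_cases hm : m ∈ V
    · obtain ⟨Θ, hΘ, T', hT', hTT'⟩ := hm
      obtain ⟨y, hy, h⟩ := hΘ (k, n)
      obtain ⟨x, hx, hx', hxT⟩ := h _ hT'
      exact ⟨(y, x), fun _ => ⟨hy, hx, hx', hTT'.trans hxT⟩⟩
    · exact ⟨([], []), fun h => absurd h hm⟩
  choose yx hyx using hchoose
  have hVfin : V.Finite := V.toFinite
  let l : List M := hVfin.toFinset.toList
  have hl : ∀ m, m ∈ l ↔ m ∈ V := by simp [l]
  by_cases hl0 : l = []
  -- Without admissible values the target set is empty, so any word of value e will do.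
  · obtain ⟨x, hx, -⟩ := hS k n
    refine ⟨x, hx, ?_⟩
    rintro _ ⟨_, ⟨_, _, m, hm, rfl⟩, _, _, rfl⟩
    rw [← hl, hl0] at hm
    simp at hm
  set N := pumpBound k with hN
  have hN1 : 1 ≤ N := one_le_pumpBound k
  let b : M → List A := fun m => wpow (yx m).2 N
  have hbe : ∀ m ∈ l, α (b m) = e := fun m hm =>
    wordHom_wpow hα (hyx m ((hl m).1 hm)).2.2.1 he hN1
  have hbUp : ∀ m ∈ l, Up (b m) := fun m hm => hUpPow (hyx m ((hl m).1 hm)).2.2.2 hN1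
  have hUpL : ∀ (l' : List M), l' ⊆ l → ∀ {x}, Up x → Up ((l'.map b).flatten ++ x) := by
    intro l' hl' x hx
    induction l' with
    | nil => simpa using hx
    | cons m l' ih =>
      simp only [List.map_cons, List.flatten_cons, List.append_assoc]
      exact hUp (hbUp m (hl' (by simp))) (ih fun z hz => hl' (List.mem_cons_of_mem _ hz))
  have hUpR : ∀ (l' : List M), l' ⊆ l → ∀ {x}, Up x → Up (x ++ (l'.map b).flatten) := by
    intro l' hl'
    induction l' with
    | nil => intro x hx; simpa using hx
    | cons m l' ih =>
      intro x hx
      simp only [List.map_cons, List.flatten_cons]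
      rw [← List.append_assoc]
      exact ih (fun z hz => hl' (List.mem_cons_of_mem _ hz)) (hUp hx (hbUp m (hl' (by simp))))
  -- The word x₀ contains a long power of x_m for every admissible m, so the final witness does not
  -- depend on m.
  set x₀ : List A := (l.map b).flatten with hx₀
  have hx₀e : α x₀ = e := by
    have : ∀ l' : List M, l' ≠ [] → l' ⊆ l → α (l'.map b).flatten = e := by
      intro l'
      induction l' with
      | nil => intro h; exact absurd rfl h
      | cons m l' ih =>
        intro _ hsub
        rw [List.map_cons, List.flatten_cons, hα.append, hbe m (hsub (by simp))]
        by_cases hl' : l' = []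
        · subst hl'; simp [hα.nil]
        · rw [ih hl' fun z hz => hsub (List.mem_cons_of_mem _ hz), he]
    exact this l hl0 (fun _ h => h)
  -- Passing to this power makes z equivalent to z ++ z for ≤_k, which is the idempotence required
  -- when `cutLe_wpow_insert` is applied over the base `cutGe E k`.
  set z := wpow x₀ N with hz
  have hze : α z = e := wordHom_wpow hα hx₀e he hN1
  have hx₀x₀ : α x₀ = α (x₀ ++ x₀) := by rw [hα.append, hx₀e, he]
  have hzz : cutLe E k z (z ++ z) ∧ cutLe E k (z ++ z) z := by
    rw [hz, ← wpow_add]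
    exact ⟨cutLe_wpow_wpow hE (hEα _ _ hx₀x₀) (hEα _ _ hx₀x₀.symm) k le_rfl (by omega),
      cutLe_wpow_wpow hE (hEα _ _ hx₀x₀) (hEα _ _ hx₀x₀.symm) k (by omega) le_rfl⟩
  refine ⟨wpow z (pumpBound n), wordHom_wpow hα hze he (one_le_pumpBound n), ?_⟩
  rintro _ ⟨_, ⟨t₁, ht₁, m, hm, rfl⟩, t₂, ht₂, rfl⟩
  obtain ⟨hym, hyxm, hxe, hxUp⟩ := hyx m hm
  obtain ⟨l₁, l₂, hl12⟩ := List.append_of_mem ((hl m).2 hm)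
  have hl₁ : l₁ ⊆ l := fun z hz => by rw [hl12]; simp [hz]
  have hl₂ : l₂ ⊆ l := fun z hz => by rw [hl12]; simp [hz]
  have hbm := hbUp m ((hl m).2 hm)
  let pre := (l₁.map b).flatten ++ b m
  let post := b m ++ (l₂.map b).flatten
  have hx₀' : x₀ = (l₁.map b).flatten ++ b m ++ (l₂.map b).flatten := by
    rw [hx₀, hl12]; simp
  have hx₀Up : Up x₀ := by
    rw [hx₀']
    exact hUpR l₂ hl₂ (hUpL l₁ hl₁ hbm)
  -- The prefix ends with x_m^N and the suffix starts with it. Replacing y_m by x_m gives x_m^(2N+1)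
  -- in the middle, which ≤_k does not distinguish from x_m^N.
  have hv : cutLe E k (pre ++ (yx m).1 ++ post) x₀ := by
    refine hle.trans _ _ _ (hle.append _ _ _ _ (hle.append _ _ _ _ (hle.refl pre) hyxm)
      (hle.refl post)) ?_
    have e1 : pre ++ (yx m).2 ++ post =
        (l₁.map b).flatten ++ wpow (yx m).2 (N + 1 + N) ++ (l₂.map b).flatten := by
      simp [pre, post, b, wpow_add, wpow_one]
    rw [e1, hx₀']
    have hxx : α (yx m).2 = α ((yx m).2 ++ (yx m).2) := by rw [hα.append, hxe, he]
    exact hle.append _ _ _ _ (hle.append _ _ _ _ (hle.refl _)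
      (cutLe_wpow_wpow hE (hEα _ _ hxx) (hEα _ _ hxx.symm) k (by omega) le_rfl)) (hle.refl _)
  -- The remaining N-1 copies of x₀ complete the inserted word to one below z itself.
  have hv' : cutLe E k (pre ++ (yx m).1 ++ post ++ wpow x₀ (N - 1)) z := by
    have : z = x₀ ++ wpow x₀ (N - 1) := by rw [hz, ← wpow_succ]; congr 1; omega
    rw [this]
    exact hle.append _ _ _ _ hv (hle.refl _)
  have hins : sqLe E k n (wpow z (pumpBound n)) (wpow z (pumpBound n) ++
      (pre ++ (yx m).1 ++ post ++ wpow x₀ (N - 1)) ++ wpow z (pumpBound n)) :=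
    cutLe_wpow_insert (isPrecongruence_cutGe hE k) hzz.2 hzz.1 hv' n le_rfl le_rfl le_rfl
  have hzUp : Up (wpow z (pumpBound n)) :=
    hUpPow (hUpPow hx₀Up hN1) (one_le_pumpBound n)
  have hleft : Up (wpow z (pumpBound n) ++ pre) := hUp hzUp (hUpL l₁ hl₁ hbm)
  have hright : Up (post ++ (wpow x₀ (N - 1) ++ wpow z (pumpBound n))) :=
    hUp (hUpR l₂ hl₂ hbm) (hUpPow' hx₀Up hzUp _)
  obtain ⟨u₁, hu₁, rfl⟩ := hleft ht₁
  obtain ⟨u₂, hu₂, rfl⟩ := hright ht₂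
  refine ⟨u₁ ++ (yx m).1 ++ u₂, ?_, by rw [hα.append, hα.append, hym]⟩
  refine hsq.trans _ _ _ hins ?_
  have h := hsq.append _ _ _ _ (hsq.append _ _ _ _ hu₁ (hsq.refl (yx m).1)) hu₂
  simpa only [List.append_assoc] using h

theorem pbClosed_semantic [Finite M] (hα : IsWordHom α) (hE : IsPrecongruence E)
    (hEα : ∀ x y, α x = α y → E x y) (hsame : ∀ x y, same (α x) (α y) → E y x) :
    PBClosed α same (semS α E) (semP α E) := by
  refine ⟨?_, fun k n => ⟨[], hα.nil, ?_⟩, fun a k n => ⟨[a], rfl, ?_⟩, ?_, ?_,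
    fun e T hS he hT => semS_pump hα hE hEα hS he hT⟩
  · refine polClosed_semantic (fun i : ℕ × ℕ => i.1)
      (fun (i : ℕ × ℕ) x (w : M × Set M) => α x = w.1 ∧ w.2 ⊆ α '' up (sqLe E i.1 i.2) x)
      hα hE hEα ?_ ?_ ?_ ?_ ?_
    · intro i
      refine ⟨hα.nil, ?_⟩
      rintro _ rfl
      exact ⟨[], (isPrecongruence_sqLe hE _ _).refl _, hα.nil⟩
    · intro i a
      refine ⟨rfl, ?_⟩
      rintro _ rfl
      exact ⟨[a], (isPrecongruence_sqLe hE _ _).refl _, rfl⟩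
    · intro i x y u v hu hv
      exact ⟨by rw [hα.append, hu.1, hv.1]; rfl,
        image_up_append hα (isPrecongruence_sqLe hE _ _) hu.2 hv.2⟩
    · intro i x u v huv hv
      exact ⟨hv.1.trans huv.1.symm, huv.2.trans hv.2⟩
    · rintro y w ⟨hw, hwy⟩ i
      obtain ⟨z, hz, hzT⟩ := hw i.1 i.2
      rw [← hz] at hwy
      exact ⟨z, hsame _ _ hwy, hz, hzT⟩
  · rintro _ rfl
    exact ⟨[], (isPrecongruence_sqLe hE _ _).refl _, hα.nil⟩
  · rintro _ rfl
    exact ⟨[a], (isPrecongruence_sqLe hE _ _).refl _, rfl⟩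
  · intro m T m' T' h h' k n
    obtain ⟨x, hx, hT⟩ := h k n
    obtain ⟨x', hx', hT'⟩ := h' k n
    exact ⟨x ++ x', by rw [hα.append, hx, hx'],
      image_up_append hα (isPrecongruence_sqLe hE _ _) hT hT'⟩
  · intro m T T' h hT k n
    obtain ⟨x, hx, hxT⟩ := h k n
    exact ⟨x, hx, hT.trans hxT⟩

/-- A congruence of finite index is the kernel of a morphism to a finite monoid. -/
theorem exists_finite_monoid {A : Type u} {T : Type*} [Finite T] {r : List A → List A → Prop}
    (hr : IsPrecongruence r) (φ : List A → T) (hφ : ∀ x y, r x y ↔ φ x = φ y) :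
    ∃ (G : Type u) (_ : Monoid G) (_ : Finite G) (γ : List A → G),
      IsWordHom γ ∧ ∀ x y, γ x = γ y ↔ r x y := by
  let c : Con (FreeMonoid A) :=
    { r := r
      iseqv := ⟨hr.refl, fun {x y} h => (hφ _ _).2 ((hφ _ _).1 h).symm, fun h h' =>
        hr.trans _ _ _ h h'⟩
      mul' := fun h h' => hr.append _ _ _ _ h h' }
  let γ : List A → c.Quotient := fun x => ((FreeMonoid.ofList x : FreeMonoid A) : c.Quotient)
  have hγ : ∀ x y, γ x = γ y ↔ r x y := fun x y => c.eq
  refine ⟨c.Quotient, inferInstance, ?_, γ, ⟨rfl, fun x y => rfl⟩, hγ⟩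
  refine Finite.of_injective (fun q : c.Quotient => φ (Quotient.out q : FreeMonoid A).toList) ?_
  intro p q h
  have := (hγ _ _).2 ((hφ _ _).2 h)
  have hout : ∀ q : c.Quotient, γ (Quotient.out q : FreeMonoid A).toList = q :=
    fun q => Quotient.out_eq q
  rwa [hout, hout] at this

/-- `T` is a possible value of `x`, and remains so under `n` nested splittings of `x`. -/
def Good (α : List A → M) (S : M → Set M → Prop) : ℕ → List A → Set M → Prop
  | 0, x, T => S (α x) T ∧ ∀ a, x = [a] → T ⊆ {α [a]}
  | n + 1, x, T => (S (α x) T ∧ ∀ a, x = [a] → T ⊆ {α [a]}) ∧ ∀ x₁ x₂, x = x₁ ++ x₂ →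
      ∃ T₁ T₂, T ⊆ T₁ * T₂ ∧ Good α S n x₁ T₁ ∧ Good α S n x₂ T₂

theorem Good.of_succ {S : M → Set M → Prop} {n : ℕ} : ∀ {x : List A} {T : Set M},
    Good α S (n + 1) x T → Good α S n x T := by
  induction n with
  | zero => intro x T h; exact h.1
  | succ n ih =>
    intro x T h
    refine ⟨h.1, fun x₁ x₂ hx => ?_⟩
    obtain ⟨T₁, T₂, hT, h₁, h₂⟩ := h.2 x₁ x₂ hx
    exact ⟨T₁, T₂, hT, ih h₁, ih h₂⟩

theorem image_up_succ_append (hα : IsWordHom α) {B : List A → List A → Prop}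
    (hB : IsPrecongruence B) (n : ℕ) (x y : List A) :
    α '' up (cutLe B (n + 1)) (x ++ y) ⊆ α '' up (cutLe B n) x * α '' up (cutLe B n) y := by
  rintro _ ⟨z, hz, rfl⟩
  obtain ⟨z₁, z₂, rfl, h₁, h₂⟩ := cutLe.split hB hz
  exact ⟨_, ⟨z₁, h₁, rfl⟩, _, ⟨z₂, h₂, rfl⟩, (hα.append _ _).symm⟩

theorem flatten_eq_append {x₁ x₂ : List A} : ∀ {l : List (List A)}, l.flatten = x₁ ++ x₂ →
    (∃ l₁ l₂, l = l₁ ++ l₂ ∧ x₁ = l₁.flatten ∧ x₂ = l₂.flatten) ∨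
    ∃ l₁ u v l₂, l = l₁ ++ (u ++ v) :: l₂ ∧ x₁ = l₁.flatten ++ u ∧ x₂ = v ++ l₂.flatten := by
  intro l
  induction l generalizing x₁ with
  | nil =>
    intro h
    obtain ⟨rfl, rfl⟩ : x₁ = [] ∧ x₂ = [] := by simpa using h.symm
    exact Or.inl ⟨[], [], rfl, rfl, rfl⟩
  | cons y l ih =>
    intro h
    rw [List.flatten_cons, List.append_eq_append_iff] at h
    obtain ⟨t, rfl, h⟩ | ⟨t, rfl, h⟩ := h
    · rcases ih h with ⟨l₁, l₂, rfl, rfl, rfl⟩ | ⟨l₁, u, v, l₂, rfl, rfl, rfl⟩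
      · exact Or.inl ⟨y :: l₁, l₂, rfl, by simp, rfl⟩
      · exact Or.inr ⟨y :: l₁, u, v, l₂, rfl, by simp, rfl⟩
    · exact Or.inr ⟨[], x₁, t, l, rfl, rfl, h⟩

/-- A split of the concatenation falls either between two blocks or inside one. In the second case
`image_up_succ_append` divides the set of values of that block, using one of the n extra levels; the
two parts are again infixes of a block, so the hypothesis on infixes passes to them. -/
theorem good_flatten (hα : IsWordHom α) {S : M → Set M → Prop}
    (hSone : S 1 {1}) (hSmul : ∀ m T m' T', S m T → S m' T' → S (m * m') (T * T'))
    (hSdown : ∀ m T T', S m T → T' ⊆ T → S m T') {B : List A → List A → Prop}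
    (hB : IsPrecongruence B) {n₀ : ℕ} (hnil : α '' up (cutLe B n₀) [] ⊆ {1})
    (hletter : ∀ a, α '' up (cutLe B n₀) [a] ⊆ {α [a]}) (n : ℕ) : ∀ (l : List (List A)) (T : Set M),
    (∀ x ∈ l, ∀ x', x' <:+: x → S (α x') (α '' up (cutLe B n₀) x')) →
    T ⊆ (l.map fun x => α '' up (cutLe B (n₀ + n)) x).prod → Good α S n l.flatten T := by
  have hanti : ∀ n x, α '' up (cutLe B (n₀ + n)) x ⊆ α '' up (cutLe B n₀) x := fun n x =>
    Set.image_mono fun y hy => cutLe.mono (Nat.le_add_right n₀ n) hy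
  have hbase : ∀ n, ∀ (l : List (List A)) (T : Set M),
      (∀ x ∈ l, ∀ x', x' <:+: x → S (α x') (α '' up (cutLe B n₀) x')) →
      T ⊆ (l.map fun x => α '' up (cutLe B (n₀ + n)) x).prod →
      S (α l.flatten) T ∧ ∀ a, l.flatten = [a] → T ⊆ {α [a]} := by
    intro n l T hl hT
    constructor
    · refine hSdown _ _ _ ?_ hT
      clear hT
      induction l with
      | nil =>
        rw [List.flatten_nil, hα.nil, List.map_nil, List.prod_nil, ← Set.singleton_one]
        exact hSone
      | cons x l ih =>
        rw [List.flatten_cons, hα.append, List.map_cons, List.prod_cons]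
        exact hSmul _ _ _ _ (hSdown _ _ _ (hl x (by simp) x List.infix_rfl) (hanti n x))
          (ih fun y hy => hl y (List.mem_cons_of_mem _ hy))
    · intro a ha
      refine hT.trans ?_
      have h1 : ∀ l : List (List A), l.flatten = [] →
          (l.map fun x => α '' up (cutLe B (n₀ + n)) x).prod ⊆ {1} := by
        intro l
        induction l with
        | nil => intro _; simp
        | cons x l ih =>
          intro h
          obtain ⟨rfl, h⟩ := List.append_eq_nil_iff.1 (List.flatten_cons ▸ h)
          rw [List.map_cons, List.prod_cons]
          exact (Set.mul_subset_mul ((hanti n []).trans hnil) (ih h)).trans (by simp)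
      clear hT hl
      induction l with
      | nil => simp at ha
      | cons x l ih =>
        rw [List.map_cons, List.prod_cons]
        rw [List.flatten_cons] at ha
        rcases List.append_eq_singleton_iff.1 ha with ⟨rfl, h⟩ | ⟨rfl, h⟩
        · exact (Set.mul_subset_mul ((hanti n []).trans hnil) (ih h)).trans (by simp)
        · exact (Set.mul_subset_mul ((hanti n [a]).trans (hletter a)) (h1 l h)).trans (by simp)
  induction n with
  | zero => exact hbase 0
  | succ n ih =>
    intro l T hl hT
    refine ⟨hbase (n + 1) l T hl hT, fun x₁ x₂ hx => ?_⟩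
    have hanti1 : ∀ l : List (List A), (l.map fun x => α '' up (cutLe B (n₀ + (n + 1))) x).prod ⊆
        (l.map fun x => α '' up (cutLe B (n₀ + n)) x).prod := by
      intro l
      induction l with
      | nil => exact subset_rfl
      | cons x l ih =>
        rw [List.map_cons, List.prod_cons, List.map_cons, List.prod_cons]
        exact Set.mul_subset_mul (Set.image_mono fun y hy => cutLe.of_succ hy) ih
    rcases flatten_eq_append hx with ⟨l₁, l₂, rfl, rfl, rfl⟩ | ⟨l₁, u, v, l₂, rfl, rfl, rfl⟩
    · refine ⟨_, _, ?_, ih l₁ _ (fun x hx => hl x (by simp [hx])) subset_rfl,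
        ih l₂ _ (fun x hx => hl x (by simp [hx])) subset_rfl⟩
      refine hT.trans ?_
      rw [List.map_append, List.prod_append]
      exact Set.mul_subset_mul (hanti1 l₁) (hanti1 l₂)
    · have hu := ih (l₁ ++ [u]) _ (by
        intro x hx x' hx'
        rcases List.mem_append.1 hx with hx | hx
        · exact hl x (by simp [hx]) x' hx'
        · obtain rfl : x = u := by simpa using hx
          exact hl (x ++ v) (by simp) x' (hx'.trans (List.prefix_append _ _).isInfix)) subset_rfl
      have hv := ih (v :: l₂) _ (by
        intro x hx x' hx'
        rcases List.mem_cons.1 hx with rfl | hx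
        · exact hl (u ++ x) (by simp) x' (hx'.trans (List.suffix_append _ _).isInfix)
        · exact hl x (by simp [hx]) x' hx') subset_rfl
      refine ⟨_, _, ?_, by simpa using hu, by simpa using hv⟩
      refine hT.trans ?_
      simp only [List.map_append, List.prod_append, List.map_cons, List.prod_cons]
      rw [mul_assoc, ← mul_assoc (α '' up (cutLe B (n₀ + n)) u)]
      refine Set.mul_subset_mul (hanti1 l₁) (Set.mul_subset_mul ?_ (hanti1 l₂))
      exact image_up_succ_append hα hB _ u v

/-- Completeness is applied twice: first to P, giving a lower level j with `Good` as the notion of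
possible value, then to S over the order of a fixed lower level k. The link is that a concatenation
of saturated blocks is itself `Good`, hence a legitimate witness in the lower data. -/
theorem PBClosed.exists_level [Finite A] [Finite M] {S : M → Set M → Prop}
    {P : M → Set (M × Set M) → Prop} (hSP : PBClosed α same S P) (hα : IsWordHom α)
    (hE : IsPrecongruence E) (hEfin : (Set.range (up E)).Finite)
    (hsame : ∀ x y, E y x → same (α x) (α y)) :
    ∃ k n, ∀ x, S (α x) (α '' up (sqLe E k n) x) := by
  obtain ⟨j, hj⟩ := hSP.pol.exists_level isMonoidPreorder_ratedLe hα hE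
    (fun n x w => α x = w.1 ∧ Good α S n x w.2)
    (fun n x w h => ⟨h.1, h.2.of_succ⟩)
    (fun n x x' w h => by
      obtain ⟨T₁, T₂, hT, h₁, h₂⟩ := h.2.2 x x' rfl
      exact ⟨(α x, T₁), (α x', T₂), ⟨by rw [← h.1, hα.append]; rfl, hT⟩, ⟨rfl, h₁⟩, ⟨rfl, h₂⟩⟩)
    (fun a w h => ⟨h.1.symm, h.2.2 a rfl⟩)
    (fun y x w hyx h => ⟨w, ⟨h.1 ▸ h.2.1, h.1 ▸ hsame x y hyx⟩, isMonoidPreorder_ratedLe.refl w⟩)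
  -- At least j, so that ≤_k implies the relation used for P. At least 1, so that only the empty
  -- word lies below the empty word, which bounds the values above the empty word and above the
  -- letters.
  set k := max j 1 with hk
  have hle := hE.cutLe k
  have hge := isPrecongruence_cutGe hE k
  have hfin := finite_range_up_cutLe hEfin k
  have := hfin.to_subtype
  let φ : List A → M × Set.range (up (cutLe E k)) := fun x => (α x, ⟨up (cutLe E k) x, x, rfl⟩)
  -- Refining α by equivalence for ≤_k ensures that the middle word and the pumped list of blocks,
  -- having equal images, are interchangeable at the lower level.
  let r : List A → List A → Prop := fun x y => α x = α y ∧ cutLe E k x y ∧ cutLe E k y x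
  have hr : IsPrecongruence r :=
    ⟨fun x => ⟨rfl, hle.refl x, hle.refl x⟩, fun x y z h h' => ⟨h.1.trans h'.1,
      hle.trans _ _ _ h.2.1 h'.2.1, hle.trans _ _ _ h'.2.2 h.2.2⟩, fun x y x' y' h h' =>
      ⟨by rw [hα.append, hα.append, h.1, h'.1], hle.append _ _ _ _ h.2.1 h'.2.1,
        hle.append _ _ _ _ h.2.2 h'.2.2⟩⟩
  obtain ⟨G, _, _, γ, hγ, hγr⟩ := exists_finite_monoid hr φ (by
    intro x y
    simp only [φ, r, Prod.mk.injEq]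
    refine and_congr_right fun _ => ⟨fun h => ?_, fun h => ⟨?_, ?_⟩⟩
    · exact Subtype.ext (Set.Subset.antisymm (fun z hz => hle.trans _ _ _ h.2 hz)
        (fun z hz => hle.trans _ _ _ h.1 hz))
    · have : y ∈ up (cutLe E k) y := hle.refl y
      rw [← Subtype.mk.inj h] at this; exact this
    · have : x ∈ up (cutLe E k) x := hle.refl x
      rw [Subtype.mk.inj h] at this; exact this)
  have hnil' : ∀ x, cutLe E k x [] → x = [] := by
    intro x hx
    have hx1 := hx.mono (le_max_right j 1)
    cases x with
    | nil => rfl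
    | cons a x =>
      obtain ⟨y₁, y₂, hy, -⟩ := hx1.2 [] a x rfl
      simp at hy
  have hnil : α '' up (sqLe E k 1) [] ⊆ {1} := by
    rintro _ ⟨y, hy, rfl⟩
    rw [hnil' y hy.1, hα.nil]
    rfl
  have hletter : ∀ a, α '' up (sqLe E k 1) [a] ⊆ {α [a]} := by
    rintro a _ ⟨y, hy, rfl⟩
    obtain ⟨y₁, y₂, rfl, h₁, h₂⟩ := hy.2 [] a [] rfl
    rw [hnil' y₁ h₁, hnil' y₂ h₂]
    rfl
  let τ : ℕ → List A → M × Set M := fun n x => (α x, α '' up (sqLe E k n) x)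
  have hanti : ∀ {m n}, m ≤ n → ∀ x, α '' up (sqLe E k n) x ⊆ α '' up (sqLe E k m) x :=
    fun hmn x => Set.image_mono fun y hy => cutLe.mono hmn hy
  obtain ⟨n, hn⟩ := exists_forall_saturated (le := ratedLe)
    (Sat := fun v : M × Set M => S v.1 v.2) (τ := τ) hγ
    isMonoidPreorder_ratedLe.refl isMonoidPreorder_ratedLe.trans isMonoidPreorder_ratedLe.mul
    (fun a b h hb => by
      have := hSP.down _ _ _ hb h.2
      rwa [← h.1] at this)
    (fun a b ha hb => hSP.mul _ _ _ _ ha hb)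
    (fun n x => ⟨rfl, hanti (Nat.le_succ n) x⟩)
    (fun n x y => ⟨hα.append x y, image_up_succ_append hα hge n x y⟩)
    1
    (by
      change S (α []) _
      rw [hα.nil]
      exact hSP.down _ _ _ hSP.one hnil)
    (fun a => hSP.down _ _ _ (hSP.letter a) (hletter a))
    (fun n => by
      -- Level n provides the saturated infixes, level 1 controls the empty word and the letters,
      -- and the j extra levels pay for the splittings inside `Good α S j`.
      refine ⟨max n 1 + j, by omega, fun g hg l hl hx hf mid hmid => ?_⟩
      set f := (l.map (τ (max n 1 + j))).prod with hfdef
      obtain ⟨x₁, hx₁⟩ := List.exists_mem_of_ne_nil l hl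
      have hrx : ∀ x ∈ l, α x = α mid := fun x hxl =>
        ((hγr x mid).1 ((hx x hxl).1.trans hmid.symm)).1
      have hmm : α mid * α mid = α mid := by
        have : γ (mid ++ mid) = γ mid := by rw [hγ.append, hmid, hg]
        rw [← hα.append]
        exact ((hγr _ _).1 this).1
      have hf1 : f.1 = α mid := prod_map_fst_of_idempotent hmm (τ _) l hl hrx
      have hfS : S f.1 f.2 := prod_map_of_mul (Sat := fun v : M × Set M => S v.1 v.2)
        (fun a b ha hb => hSP.mul _ _ _ _ ha hb) (τ _) l hl
        fun x hxl => hSP.down _ _ _ ((hx x hxl).2 x List.infix_rfl) (hanti (by omega) x)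
      have hf2 : f.2 * f.2 = f.2 := congrArg Prod.snd hf
      rw [hf1] at hfS
      have hpump := hSP.pump (α mid) f.2 hfS hmm hf2.ge
      change S (f.1 * α mid * f.1) (f.2 * (α '' up (sqLe E k (max n 1 + j)) mid) * f.2)
      rw [hf1, hmm, hmm]
      refine hSP.down _ _ _ hpump (Set.mul_subset_mul (Set.mul_subset_mul subset_rfl ?_)
        subset_rfl)
      rintro _ ⟨y, hy, rfl⟩
      have hlfl : γ l.flatten = g := by
        clear hf hfdef hf1 hfS hf2 hpump hx₁ hrx
        induction l with
        | nil => exact absurd rfl hl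
        | cons x l ih =>
          rw [List.flatten_cons, hγ.append, (hx x (by simp)).1]
          by_cases hl' : l = []
          · subst hl'; rw [List.flatten_nil, hγ.nil, mul_one]
          · rw [ih hl' fun y hy => hx y (List.mem_cons_of_mem _ hy), hg]
      have hmidl := (hγr mid l.flatten).1 (hmid.trans hlfl.symm)
      -- The upper order reverses ≤_k, so y lies below the middle word and therefore below the
      -- concatenated blocks. The latter realize f.2 with the idempotent value α mid, so α y is
      -- admissible in the pumping rule.
      have hyl : cutLe E j y l.flatten :=
        (hle.trans _ _ _ (show cutGe E k mid y from
          cutLe.base (B := cutGe E k) hy) hmidl.2.1).mono (le_max_left j 1)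
      have hgood : Good α S j l.flatten f.2 := by
        refine good_flatten hα hSP.one hSP.mul hSP.down hge (n₀ := max n 1)
          ((hanti (le_max_right n 1) _).trans hnil)
          (fun a => (hanti (le_max_right n 1) _).trans (hletter a)) j l f.2
          (fun x hxl x' hx' => hSP.down _ _ _ ((hx x hxl).2 x' hx')
            (hanti (le_max_left n 1) x')) ?_
        have : ∀ l : List (List A), (l.map (τ (max n 1 + j))).prod.2 =
            (l.map fun x => α '' up (cutLe (cutGe E k) (max n 1 + j)) x).prod := by
          intro l
          induction l with
          | nil => rfl
          | cons x l ih => rw [List.map_cons, List.prod_cons, List.map_cons, List.prod_cons,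
              Prod.snd_mul, ih]; rfl
        rw [← this l]
      refine ⟨_, hj y, f.2, ⟨l.flatten, hyl, ?_, hgood⟩, subset_rfl⟩
      exact hmidl.1.symm)
  exact ⟨k, n, hn⟩

end PBClosed

/-! ### Polynomial closure and cuts -/

section Bridge

variable {A : Type*} {B : List A → List A → Prop}

/-- Some member of `Ks` contains `x` and lies in the up-set of `x`. -/
def Fits (R : List A → List A → Prop) (Ks : Set (Language A)) (x : List A) : Prop :=
  ∃ K ∈ Ks, x ∈ K ∧ ∀ y ∈ K, R x y

/-- The marked products of members of two classes. -/
def markedProducts (Ks Ks' : Set (Language A)) : Set (Language A) :=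
  {L | ∃ K ∈ Ks, ∃ a : A, ∃ K' ∈ Ks', L = K * {[a]} * K'}

theorem finite_markedProducts [Finite A] {Ks Ks' : Set (Language A)} (h : Ks.Finite)
    (h' : Ks'.Finite) : (markedProducts Ks Ks').Finite := by
  refine ((h.prod (Set.finite_univ (α := A))).prod h').image
    (fun t => t.1.1 * {[t.1.2]} * t.2) |>.subset ?_
  rintro _ ⟨K, hK, a, K', hK', rfl⟩
  exact ⟨((K, a), K'), ⟨⟨hK, trivial⟩, hK'⟩, rfl⟩

theorem markedProducts_subset_pol {D Ks Ks' : Set (Language A)} (h : Ks ⊆ Pol D)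
    (h' : Ks' ⊆ Pol D) : markedProducts Ks Ks' ⊆ Pol D := by
  rintro _ ⟨K, hK, a, K', hK', rfl⟩
  exact PolMem.marked _ _ _ (h hK) (h' hK')

theorem mem_marked {K L : Language A} {a : A} {w : List A} :
    w ∈ K * {[a]} * L ↔ ∃ u ∈ K, ∃ v ∈ L, w = u ++ a :: v := by
  constructor
  · rintro ⟨_, ⟨u, hu, _, rfl, rfl⟩, v, hv, rfl⟩
    exact ⟨u, hu, v, hv, by simp⟩
  · rintro ⟨u, hu, v, hv, rfl⟩
    exact ⟨u ++ [a], ⟨u, hu, [a], rfl, rfl⟩, v, hv, by simp⟩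

theorem Fits.mono {R : List A → List A → Prop} {Ks Ks' : Set (Language A)} (h : Ks ⊆ Ks')
    {x : List A} (hx : Fits R Ks x) : Fits R Ks' x := by
  obtain ⟨K, hK, h'⟩ := hx
  exact ⟨K, h hK, h'⟩

theorem Fits.append_cons {R : List A → List A → Prop} (hR : IsPrecongruence R)
    {Ks Ks' : Set (Language A)} {u v : List A} {a : A} (hu : Fits R Ks u) (hv : Fits R Ks' v) :
    Fits R (markedProducts Ks Ks') (u ++ a :: v) := by
  obtain ⟨K, hK, huK, h⟩ := hu
  obtain ⟨K', hK', hvK, h'⟩ := hv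
  refine ⟨_, ⟨K, hK, a, K', hK', rfl⟩, mem_marked.2 ⟨u, huK, v, hvK, rfl⟩, fun y hy => ?_⟩
  obtain ⟨y₁, h₁, y₂, h₂, rfl⟩ := mem_marked.1 hy
  exact hR.append _ _ _ _ (h _ h₁) (hR.append [a] [a] _ _ (hR.refl _) (h' _ h₂))

theorem Fits.append_of_suffix {R : List A → List A → Prop} (hR : IsPrecongruence R)
    {Ks Ks' : Set (Language A)} {u v : List A} (hu : Fits R Ks u)
    (hv : ∀ v', v' <:+ v → Fits R Ks' v') : Fits R (Ks ∪ markedProducts Ks Ks') (u ++ v) := by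
  cases v with
  | nil => rw [List.append_nil]; exact hu.mono Set.subset_union_left
  | cons a v => exact (hu.append_cons hR (hv v ⟨[a], rfl⟩)).mono Set.subset_union_right

theorem Fits.append_of_prefix {R : List A → List A → Prop} (hR : IsPrecongruence R)
    {Ks Ks' : Set (Language A)} {u v : List A} (hu : ∀ u', u' <+: u → Fits R Ks u')
    (hv : Fits R Ks' v) : Fits R (Ks' ∪ markedProducts Ks Ks') (u ++ v) := by
  rcases List.eq_nil_or_concat u with rfl | ⟨u, a, rfl⟩
  · exact hv.mono Set.subset_union_left
  · rw [List.concat_eq_append, List.append_assoc]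
    exact (Fits.append_cons hR (hu u ⟨[a], by simp⟩) hv).mono Set.subset_union_right

theorem wordHom_flatten {G : Type*} [Monoid G] {γ : List A → G} (hγ : IsWordHom γ) {g : G}
    (hg : g * g = g) : ∀ l : List (List A), l ≠ [] → (∀ x ∈ l, γ x = g) → γ l.flatten = g := by
  intro l
  induction l with
  | nil => intro h; exact absurd rfl h
  | cons x l ih =>
    intro _ hl
    rw [List.flatten_cons, hγ.append, hl x (by simp)]
    by_cases hl' : l = []
    · rw [hl', List.flatten_nil, hγ.nil, mul_one]
    · rw [ih hl' fun y hy => hl y (List.mem_cons_of_mem _ hy), hg]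

/-- In the language K a (up B m) b K' the middle is tested only at the base level. This is enough:
if a v is the new middle part, z is below z^N, which is below z^N (a v) z^N by insertion, and the
outer powers lie below what K and b K' contain. -/
theorem fits_triple (hB : IsPrecongruence B) {n : ℕ} {Ks : Set (Language A)} {z m z' : List A}
    {a b : A} (hz : Fits (cutLe B n) Ks z) (hz' : Fits (cutLe B n) Ks z')
    (hzz : cutLe B n z (z ++ z)) (hzz' : cutLe B n (z ++ z) z)
    (hm : cutLe B n z (a :: m)) (hb : cutLe B n z (b :: z'))
    (hx : cutLe B n (z ++ (a :: m ++ b :: z')) z) :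
    Fits (cutLe B n) (markedProducts Ks (markedProducts (Set.range fun u => up B u) Ks))
      (z ++ (a :: m ++ b :: z')) := by
  have hR := hB.cutLe n
  obtain ⟨K, hK, hzK, h⟩ := hz
  obtain ⟨K', hK', hzK', h'⟩ := hz'
  refine ⟨_, ⟨K, hK, a, _, ⟨_, ⟨m, rfl⟩, b, K', hK', rfl⟩, rfl⟩,
    mem_marked.2 ⟨z, hzK, _, mem_marked.2 ⟨m, hB.refl m, z', hzK', rfl⟩, rfl⟩, fun y hy => ?_⟩
  obtain ⟨y₁, h₁, y₂, h₂, rfl⟩ := mem_marked.1 hy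
  obtain ⟨v, hv, y₃, h₃, rfl⟩ := mem_marked.1 h₂
  have hzv : B z (a :: v) := hB.trans _ _ _ hm.base (hB.append [a] [a] _ _ (hB.refl _) hv)
  have hN := one_le_pumpBound n
  have hpow : cutLe B n z (wpow z (pumpBound n)) := by
    simpa [wpow_one] using hR.wpow_of_idem hzz hzz' (m := 1) le_rfl hN
  have hpow' : cutLe B n (wpow z (pumpBound n)) z := by
    simpa [wpow_one] using hR.wpow_of_idem hzz hzz' (n := 1) hN le_rfl
  refine hR.trans _ _ _ hx (hR.trans _ _ _ hpow (hR.trans _ _ _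
    (cutLe_wpow_insert hB hzz.base hzz'.base hzv n le_rfl le_rfl le_rfl) ?_))
  have hlast := hR.trans _ _ _ (hR.trans _ _ _ hpow' hb)
    (hR.append [b] [b] _ _ (hR.refl _) (h' _ h₃))
  have := hR.append _ _ _ _ (hR.append _ _ _ _ (hR.trans _ _ _ hpow' (h _ h₁))
    (hR.refl (a :: v))) hlast
  simpa using this

/-- Forest induction over the quotient by equivalence for `cutLe B n`. In a star all blocks are
equivalent to one idempotent, so only the first and last blocks need precise languages. This keeps
the family finite although the number of blocks is unbounded. -/
theorem exists_finite_fits [Finite A] (hB : IsPrecongruence B) (hfin : (Set.range (up B)).Finite)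
    {D : Set (Language A)} (hD : ∀ x, up B x ∈ Pol D) (n : ℕ) :
    ∃ Ks : Set (Language A), Ks.Finite ∧ Ks ⊆ Pol D ∧ ∀ x, Fits (cutLe B n) Ks x := by
  have hR := hB.cutLe n
  have hfin' := finite_range_up_cutLe hfin n
  have := hfin'.to_subtype
  let φ : List A → Set.range (up (cutLe B n)) := fun x => ⟨up (cutLe B n) x, x, rfl⟩
  obtain ⟨G, _, _, γ, hγ, hγr⟩ := exists_finite_monoid
    (r := fun x y => cutLe B n x y ∧ cutLe B n y x)
    ⟨fun x => ⟨hR.refl x, hR.refl x⟩, fun x y z h h' => ⟨hR.trans _ _ _ h.1 h'.1,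
      hR.trans _ _ _ h'.2 h.2⟩, fun x y x' y' h h' => ⟨hR.append _ _ _ _ h.1 h'.1,
        hR.append _ _ _ _ h.2 h'.2⟩⟩ φ (by
    refine fun x y => ⟨fun h => ?_, fun h => ⟨?_, ?_⟩⟩
    · exact Subtype.ext (Set.Subset.antisymm (fun z hz => hR.trans _ _ _ h.2 hz)
        (fun z hz => hR.trans _ _ _ h.1 hz))
    · have : y ∈ up (cutLe B n) y := hR.refl y
      rw [← Subtype.mk.inj h] at this; exact this
    · have : x ∈ up (cutLe B n) x := hR.refl x
      rw [Subtype.mk.inj h] at this; exact this)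
  set U : Set (Language A) := Set.range fun u => up B u with hU
  have hUD : U ⊆ Pol D := by rintro _ ⟨u, rfl⟩; exact hD u
  have hUnil : Fits (cutLe B n) U [] := by
    refine ⟨_, ⟨[], rfl⟩, hB.refl [], fun y hy => ?_⟩
    cases n with
    | zero => exact hy
    | succ n => exact ⟨hy, fun x₁ a x₂ h => by simp at h⟩
  let F : Language A → Prop := fun X => ∃ Ks : Set (Language A), (Ks.Finite ∧ Ks ⊆ Pol D) ∧
    ∀ x ∈ X, ∀ x', x' <:+: x → Fits (cutLe B n) Ks x'
  have good_union : ∀ {Ks Ks' : Set (Language A)}, (Ks.Finite ∧ Ks ⊆ Pol D) →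
      (Ks'.Finite ∧ Ks' ⊆ Pol D) → ((Ks ∪ Ks').Finite ∧ Ks ∪ Ks' ⊆ Pol D) := fun h h' =>
    ⟨h.1.union h'.1, Set.union_subset h.2 h'.2⟩
  have good_mul : ∀ {Ks Ks' : Set (Language A)}, (Ks.Finite ∧ Ks ⊆ Pol D) →
      (Ks'.Finite ∧ Ks' ⊆ Pol D) →
      ((markedProducts Ks Ks').Finite ∧ markedProducts Ks Ks' ⊆ Pol D) := fun h h' =>
    ⟨finite_markedProducts h.1 h'.1, markedProducts_subset_pol h.2 h'.2⟩
  have hF : IsForestFamily γ F := by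
    refine ⟨?_, ?_, ?_, ⟨U, ⟨hfin, hUD⟩, ?_⟩,
      fun a => ⟨U ∪ markedProducts U U, good_union ⟨hfin, hUD⟩ (good_mul ⟨hfin, hUD⟩ ⟨hfin, hUD⟩),
        ?_⟩, ?_⟩
    · rintro X Y h ⟨Ks, hKs, hY⟩
      exact ⟨Ks, hKs, fun x hx => hY x (h hx)⟩
    · rintro X Y ⟨Ks, hKs, hX⟩ ⟨Ks', hKs', hY⟩
      refine ⟨Ks ∪ Ks', good_union hKs hKs', ?_⟩
      rintro x (hx | hx) x' hx'
      · exact (hX x hx x' hx').mono Set.subset_union_left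
      · exact (hY x hx x' hx').mono Set.subset_union_right
    · rintro X Y ⟨Ks, hKs, hX⟩ ⟨Ks', hKs', hY⟩
      refine ⟨Ks' ∪ (Ks ∪ markedProducts Ks Ks'), good_union hKs' (good_union hKs
        (good_mul hKs hKs')), ?_⟩
      rintro _ ⟨x, hx, y, hy, rfl⟩ z hz
      rcases infix_append_cases hz with h | h | ⟨u, v, rfl, hu, hv⟩
      · exact (hX x hx z h).mono (Set.subset_union_left.trans Set.subset_union_right)
      · exact (hY y hy z h).mono Set.subset_union_left
      · exact (Fits.append_of_suffix hR (hX x hx u hu.isInfix)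
          fun v' hv' => hY y hy v' (hv'.isInfix.trans hv.isInfix)).mono Set.subset_union_right
    · intro x hx x' hx'
      rw [(Language.mem_one _).1 hx, List.infix_nil] at hx'
      rwa [hx']
    · intro x hx x' hx'
      rw [show x = [a] from hx] at hx'
      have hcase : x' = [] ∨ x' = [a] := by
        have := hx'.sublist
        rcases x' with _ | ⟨b, x'⟩
        · exact Or.inl rfl
        · exact Or.inr (this.eq_of_length_le (by simp))
      rcases hcase with rfl | rfl
      · exact hUnil.mono Set.subset_union_left
      · exact (Fits.append_cons (u := []) hR hUnil hUnil).mono Set.subset_union_right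
    · rintro g X hg hXg ⟨Ks₀, hKs₀, hX₀⟩
      obtain ⟨Ks, hKs, hnil, hX⟩ : ∃ Ks : Set (Language A), (Ks.Finite ∧ Ks ⊆ Pol D) ∧
          Fits (cutLe B n) Ks [] ∧ ∀ x ∈ X, ∀ x', x' <:+: x → Fits (cutLe B n) Ks x' :=
        ⟨Ks₀ ∪ U, good_union hKs₀ ⟨hfin, hUD⟩, hUnil.mono Set.subset_union_right,
          fun x hx x' hx' => (hX₀ x hx x' hx').mono Set.subset_union_left⟩
      -- These account for zero or one block, for two blocks, and for three or more with everything
      -- between the extremes read at the base level.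
      set Ks₁ := (Ks ∪ markedProducts Ks Ks) ∪ markedProducts Ks (markedProducts U Ks) with hKs₁
      have hgood₁ : Ks₁.Finite ∧ Ks₁ ⊆ Pol D :=
        good_union (good_union hKs (good_mul hKs hKs)) (good_mul hKs (good_mul ⟨hfin, hUD⟩ hKs))
      have hmain : ∀ l : List (List A), (∀ x ∈ l, x ∈ X ∧ x ≠ []) →
          Fits (cutLe B n) Ks₁ l.flatten := by
        intro l hl
        have hsub : Ks ⊆ Ks₁ := Set.subset_union_left.trans Set.subset_union_left
        rcases l with _ | ⟨z, l⟩
        · exact hnil.mono hsub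
        have hz := hX z (hl z (by simp)).1
        rcases List.eq_nil_or_concat l with rfl | ⟨l, z', rfl⟩
        · simpa using (hz z List.infix_rfl).mono hsub
        have hz' := hX z' (hl z' (by simp)).1
        by_cases hl0 : l = []
        · subst hl0
          simpa using (Fits.append_of_suffix hR (hz z List.infix_rfl)
            fun v hv => hz' v hv.isInfix).mono Set.subset_union_left
        have hlg : γ l.flatten = g := wordHom_flatten hγ hg l hl0 fun x hx =>
          hXg x (hl x (by simp [hx])).1
        have hlne : l.flatten ≠ [] := by
          obtain ⟨x, hx⟩ := List.exists_mem_of_ne_nil l hl0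
          intro h
          exact (hl x (by simp [hx])).2 (List.flatten_eq_nil_iff.1 h x hx)
        have hgz := hXg z (hl z (by simp)).1
        have hgz' := hXg z' (hl z' (by simp)).1
        obtain ⟨a, m, hm⟩ := List.exists_cons_of_ne_nil hlne
        obtain ⟨b, z₂, hb⟩ := List.exists_cons_of_ne_nil (hl z' (by simp)).2
        have hidem := (hγr z (z ++ z)).1 (by rw [hγ.append, hgz, hg])
        have h := fits_triple (a := a) (b := b) (m := m) (z' := z₂) hB (hz z List.infix_rfl)
          (hz' z₂ ⟨[b], [], by rw [hb]; simp⟩) hidem.1 hidem.2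
          (by rw [← hm]; exact ((hγr _ _).1 (hgz.trans hlg.symm)).1)
          (by rw [← hb]; exact ((hγr _ _).1 (hgz.trans hgz'.symm)).1)
          (by
            rw [← hm, ← hb]
            exact ((hγr _ _).1 (by rw [hγ.append, hγ.append, hgz, hlg, hgz', hg, hg])).1)
        rw [← hm, ← hb] at h
        have h2 := h.mono (Set.subset_union_right (s := Ks ∪ markedProducts Ks Ks))
        simpa using h2
      -- Empty blocks are discarded, since the marks are the first letters of the middle part and of
      -- the last block.
      have hmain' : ∀ l : List (List A), (∀ x ∈ l, x ∈ X) → Fits (cutLe B n) Ks₁ l.flatten := by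
        classical
        intro l hl
        have := hmain (l.filter fun x => x ≠ []) (fun x hx => by
          rw [List.mem_filter] at hx
          exact ⟨hl x hx.1, by simpa using hx.2⟩)
        have heq : ∀ l : List (List A), (l.filter fun x => x ≠ []).flatten = l.flatten := by
          intro l
          induction l with
          | nil => rfl
          | cons x l ih =>
            rw [List.filter_cons]
            split_ifs with h
            · rw [List.flatten_cons, List.flatten_cons, ih]
            · have : x = [] := by simpa using h
              rw [ih, List.flatten_cons, this, List.nil_append]
        rwa [heq] at this
      set Ks₂ := Ks₁ ∪ markedProducts Ks Ks₁ with hKs₂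
      have hgood₂ : Ks₂.Finite ∧ Ks₂ ⊆ Pol D := good_union hgood₁ (good_mul hKs hgood₁)
      refine ⟨Ks₂ ∪ markedProducts Ks₂ Ks, good_union hgood₂ (good_mul hgood₂ hKs), ?_⟩
      intro w hw x' hx'
      obtain ⟨l, rfl, hl⟩ := Language.mem_kstar.1 hw
      obtain ⟨u, l', v, rfl, hl', hu, hv⟩ := infix_flatten hx'
      have hpart : ∀ u, (u = [] ∨ ∃ y ∈ l, u <:+: y) → ∀ u', u' <:+: u →
          Fits (cutLe B n) Ks u' := by
        rintro u (rfl | ⟨y, hy, hu⟩) u' hu'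
        · rw [List.infix_nil] at hu'; rwa [hu']
        · exact hX y (hl y hy) u' (hu'.trans hu)
      rw [← List.append_assoc]
      exact Fits.append_of_suffix hR (Fits.append_of_prefix hR
        (fun u' hu' => hpart u hu u' hu'.isInfix) (hmain' l' fun x hx => hl x (hl' hx)))
        fun v' hv' => hpart v hv v' hv'.isInfix
  obtain ⟨Ks, hKs, h⟩ := hF.top hγ
  exact ⟨Ks, hKs.1, hKs.2, fun x => h x trivial x List.infix_rfl⟩

theorem mem_of_forall_iff {D : Set (Language A)} {K L : Language A} (hL : L ∈ D)
    (h : ∀ x, x ∈ K ↔ x ∈ L) : K ∈ D := by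
  rwa [show K = L from Set.ext h]

theorem exists_finite_union {D : Set (Language A)} (hbot : ⊥ ∈ D)
    (hunion : ∀ K ∈ D, ∀ L ∈ D, K ⊔ L ∈ D) {Ks : Set (Language A)} (hfin : Ks.Finite)
    (hsub : Ks ⊆ D) : ∃ L ∈ D, ∀ x, x ∈ L ↔ ∃ K ∈ Ks, x ∈ K := by
  induction Ks, hfin using Set.Finite.induction_on with
  | empty => exact ⟨⊥, hbot, fun x => ⟨fun h => h.elim, fun ⟨K, hK, _⟩ => hK.elim⟩⟩
  | @insert K Ks _ _ ih =>
    obtain ⟨L, hL, h⟩ := ih fun K' hK' => hsub (Set.mem_insert_of_mem _ hK')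
    refine ⟨K ⊔ L, hunion _ (hsub (Set.mem_insert _ _)) _ hL, fun x => ?_⟩
    constructor
    · rintro (hx | hx)
      · exact ⟨K, Set.mem_insert _ _, hx⟩
      · obtain ⟨K', hK', hx⟩ := (h x).1 hx
        exact ⟨K', Set.mem_insert_of_mem _ hK', hx⟩
    · rintro ⟨K', hK', hx⟩
      rcases Set.mem_insert_iff.1 hK' with rfl | hK'
      · exact Or.inl hx
      · exact Or.inr ((h x).2 ⟨K', hK', hx⟩)

theorem pol_bot {D : Set (Language A)} (hbot : ⊥ ∈ D) : ⊥ ∈ Pol D := PolMem.base _ hbot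

theorem pol_sup {D : Set (Language A)} : ∀ K ∈ Pol D, ∀ L ∈ Pol D, K ⊔ L ∈ Pol D :=
  fun _ hK _ hL => PolMem.union _ _ hK hL

/-- The up-set is the union of those members of the finite family that it contains: every y in it
lies in a member contained in the up-set of y. -/
theorem up_cutLe_mem_pol [Finite A] (hB : IsPrecongruence B) (hfin : (Set.range (up B)).Finite)
    {D : Set (Language A)} (hbot : ⊥ ∈ D) (hD : ∀ x, up B x ∈ Pol D) (n : ℕ) (x : List A) :
    up (cutLe B n) x ∈ Pol D := by
  obtain ⟨Ks, hKs, hKD, hfit⟩ := exists_finite_fits hB hfin hD n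
  obtain ⟨L, hL, h⟩ := exists_finite_union (pol_bot hbot) pol_sup
    (hKs.subset (Set.sep_subset Ks fun K => ∀ y ∈ K, cutLe B n x y))
    ((Set.sep_subset _ _).trans hKD)
  have : up (cutLe B n) x = L := by
    ext y
    refine Iff.trans ⟨fun hy => ?_, ?_⟩ (h y).symm
    · obtain ⟨K, hK, hyK, hK'⟩ := hfit y
      exact ⟨K, ⟨hK, fun z hz => (hB.cutLe n).trans _ _ _ hy (hK' z hz)⟩, hyK⟩
    · rintro ⟨K, ⟨_, hK⟩, hy⟩
      exact hK y hy
  rw [this]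
  exact hL

theorem separable_pol_iff {D : Set (Language A)} (hbot : ⊥ ∈ D) (L₁ L₂ : Language A) :
    Separable (Pol D) L₁ L₂ ↔ Coverable (Pol D) L₁ {L₂} := by
  constructor
  · rintro ⟨K, hK, h₁, h₂⟩
    exact ⟨{K}, ⟨Set.finite_singleton K, by simpa using hK, fun w hw => ⟨K, rfl, h₁ hw⟩⟩,
      fun K' hK' => ⟨L₂, rfl, by rw [Set.mem_singleton_iff.1 hK', inf_comm, h₂]⟩⟩
  · rintro ⟨Ks, ⟨hfin, hsub, hcov⟩, h⟩
    obtain ⟨K, hK, hmem⟩ := exists_finite_union (pol_bot hbot) pol_sup hfin hsub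
    refine ⟨K, hK, fun w hw => (hmem w).2 (hcov w hw), ?_⟩
    ext w
    refine ⟨?_, fun h => h.elim⟩
    rintro ⟨hw, hwK⟩
    obtain ⟨K', hK', hw'⟩ := (hmem w).1 hwK
    obtain ⟨_, rfl, hd⟩ := h K' hK'
    rw [← hd]
    exact ⟨hw', hw⟩

theorem cutLe_antitone {B : ℕ → List A → List A → Prop}
    (hanti : ∀ m n x y, m ≤ n → B n x y → B m x y) {m n : ℕ} {x y : List A} (hmn : m ≤ n)
    (h : cutLe (B n) n x y) : cutLe (B m) m x y :=
  (h.mono_base fun x y hxy => hanti _ _ x y hmn hxy).mono hmn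

/-- Unions take the larger level, and a marked concatenation uses one cut at its marker. -/
theorem exists_cutLe_of_mem_pol {D : Set (Language A)} {B : ℕ → List A → List A → Prop}
    (hanti : ∀ m n x y, m ≤ n → B n x y → B m x y)
    (hinv : ∀ L ∈ D, ∃ n, ∀ x y, cutLe (B n) n x y → x ∈ L → y ∈ L) {K : Language A}
    (hK : K ∈ Pol D) : ∃ n, ∀ x y, cutLe (B n) n x y → x ∈ K → y ∈ K := by
  have hanti' : ∀ {m n x y}, m ≤ n → cutLe (B n) n x y → cutLe (B m) m x y :=
    cutLe_antitone hanti
  induction hK with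
  | base L hL => exact hinv L hL
  | union K L _ _ ihK ihL =>
    obtain ⟨m, hm⟩ := ihK
    obtain ⟨n, hn⟩ := ihL
    refine ⟨max m n, fun x y hxy hx => ?_⟩
    rcases hx with hx | hx
    · exact Or.inl (hm x y (hanti' (le_max_left _ _) hxy) hx)
    · exact Or.inr (hn x y (hanti' (le_max_right _ _) hxy) hx)
  | marked K L a _ _ ihK ihL =>
    obtain ⟨m, hm⟩ := ihK
    obtain ⟨n, hn⟩ := ihL
    refine ⟨max m n + 1, fun x y hxy hx => ?_⟩
    obtain ⟨u, hu, v, hv, rfl⟩ := mem_marked.1 hx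
    obtain ⟨y₁, y₂, rfl, h₁, h₂⟩ := hxy.2 u a v rfl
    have hbase : ∀ {x y}, cutLe (B (max m n + 1)) (max m n) x y →
        cutLe (B (max m n)) (max m n) x y := fun h =>
      h.mono_base fun x y hxy => hanti _ _ x y (Nat.le_succ _) hxy
    exact mem_marked.2 ⟨y₁, hm u y₁ (hanti' (le_max_left _ _) (hbase h₁)) hu, y₂,
      hn v y₂ (hanti' (le_max_right _ _) (hbase h₂)) hv, rfl⟩

/-- Coverability by a polynomial closure, in terms of a decreasing sequence of base relations
defining the same languages as the base class. -/
theorem coverable_pol_iff [Finite A] {D : Set (Language A)} (hbot : ⊥ ∈ D)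
    {B : ℕ → List A → List A → Prop} (hB : ∀ n, IsPrecongruence (B n))
    (hfin : ∀ n, (Set.range (up (B n))).Finite)
    (hanti : ∀ m n x y, m ≤ n → B n x y → B m x y) (hD : ∀ n x, up (B n) x ∈ Pol D)
    (hinv : ∀ L ∈ D, ∃ n, ∀ x y, cutLe (B n) n x y → x ∈ L → y ∈ L) (L : Language A)
    (Ls : Set (Language A)) :
    Coverable (Pol D) L Ls ↔
      ∃ n, ∀ x ∈ L, ∃ L' ∈ Ls, ∀ y, cutLe (B n) n x y → y ∉ L' := by
  have hanti' : ∀ {m n x y}, m ≤ n → cutLe (B n) n x y → cutLe (B m) m x y :=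
    cutLe_antitone hanti
  constructor
  · rintro ⟨Ks, ⟨hKs, hsub, hcov⟩, h⟩
    have hup := fun K => exists_cutLe_of_mem_pol hanti hinv (K := K)
    have hN : ∃ n, ∀ K ∈ Ks, ∀ x y, cutLe (B n) n x y → x ∈ K → y ∈ K := by
      clear hcov h
      induction Ks, hKs using Set.Finite.induction_on with
      | empty => exact ⟨0, fun K hK => hK.elim⟩
      | @insert K Ks _ _ ih =>
        obtain ⟨m, hm⟩ := hup K (hsub (Set.mem_insert _ _))
        obtain ⟨n, hn⟩ := ih fun K' hK' => hsub (Set.mem_insert_of_mem _ hK')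
        refine ⟨max m n, fun K' hK' x y hxy hx => ?_⟩
        rcases Set.mem_insert_iff.1 hK' with rfl | hK'
        · exact hm x y (hanti' (le_max_left _ _) hxy) hx
        · exact hn K' hK' x y (hanti' (le_max_right _ _) hxy) hx
    obtain ⟨n, hn⟩ := hN
    refine ⟨n, fun x hx => ?_⟩
    obtain ⟨K, hK, hxK⟩ := hcov x hx
    obtain ⟨L', hL', hd⟩ := h K hK
    refine ⟨L', hL', fun y hy hyL => ?_⟩
    have : y ∈ K ⊓ L' := ⟨hn K hK x y hy hxK, hyL⟩
    rw [hd] at this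
    exact this.elim
  · rintro ⟨n, hn⟩
    -- The canonical cover by principal up-sets; it is finite even when L is infinite.
    refine ⟨(fun x => up (cutLe (B n) n) x) '' L,
      ⟨(finite_range_up_cutLe (hfin n) n).subset (Set.image_subset_range _ _), ?_, ?_⟩, ?_⟩
    · rintro _ ⟨x, _, rfl⟩
      exact up_cutLe_mem_pol (hB n) (hfin n) hbot (hD n) n x
    · exact fun w hw => ⟨_, ⟨w, hw, rfl⟩, ((hB n).cutLe n).refl w⟩
    · rintro _ ⟨x, hx, rfl⟩
      obtain ⟨L', hL', h⟩ := hn x hx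
      refine ⟨L', hL', ?_⟩
      ext y
      exact ⟨fun hy => (h y hy.1 hy.2).elim, fun h => h.elim⟩

end Bridge

/-! ### The two classes built on a finite quotienting Boolean algebra -/

section Levels

variable {A : Type*} {C : Set (Language A)}

/-- Equivalence of words with respect to a class of languages. -/
def classEquiv (C : Set (Language A)) (x y : List A) : Prop := ∀ L ∈ C, x ∈ L ↔ y ∈ L

theorem classEquiv.symm {x y : List A} (h : classEquiv C x y) : classEquiv C y x :=
  fun L hL => (h L hL).symm

theorem isPrecongruence_classEquiv (hquot : IsQuotienting C) : IsPrecongruence (classEquiv C) := by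
  refine ⟨fun x L _ => Iff.rfl, fun x y z h h' L hL => (h L hL).trans (h' L hL),
    fun x y x' y' h h' L hL => ?_⟩
  exact (h _ (hquot.right_mem L hL x')).trans (h' _ (hquot.left_mem L hL y))

theorem finite_range_up_classEquiv (hfin : C.Finite) : (Set.range (up (classEquiv C))).Finite := by
  have : Finite C := hfin
  refine (Set.toFinite (Set.range fun x : List A => {L : C | x ∈ L.1})).of_surjOn
    (fun t => {y | ∀ L : C, L ∈ t ↔ y ∈ L.1}) ?_
  rintro _ ⟨x, rfl⟩
  refine ⟨_, ⟨x, rfl⟩, ?_⟩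
  ext y
  exact ⟨fun h L hL => h ⟨L, hL⟩, fun h L => h L.1 L.2⟩

/-- The class of x is an atom of C: the intersection of the languages of C that contain x and of the
complements of the others. -/
theorem up_classEquiv_mem (hfin : C.Finite) (hbool : IsBooleanAlgebra C) (x : List A) :
    up (classEquiv C) x ∈ C := by
  have key : ∀ S : Set (Language A), S.Finite → S ⊆ C → up (classEquiv S) x ∈ C := by
    intro S hS
    induction S, hS using Set.Finite.induction_on with
    | empty =>
      intro _
      refine mem_of_forall_iff hbool.univ_mem fun y => ?_
      exact ⟨fun _ => trivial, fun _ L hL => hL.elim⟩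
    | @insert K S _ _ ih =>
      intro hsub
      have hS := ih fun L hL => hsub (Set.mem_insert_of_mem _ hL)
      have hK := hsub (Set.mem_insert K S)
      have hmem : ∀ y, y ∈ up (classEquiv (insert K S)) x ↔
          (x ∈ K ↔ y ∈ K) ∧ y ∈ up (classEquiv S) x := fun y =>
        ⟨fun h => ⟨h K (Set.mem_insert _ _), fun L hL => h L (Set.mem_insert_of_mem _ hL)⟩,
          fun h L hL => by
            rcases Set.mem_insert_iff.1 hL with rfl | hL
            · exact h.1
            · exact h.2 L hL⟩
      by_cases hx : x ∈ K
      · refine mem_of_forall_iff (hbool.inter_mem _ hK _ hS) fun y => ?_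
        exact (hmem y).trans (and_congr_left fun _ =>
          ⟨fun h => h.1 hx, fun h => ⟨fun _ => h, fun _ => hx⟩⟩)
      · refine mem_of_forall_iff (hbool.inter_mem _ (hbool.compl_mem _ hK) _ hS) fun y => ?_
        refine (hmem y).trans (and_congr_left fun _ => ?_)
        simp only [hx, false_iff]
        exact Iff.rfl
  exact key C hfin subset_rfl

theorem coverable_pol_class_iff [Finite A] (hfin : C.Finite) (hbool : IsBooleanAlgebra C)
    (hquot : IsQuotienting C) (L : Language A) (Ls : Set (Language A)) :
    Coverable (Pol C) L Ls ↔
      ∃ n, ∀ x ∈ L, ∃ L' ∈ Ls, ∀ y, cutLe (classEquiv C) n x y → y ∉ L' :=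
  coverable_pol_iff (B := fun _ => classEquiv C) hbool.empty_mem
    (fun _ => isPrecongruence_classEquiv hquot) (fun _ => finite_range_up_classEquiv hfin)
    (fun _ _ _ _ _ h => h) (fun _ x => PolMem.base _ (up_classEquiv_mem hfin hbool x))
    (fun L hL => ⟨0, fun _ _ h hx => (h L hL).1 hx⟩) L Ls

theorem classEquiv_of_cutGe {k : ℕ} {x y : List A} (h : cutGe (classEquiv C) k x y) :
    classEquiv C x y := (cutLe.base h).symm

theorem finite_range_up_cutGe [Finite A] (hfin : C.Finite) (hquot : IsQuotienting C) (k : ℕ) :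
    (Set.range (up (cutGe (classEquiv C) k))).Finite := by
  have hR := (isPrecongruence_classEquiv hquot).cutLe k
  refine (finite_range_up_cutLe (finite_range_up_classEquiv hfin) k).of_surjOn
    (fun S => {y | ∃ x, S = up (cutLe (classEquiv C) k) x ∧ cutLe (classEquiv C) k y x}) ?_
  rintro _ ⟨x, rfl⟩
  refine ⟨_, ⟨x, rfl⟩, ?_⟩
  ext y
  constructor
  · rintro ⟨x', hx', hy⟩
    have : x ∈ up (cutLe (classEquiv C) k) x' := hx' ▸ hR.refl x
    exact hR.trans _ _ _ hy this
  · exact fun hy => ⟨x, rfl, hy⟩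

/-- The words below x form the complement of the union of the up-sets of all words not below x, and
there are finitely many such up-sets. -/
theorem up_cutGe_mem [Finite A] (hfin : C.Finite) (hbool : IsBooleanAlgebra C)
    (hquot : IsQuotienting C) (k : ℕ) (x : List A) :
    up (cutGe (classEquiv C) k) x ∈ BoolClosure (Pol C) := by
  have hE := isPrecongruence_classEquiv hquot
  have hR := hE.cutLe k
  have hEfin := finite_range_up_classEquiv hfin
  obtain ⟨L, hL, h⟩ := exists_finite_union (D := BoolClosure (Pol C)) BoolClosureMem.empty
    (fun _ hK _ hL => BoolClosureMem.union _ _ hK hL)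
    (Ks := (fun u => up (cutLe (classEquiv C) k) u) '' {u | ¬ cutLe (classEquiv C) k u x})
    ((finite_range_up_cutLe hEfin k).subset (Set.image_subset_range _ _)) (by
      rintro _ ⟨u, _, rfl⟩
      exact BoolClosureMem.base _ (up_cutLe_mem_pol hE hEfin hbool.empty_mem
        (fun x => PolMem.base _ (up_classEquiv_mem hfin hbool x)) k u))
  refine mem_of_forall_iff (BoolClosureMem.compl _ hL) fun y => ?_
  change cutLe (classEquiv C) k y x ↔ ¬ y ∈ L
  rw [h]
  constructor
  · rintro hy ⟨_, ⟨u, hu, rfl⟩, huy⟩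
    exact hu (hR.trans _ _ _ huy hy)
  · intro hy
    by_contra hyx
    exact hy ⟨_, ⟨y, hyx, rfl⟩, hR.refl y⟩

theorem exists_cutLe_of_mem_boolClosure {L : Language A} (hL : L ∈ BoolClosure (Pol C)) :
    ∃ k, ∀ x y, cutLe (classEquiv C) k x y → cutLe (classEquiv C) k y x → (x ∈ L ↔ y ∈ L) := by
  induction hL with
  | base L hL =>
    obtain ⟨n, hn⟩ := exists_cutLe_of_mem_pol (B := fun _ => classEquiv C)
      (fun _ _ _ _ _ h => h) (fun L hL => ⟨0, fun _ _ h hx => (h L hL).1 hx⟩) hL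
    exact ⟨n, fun x y h h' => ⟨hn x y h, hn y x h'⟩⟩
  | empty => exact ⟨0, fun _ _ _ _ => Iff.rfl⟩
  | univ => exact ⟨0, fun _ _ _ _ => Iff.rfl⟩
  | union K L _ _ ihK ihL =>
    obtain ⟨m, hm⟩ := ihK
    obtain ⟨n, hn⟩ := ihL
    exact ⟨max m n, fun x y h h' => or_congr
      (hm x y (h.mono (le_max_left _ _)) (h'.mono (le_max_left _ _)))
      (hn x y (h.mono (le_max_right _ _)) (h'.mono (le_max_right _ _)))⟩
  | inter K L _ _ ihK ihL =>
    obtain ⟨m, hm⟩ := ihK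
    obtain ⟨n, hn⟩ := ihL
    exact ⟨max m n, fun x y h h' => and_congr
      (hm x y (h.mono (le_max_left _ _)) (h'.mono (le_max_left _ _)))
      (hn x y (h.mono (le_max_right _ _)) (h'.mono (le_max_right _ _)))⟩
  | compl L _ ih =>
    obtain ⟨n, hn⟩ := ih
    exact ⟨n, fun x y h h' => not_congr (hn x y h h')⟩

/-- One-sided base relations suffice for Boolean combinations. If x and y are related by k nested
cuts over the reverse of ≤_k, the base gives y ≤_k x; forgetting the base down to equivalence modulo
C, which is symmetric, leaves exactly x ≤_k y. -/
theorem coverable_pbPol_iff [Finite A] (hfin : C.Finite) (hbool : IsBooleanAlgebra C)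
    (hquot : IsQuotienting C) (L : Language A) (Ls : Set (Language A)) :
    Coverable (PBPol C) L Ls ↔
      ∃ k n, ∀ x ∈ L, ∃ L' ∈ Ls, ∀ y, sqLe (classEquiv C) k n x y → y ∉ L' := by
  have hE := isPrecongruence_classEquiv hquot
  have hanti : ∀ m n x y, m ≤ n → cutGe (classEquiv C) n x y → cutGe (classEquiv C) m x y :=
    fun _ _ _ _ hmn h => cutLe.mono hmn h
  refine (coverable_pol_iff (B := cutGe (classEquiv C)) BoolClosureMem.empty
    (isPrecongruence_cutGe hE) (finite_range_up_cutGe hfin hquot) hanti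
    (fun n x => PolMem.base _ (up_cutGe_mem hfin hbool hquot n x)) ?_ L Ls).trans ?_
  · intro L hL
    obtain ⟨k, hk⟩ := exists_cutLe_of_mem_boolClosure hL
    exact ⟨k, fun x y hxy hx =>
      (hk x y (hxy.mono_base fun _ _ h => classEquiv_of_cutGe h) hxy.base).1 hx⟩
  · constructor
    · rintro ⟨n, hn⟩
      exact ⟨n, n, hn⟩
    · rintro ⟨k, n, h⟩
      refine ⟨max k n, fun x hx => ?_⟩
      obtain ⟨L', hL', h'⟩ := h x hx
      exact ⟨L', hL', fun y hy => h' y ((cutLe.mono_base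
        (fun x y => hanti _ _ x y (le_max_left k n)) hy).mono (le_max_right k n))⟩

end Levels

open scoped Pointwise

/-! ### Saturated pairs over finite tables -/

section Nested

variable {A M : Type*} [Monoid M]

/-- The inference rules shared by the two levels. The value of the letter `a` is
`(α [a], {v a})`. -/
structure NestedClosed (α : List A → M) (v : A → M) (same : M → M → Prop) (S : M → Set M → Prop)
    (P : M → Set (M × Set M) → Prop) : Prop where
  pol : PolClosed α (fun a => (α [a], {v a})) ratedLe (fun e => {w | S w.1 w.2 ∧ same w.1 e}) P
  one : S 1 {1}
  letter : ∀ a, S (α [a]) {v a}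
  mul : ∀ m T m' T', S m T → S m' T' → S (m * m') (T * T')
  down : ∀ m T U, S m T → U ⊆ T → S m U

/-- The inference rule specific to the upper level. -/
def PumpClosed (S : M → Set M → Prop) (P : M → Set (M × Set M) → Prop) : Prop :=
  ∀ e T, S e T → e * e = e → T ⊆ T * T →
    S e (T * {m | ∃ Θ, P m Θ ∧ ∃ T', (e, T') ∈ Θ ∧ T ⊆ T'} * T)

theorem pbClosed_iff {α : List A → M} {same : M → M → Prop} {S : M → Set M → Prop}
    {P : M → Set (M × Set M) → Prop} : PBClosed α same S P ↔
      NestedClosed α (fun a => α [a]) same S P ∧ PumpClosed S P :=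
  ⟨fun h => ⟨⟨h.pol, h.one, h.letter, h.mul, h.down⟩, h.pump⟩,
    fun h => ⟨h.1.pol, h.1.one, h.1.letter, h.1.mul, h.1.down, h.2⟩⟩

end Nested

/-! ### Finite tables, list codes and the closure checks -/

section Table

variable {γ : Type*}

/-- Finite presentation of a finite monoid with distinguished elements and subsets: the list of
elements, the unit, the values of the letters, the graph of the multiplication, the graph of a
relation, the accepting set of the language to cover, the accepting sets of the other languages. -/
abbrev Table (γ : Type*) : Type _ :=
  List γ × γ × List (γ × γ) × List (γ × γ × γ) × List (γ × γ) × List γ × List (List γ)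

/-- Inclusion of lists, as sets. -/
def listLe (t s : List γ) : Prop := ∀ c ∈ t, c ∈ s

/-- The relation `w ≤ u` on coded elements of `M × Set M`. -/
def codeLe (w u : γ × List γ) : Prop := w.1 = u.1 ∧ listLe w.2 u.2

/-- The relation `w₁ * w₂ ≤ w₃` on coded elements of `M × Set M`. -/
def codeMulLe (g : List (γ × γ × γ)) (w₁ w₂ w₃ : γ × List γ) : Prop :=
  (w₁.1, w₂.1, w₃.1) ∈ g ∧ ∀ h ∈ g, h.1 ∈ w₁.2 → h.2.1 ∈ w₂.2 → h.2.2 ∈ w₃.2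

/-- The relation `w ≤ w₁ * w₂` on coded elements of `M × Set M`. -/
def codeLeMul (g : List (γ × γ × γ)) (w w₁ w₂ : γ × List γ) : Prop :=
  (w₁.1, w₂.1, w.1) ∈ g ∧ ∀ c ∈ w.2, ∃ h ∈ g, h.1 ∈ w₁.2 ∧ h.2.1 ∈ w₂.2 ∧ h.2.2 = c

/-- Codes of the elements of `M × Set M`. -/
def ratedCodes (D : Table γ) : List (γ × List γ) := D.1.product D.1.sublists'

/-- Codes of the elements of `M × Set (M × Set M)`. -/
def pairCodes (D : Table γ) : List (γ × List (γ × List γ)) := D.1.product (ratedCodes D).sublists'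

/-- The closure conditions for the lower component. -/
def polCheck (D : Table γ) (S : List (γ × List γ)) (P : List (γ × List (γ × List γ))) : Prop :=
  (∃ x ∈ P, x.1 = D.2.1 ∧ ∃ w ∈ x.2, codeLe (D.2.1, [D.2.1]) w) ∧
  (∀ v ∈ D.2.2.1, ∃ x ∈ P, x.1 = v.1 ∧ ∃ w ∈ x.2, codeLe (v.1, [v.2]) w) ∧
  (∀ x ∈ P, ∀ y ∈ P, ∃ z ∈ P, (x.1, y.1, z.1) ∈ D.2.2.2.1 ∧ ∀ w₁ ∈ x.2, ∀ w₂ ∈ y.2, ∃ w₃ ∈ z.2,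
    codeMulLe D.2.2.2.1 w₁ w₂ w₃) ∧
  ∀ x ∈ P, (x.1, x.1, x.1) ∈ D.2.2.2.1 → ∀ θ ∈ (ratedCodes D).sublists',
    (∀ w ∈ θ, ∃ w' ∈ x.2, codeLe w w') →
    (∀ w ∈ θ, ∃ w₁ ∈ θ, ∃ w₂ ∈ θ, codeLeMul D.2.2.2.1 w w₁ w₂) →
    ∃ z ∈ P, z.1 = x.1 ∧ ∀ w₁ ∈ θ, ∀ s ∈ S, (s.1, x.1) ∈ D.2.2.2.2.1 → ∀ w₂ ∈ θ, ∃ w₃ ∈ z.2,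
      ∃ u ∈ ratedCodes D, codeMulLe D.2.2.2.1 w₁ s u ∧ codeMulLe D.2.2.2.1 u w₂ w₃

/-- The closure conditions for the upper component that are shared by the two levels. -/
def ratedCheck (D : Table γ) (S : List (γ × List γ)) : Prop :=
  (∃ x ∈ S, codeLe (D.2.1, [D.2.1]) x) ∧ (∀ v ∈ D.2.2.1, ∃ x ∈ S, codeLe (v.1, [v.2]) x) ∧
  ∀ x ∈ S, ∀ y ∈ S, ∃ z ∈ S, codeMulLe D.2.2.2.1 x y z

/-- The closure condition specific to the upper level. -/
def pumpCheck (D : Table γ) (S : List (γ × List γ)) (P : List (γ × List (γ × List γ))) : Prop :=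
  ∀ x ∈ S, (x.1, x.1, x.1) ∈ D.2.2.2.1 → ∀ t ∈ D.1.sublists', listLe t x.2 →
    (∀ c ∈ t, ∃ h ∈ D.2.2.2.1, h.1 ∈ t ∧ h.2.1 ∈ t ∧ h.2.2 = c) →
    ∃ z ∈ S, z.1 = x.1 ∧ ∀ y ∈ P, (∃ w ∈ y.2, codeLe (x.1, t) w) → ∀ c₁ ∈ t, ∀ c₂ ∈ t,
      ∃ h ∈ D.2.2.2.1, ∃ g ∈ D.2.2.2.1, h.1 = c₁ ∧ h.2.1 = y.1 ∧ g.1 = h.2.2 ∧ g.2.1 = c₂ ∧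
        g.2.2 ∈ z.2

/-- Decision procedure for the lower level. -/
def polDecide (D : Table γ) : Prop :=
  ∃ S ∈ (ratedCodes D).sublists', ∃ P ∈ (pairCodes D).sublists',
    polCheck D S P ∧ ratedCheck D S ∧
      ∀ x ∈ P, x.1 ∈ D.2.2.2.2.2.1 → ∃ F ∈ D.2.2.2.2.2.2, ∀ w ∈ x.2, w.1 ∉ F

/-- Decision procedure for the upper level. -/
def pbDecide (D : Table γ) : Prop :=
  ∃ S ∈ (ratedCodes D).sublists', ∃ P ∈ (pairCodes D).sublists',
    polCheck D S P ∧ ratedCheck D S ∧ pumpCheck D S P ∧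
      ∀ x ∈ S, x.1 ∈ D.2.2.2.2.2.1 → ∃ F ∈ D.2.2.2.2.2.2, ∀ c ∈ x.2, c ∉ F

variable {A M : Type*} [Monoid M]

/-- `D` presents the monoid `M`, its elements being coded by `κ`. -/
structure Represents (D : Table γ) (κ : M → γ) (α : List A → M) (v : A → M)
    (same : M → M → Prop) (F₀ : Set M) (Fs : Set (Set M)) : Prop where
  inj : Function.Injective κ
  elems : ∀ c, c ∈ D.1 ↔ ∃ m, κ m = c
  one : D.2.1 = κ 1
  vals : ∀ c, c ∈ D.2.2.1 ↔ ∃ a, c = (κ (α [a]), κ (v a))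
  mul : ∀ c, c ∈ D.2.2.2.1 ↔ ∃ m m', c = (κ m, κ m', κ (m * m'))
  same : ∀ m m', (κ m, κ m') ∈ D.2.2.2.2.1 ↔ same m m'
  start : ∀ m, κ m ∈ D.2.2.2.2.2.1 ↔ m ∈ F₀
  targets : ∀ F, F ∈ Fs ↔ ∃ l ∈ D.2.2.2.2.2.2, F = {m | κ m ∈ l}

/-- `u` codes the element `w` of `M × Set M`. -/
def Codes (κ : M → γ) (u : γ × List γ) (w : M × Set M) : Prop :=
  u.1 = κ w.1 ∧ ∀ c, c ∈ u.2 ↔ ∃ t ∈ w.2, κ t = c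

theorem codes_singleton {γ M : Type*} {κ : M → γ} (m t : M) : Codes κ (κ m, [κ t]) (m, {t}) :=
  ⟨rfl, fun c => by
    rw [List.mem_singleton]
    exact ⟨fun h => ⟨t, rfl, h.symm⟩, fun ⟨t', ht, e⟩ => by rw [← e, Set.mem_singleton_iff.1 ht]⟩⟩

/-- `x` codes the element `y` of `M × Set (M × Set M)`. -/
def PairCodes (κ : M → γ) (x : γ × List (γ × List γ)) (y : M × Set (M × Set M)) : Prop :=
  x.1 = κ y.1 ∧ (∀ u ∈ x.2, ∃ w ∈ y.2, Codes κ u w) ∧ ∀ w ∈ y.2, ∃ u ∈ x.2, Codes κ u w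

namespace Represents

variable {D : Table γ} {κ : M → γ} {α : List A → M} {v : A → M} {same : M → M → Prop}
  {F₀ : Set M} {Fs : Set (Set M)}

theorem mem_mul (hD : Represents D κ α v same F₀ Fs)
    {m₁ m₂ m₃ : M} : (κ m₁, κ m₂, κ m₃) ∈ D.2.2.2.1 ↔ m₁ * m₂ = m₃ := by
  rw [hD.mul]
  constructor
  · rintro ⟨m, m', h⟩
    obtain ⟨h₁, h₂⟩ := Prod.mk.inj h
    obtain ⟨h₂, h₃⟩ := Prod.mk.inj h₂
    rw [hD.inj h₁, hD.inj h₂, hD.inj h₃]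
  · rintro rfl
    exact ⟨m₁, m₂, rfl⟩

theorem mem_iff (hD : Represents D κ α v same F₀ Fs)
    {u : γ × List γ} {w : M × Set M} (h : Codes κ u w) {t : M} :
    κ t ∈ u.2 ↔ t ∈ w.2 := by
  rw [h.2]
  exact ⟨fun ⟨t', ht', e⟩ => hD.inj e ▸ ht', fun ht => ⟨t, ht, rfl⟩⟩

theorem codes_one (hD : Represents D κ α v same F₀ Fs) : Codes κ (D.2.1, [D.2.1]) 1 :=
  ⟨hD.one, fun c => by
    rw [List.mem_singleton, hD.one]
    exact ⟨fun h => ⟨1, rfl, h.symm⟩, fun ⟨t, ht, e⟩ => by rw [← e, Set.mem_one.1 ht]⟩⟩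

theorem codeLe_iff (hD : Represents D κ α v same F₀ Fs)
    {u u' : γ × List γ} {w w' : M × Set M} (h : Codes κ u w) (h' : Codes κ u' w') :
    codeLe u u' ↔ ratedLe w w' := by
  refine and_congr ?_ ?_
  · rw [h.1, h'.1]
    exact hD.inj.eq_iff
  · constructor
    · intro hl t ht
      exact (hD.mem_iff h').1 (hl _ ((hD.mem_iff h).2 ht))
    · intro hs c hc
      obtain ⟨t, ht, rfl⟩ := (h.2 c).1 hc
      exact (hD.mem_iff h').2 (hs ht)

theorem codeMulLe_iff (hD : Represents D κ α v same F₀ Fs)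
    {u₁ u₂ u₃ : γ × List γ} {w₁ w₂ w₃ : M × Set M} (h₁ : Codes κ u₁ w₁)
    (h₂ : Codes κ u₂ w₂) (h₃ : Codes κ u₃ w₃) :
    codeMulLe D.2.2.2.1 u₁ u₂ u₃ ↔ ratedLe (w₁ * w₂) w₃ := by
  refine and_congr ?_ ?_
  · rw [h₁.1, h₂.1, h₃.1]
    exact hD.mem_mul
  · constructor
    · rintro h _ ⟨t, ht, t', ht', rfl⟩
      exact (hD.mem_iff h₃).1 (h (κ t, κ t', κ (t * t')) (hD.mem_mul.2 rfl)
        ((hD.mem_iff h₁).2 ht) ((hD.mem_iff h₂).2 ht'))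
    · intro h g hg hg₁ hg₂
      obtain ⟨m, m', rfl⟩ := (hD.mul g).1 hg
      exact (hD.mem_iff h₃).2 (h ⟨m, (hD.mem_iff h₁).1 hg₁, m', (hD.mem_iff h₂).1 hg₂, rfl⟩)

theorem subset_mul_iff (hD : Represents D κ α v same F₀ Fs)
    {u u₁ u₂ : γ × List γ} {w w₁ w₂ : M × Set M} (h : Codes κ u w)
    (h₁ : Codes κ u₁ w₁) (h₂ : Codes κ u₂ w₂) :
    (∀ c ∈ u.2, ∃ g ∈ D.2.2.2.1, g.1 ∈ u₁.2 ∧ g.2.1 ∈ u₂.2 ∧ g.2.2 = c) ↔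
      w.2 ⊆ w₁.2 * w₂.2 := by
  constructor
  · intro hs t ht
    obtain ⟨g, hg, hg₁, hg₂, hgt⟩ := hs _ ((hD.mem_iff h).2 ht)
    obtain ⟨m, m', rfl⟩ := (hD.mul g).1 hg
    exact ⟨m, (hD.mem_iff h₁).1 hg₁, m', (hD.mem_iff h₂).1 hg₂, hD.inj hgt⟩
  · intro hs c hc
    obtain ⟨t, ht, rfl⟩ := (h.2 c).1 hc
    obtain ⟨m, hm, m', hm', rfl⟩ := hs ht
    exact ⟨(κ m, κ m', κ (m * m')), hD.mem_mul.2 rfl, (hD.mem_iff h₁).2 hm,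
      (hD.mem_iff h₂).2 hm', rfl⟩

theorem codeLeMul_iff (hD : Represents D κ α v same F₀ Fs)
    {u u₁ u₂ : γ × List γ} {w w₁ w₂ : M × Set M} (h : Codes κ u w)
    (h₁ : Codes κ u₁ w₁) (h₂ : Codes κ u₂ w₂) :
    codeLeMul D.2.2.2.1 u u₁ u₂ ↔ ratedLe w (w₁ * w₂) := by
  refine and_congr ?_ (hD.subset_mul_iff h h₁ h₂)
  rw [h₁.1, h₂.1, h.1]
  exact hD.mem_mul.trans eq_comm

theorem exists_list (hD : Represents D κ α v same F₀ Fs)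
    (T : Set M) : ∃ t ∈ D.1.sublists', ∀ c, c ∈ t ↔ ∃ m ∈ T, κ m = c := by
  classical
  refine ⟨D.1.filter fun c => ∃ m ∈ T, κ m = c, List.mem_sublists'.2 List.filter_sublist,
    fun c => ?_⟩
  simp only [List.mem_filter, decide_eq_true_eq, and_iff_right_iff_imp]
  rintro ⟨m, _, rfl⟩
  exact (hD.elems _).2 ⟨m, rfl⟩

theorem exists_code (hD : Represents D κ α v same F₀ Fs)
    (w : M × Set M) : ∃ u ∈ ratedCodes D, Codes κ u w := by
  obtain ⟨t, ht, h⟩ := hD.exists_list w.2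
  exact ⟨(κ w.1, t), List.pair_mem_product.2 ⟨(hD.elems _).2 ⟨_, rfl⟩, ht⟩, rfl, h⟩

theorem exists_decode_list (hD : Represents D κ α v same F₀ Fs)
    {t : List γ} (ht : t ∈ D.1.sublists') :
    ∃ T : Set M, ∀ c, c ∈ t ↔ ∃ m ∈ T, κ m = c := by
  refine ⟨{m | κ m ∈ t}, fun c => ⟨fun hc => ?_, ?_⟩⟩
  · obtain ⟨m, rfl⟩ := (hD.elems c).1 ((List.mem_sublists'.1 ht).subset hc)
    exact ⟨m, hc, rfl⟩
  · rintro ⟨m, hm, rfl⟩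
    exact hm

theorem exists_decode (hD : Represents D κ α v same F₀ Fs)
    {u : γ × List γ} (hu : u ∈ ratedCodes D) : ∃ w : M × Set M, Codes κ u w := by
  obtain ⟨h₁, h₂⟩ := List.pair_mem_product.1 (show (u.1, u.2) ∈ _ from hu)
  obtain ⟨m, hm⟩ := (hD.elems _).1 h₁
  obtain ⟨T, hT⟩ := hD.exists_decode_list h₂
  exact ⟨(m, T), hm.symm, hT⟩

theorem exists_theta (hD : Represents D κ α v same F₀ Fs)
    (Θ : Set (M × Set M)) : ∃ θ ∈ (ratedCodes D).sublists',
    (∀ u ∈ θ, ∃ w ∈ Θ, Codes κ u w) ∧ ∀ w ∈ Θ, ∃ u ∈ θ, Codes κ u w := by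
  classical
  refine ⟨(ratedCodes D).filter fun u => ∃ w ∈ Θ, Codes κ u w,
    List.mem_sublists'.2 List.filter_sublist, fun u hu => by simpa using (List.mem_filter.1 hu).2,
    fun w hw => ?_⟩
  obtain ⟨u, hu, huw⟩ := hD.exists_code w
  exact ⟨u, List.mem_filter.2 ⟨hu, by simpa using ⟨w.1, w.2, hw, huw⟩⟩, huw⟩

theorem exists_pairCode (hD : Represents D κ α v same F₀ Fs)
    (y : M × Set (M × Set M)) : ∃ x ∈ pairCodes D, PairCodes κ x y := by
  obtain ⟨θ, hθ, h⟩ := hD.exists_theta y.2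
  exact ⟨(κ y.1, θ), List.pair_mem_product.2 ⟨(hD.elems _).2 ⟨_, rfl⟩, hθ⟩, rfl, h⟩

theorem exists_decode_theta (hD : Represents D κ α v same F₀ Fs)
    {θ : List (γ × List γ)} (hθ : θ ∈ (ratedCodes D).sublists') :
    ∃ Θ : Set (M × Set M), (∀ u ∈ θ, ∃ w ∈ Θ, Codes κ u w) ∧ ∀ w ∈ Θ, ∃ u ∈ θ, Codes κ u w := by
  refine ⟨{w | ∃ u ∈ θ, Codes κ u w}, fun u hu => ?_, fun w hw => hw⟩
  obtain ⟨w, hw⟩ := hD.exists_decode ((List.mem_sublists'.1 hθ).subset hu)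
  exact ⟨w, ⟨u, hu, hw⟩, hw⟩

theorem exists_pairDecode (hD : Represents D κ α v same F₀ Fs)
    {x : γ × List (γ × List γ)} (hx : x ∈ pairCodes D) :
    ∃ y : M × Set (M × Set M), PairCodes κ x y := by
  obtain ⟨h₁, h₂⟩ := List.pair_mem_product.1 (show (x.1, x.2) ∈ _ from hx)
  obtain ⟨m, hm⟩ := (hD.elems _).1 h₁
  obtain ⟨Θ, hΘ⟩ := hD.exists_decode_theta h₂
  exact ⟨(m, Θ), hm.symm, hΘ⟩

end Represents

end Table

open scoped Pointwise

/-! ### Closed systems on the monoid versus checks on its table -/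

section Transfer

variable {γ A M : Type*} [Monoid M]

/-- The set of values below the members of a list of codes. -/
def ratedDecode (κ : M → γ) (S : List (γ × List γ)) (m : M) (T : Set M) : Prop :=
  ∃ u ∈ S, ∃ w, Codes κ u w ∧ ratedLe (m, T) w

/-- The set of pairs below the members of a list of codes. -/
def pairDecode (κ : M → γ) (P : List (γ × List (γ × List γ))) (m : M) (Θ : Set (M × Set M)) :
    Prop :=
  ∃ x ∈ P, ∃ y, PairCodes κ x y ∧ m = y.1 ∧ Dom ratedLe Θ y.2

namespace Represents

variable {D : Table γ} {κ : M → γ} {α : List A → M} {v : A → M} {same : M → M → Prop}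
  {F₀ : Set M} {Fs : Set (Set M)}
  {S : List (γ × List γ)} {P : List (γ × List (γ × List γ))}

/-- A list is decoded to everything dominated by one of its members, so closure under smaller sets
is automatic and the checks only ask for a member above each result. -/
theorem polClosed_of_check (hD : Represents D κ α v same F₀ Fs)
    (hP : P ∈ (pairCodes D).sublists') (hpol : polCheck D S P) :
    PolClosed α (fun a => (α [a], {v a})) ratedLe
      (fun e => {w | ratedDecode κ S w.1 w.2 ∧ same w.1 e}) (pairDecode κ P) := by
  have hle := isMonoidPreorder_ratedLe (M := M)
  have hPd : ∀ x ∈ P, ∃ y, PairCodes κ x y := fun x hx =>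
    hD.exists_pairDecode ((List.mem_sublists'.1 hP).subset hx)
  obtain ⟨h1, h2, h3, h4⟩ := hpol
  refine ⟨?_, ?_, ?_, ?_, ?_⟩
  · obtain ⟨x, hx, hx1, u, hu, hle⟩ := h1
    obtain ⟨y, hy⟩ := hPd x hx
    obtain ⟨w, hw, huw⟩ := hy.2.1 u hu
    refine ⟨x, hx, y, hy, hD.inj (by rw [← hy.1, hx1, hD.one]), ?_⟩
    rintro _ rfl
    exact ⟨w, hw, (hD.codeLe_iff hD.codes_one huw).1 hle⟩
  · intro a
    obtain ⟨x, hx, hx1, u, hu, hle⟩ := h2 _ ((hD.vals _).2 ⟨a, rfl⟩)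
    obtain ⟨y, hy⟩ := hPd x hx
    obtain ⟨w, hw, huw⟩ := hy.2.1 u hu
    refine ⟨x, hx, y, hy, hD.inj (by rw [← hy.1, hx1]), ?_⟩
    rintro _ rfl
    exact ⟨w, hw, (hD.codeLe_iff (codes_singleton _ _) huw).1 hle⟩
  · rintro m Θ m' Θ' ⟨x, hx, y, hxy, rfl, hd⟩ ⟨x', hx', y', hxy', rfl, hd'⟩
    obtain ⟨z, hz, hz1, hz2⟩ := h3 x hx x' hx'
    obtain ⟨y'', hzy⟩ := hPd z hz
    rw [hxy.1, hxy'.1, hzy.1, hD.mem_mul] at hz1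
    refine ⟨z, hz, y'', hzy, hz1, (Dom.mul hle hd hd').trans hle ?_⟩
    rintro _ ⟨w, hw, w', hw', rfl⟩
    obtain ⟨u, hu, huw⟩ := hxy.2.2 w hw
    obtain ⟨u', hu', huw'⟩ := hxy'.2.2 w' hw'
    obtain ⟨u'', hu'', h⟩ := hz2 u hu u' hu'
    obtain ⟨w'', hw'', huw''⟩ := hzy.2.1 u'' hu''
    exact ⟨w'', hw'', (hD.codeMulLe_iff huw huw' huw'').1 h⟩
  · rintro m Θ Θ' ⟨x, hx, y, hxy, rfl, hd⟩ hd'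
    exact ⟨x, hx, y, hxy, rfl, hd'.trans hle hd⟩
  · rintro e Θ ⟨x, hx, y, hxy, rfl, hd⟩ he hΘ
    obtain ⟨θ, hθ, hθ1, hθ2⟩ := hD.exists_theta Θ
    obtain ⟨z, hz, hz1, hz2⟩ := h4 x hx (by rw [hxy.1, hD.mem_mul, he]) θ hθ
      (by
        intro u hu
        obtain ⟨w, hw, huw⟩ := hθ1 u hu
        obtain ⟨w', hw', hww⟩ := hd w hw
        obtain ⟨u', hu', huw'⟩ := hxy.2.2 w' hw'
        exact ⟨u', hu', (hD.codeLe_iff huw huw').2 hww⟩)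
      (by
        intro u hu
        obtain ⟨w, hw, huw⟩ := hθ1 u hu
        obtain ⟨_, ⟨w₁, hw₁, w₂, hw₂, rfl⟩, hww⟩ := hΘ w hw
        obtain ⟨u₁, hu₁, huw₁⟩ := hθ2 w₁ hw₁
        obtain ⟨u₂, hu₂, huw₂⟩ := hθ2 w₂ hw₂
        exact ⟨u₁, hu₁, u₂, hu₂, (hD.codeLeMul_iff huw huw₁ huw₂).2 hww⟩)
    obtain ⟨y', hzy⟩ := hPd z hz
    refine ⟨z, hz, y', hzy, hD.inj (by rw [← hxy.1, ← hzy.1, hz1]), ?_⟩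
    rintro _ ⟨_, ⟨w₁, hw₁, g, ⟨⟨s, hs, w, hsw, hgw⟩, hsame⟩, rfl⟩, w₂, hw₂, rfl⟩
    obtain ⟨u₁, hu₁, huw₁⟩ := hθ2 w₁ hw₁
    obtain ⟨u₂, hu₂, huw₂⟩ := hθ2 w₂ hw₂
    obtain ⟨u₃, hu₃, u, hu, h, h'⟩ := hz2 u₁ hu₁ s hs (by
      rw [hsw.1, hxy.1, hD.same, ← hgw.1]; exact hsame) u₂ hu₂
    obtain ⟨w₃, hw₃, huw₃⟩ := hzy.2.1 u₃ hu₃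
    obtain ⟨q, hq⟩ := hD.exists_decode hu
    refine ⟨w₃, hw₃, hle.trans _ _ _ (hle.mul _ _ _ _ ?_ (hle.refl _))
      ((hD.codeMulLe_iff hq huw₂ huw₃).1 h')⟩
    exact hle.trans _ _ _ (hle.mul _ _ _ _ (hle.refl _) hgw) ((hD.codeMulLe_iff huw₁ hsw hq).1 h)

theorem nestedClosed_of_check (hD : Represents D κ α v same F₀ Fs)
    (hS : S ∈ (ratedCodes D).sublists')
    (hP : P ∈ (pairCodes D).sublists') (hpol : polCheck D S P) (hrated : ratedCheck D S) :
    NestedClosed α v same (ratedDecode κ S) (pairDecode κ P) := by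
  have hle := isMonoidPreorder_ratedLe (M := M)
  have hSd : ∀ u ∈ S, ∃ w, Codes κ u w := fun u hu =>
    hD.exists_decode ((List.mem_sublists'.1 hS).subset hu)
  obtain ⟨h1, h2, h3⟩ := hrated
  refine ⟨hD.polClosed_of_check hP hpol, ?_, ?_, ?_, ?_⟩
  · obtain ⟨u, hu, h⟩ := h1
    obtain ⟨w, huw⟩ := hSd u hu
    exact ⟨u, hu, w, huw, (hD.codeLe_iff hD.codes_one huw).1 h⟩
  · intro a
    obtain ⟨u, hu, h⟩ := h2 _ ((hD.vals _).2 ⟨a, rfl⟩)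
    obtain ⟨w, huw⟩ := hSd u hu
    exact ⟨u, hu, w, huw, (hD.codeLe_iff (codes_singleton _ _) huw).1 h⟩
  · rintro m T m' T' ⟨u, hu, w, huw, h⟩ ⟨u', hu', w', huw', h'⟩
    obtain ⟨u'', hu'', hm⟩ := h3 u hu u' hu'
    obtain ⟨w'', huw''⟩ := hSd u'' hu''
    exact ⟨u'', hu'', w'', huw'', hle.trans _ _ _ (hle.mul _ _ _ _ h h')
      ((hD.codeMulLe_iff huw huw' huw'').1 hm)⟩
  · rintro m T T' ⟨u, hu, w, huw, h⟩ hT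
    exact ⟨u, hu, w, huw, h.1, hT.trans h.2⟩

theorem pumpClosed_of_check (hD : Represents D κ α v same F₀ Fs)
    (hS : S ∈ (ratedCodes D).sublists')
    (hpump : pumpCheck D S P) : PumpClosed (ratedDecode κ S) (pairDecode κ P) := by
  rintro e T ⟨u, hu, w, huw, hle⟩ he hT
  obtain rfl : e = w.1 := hle.1
  obtain ⟨t, ht, htT⟩ := hD.exists_list T
  have htw : Codes κ (u.1, t) (w.1, T) := ⟨huw.1, htT⟩
  obtain ⟨z, hz, hz1, hz2⟩ := hpump u hu (by rw [huw.1, hD.mem_mul, he]) t ht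
    ((hD.codeLe_iff htw huw).2 hle).2 ((hD.subset_mul_iff htw htw htw).2 hT)
  obtain ⟨w', hzw⟩ := hD.exists_decode ((List.mem_sublists'.1 hS).subset hz)
  refine ⟨z, hz, w', hzw, hD.inj (by rw [← hzw.1, hz1, huw.1]), ?_⟩
  rintro _ ⟨_, ⟨t₁, ht₁, m, ⟨Θ, ⟨x, hx, y, hxy, rfl, hd⟩, T', hT', hTT'⟩, rfl⟩, t₂, ht₂, rfl⟩
  obtain ⟨w₁, hw₁, hle₁⟩ := hd _ hT'
  obtain ⟨u₁, hu₁, huw₁⟩ := hxy.2.2 w₁ hw₁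
  obtain ⟨g, hg, g', hg', hg1, hg2, hg1', hg2', hmem⟩ := hz2 x hx
    ⟨u₁, hu₁, (hD.codeLe_iff htw huw₁).2 ⟨hle₁.1, hTT'.trans hle₁.2⟩⟩
    _ ((htT _).2 ⟨t₁, ht₁, rfl⟩) _ ((htT _).2 ⟨t₂, ht₂, rfl⟩)
  obtain ⟨a, b, rfl⟩ := (hD.mul g).1 hg
  obtain ⟨a', b', rfl⟩ := (hD.mul g').1 hg'
  rw [hxy.1] at hg2
  obtain rfl := hD.inj hg1
  obtain rfl := hD.inj hg2
  obtain rfl := hD.inj hg1'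
  obtain rfl := hD.inj hg2'
  exact (hD.mem_iff hzw).1 hmem

/-- Take all codes of elements of the given closed system. Each rule produces an exact element of
the system, and the code of that element answers the check. -/
theorem exists_check_of_nestedClosed (hD : Represents D κ α v same F₀ Fs)
    {S' : M → Set M → Prop} {P' : M → Set (M × Set M) → Prop}
    (hSP : NestedClosed α v same S' P') :
    ∃ S ∈ (ratedCodes D).sublists', ∃ P ∈ (pairCodes D).sublists',
      polCheck D S P ∧ ratedCheck D S ∧ (PumpClosed S' P' → pumpCheck D S P) ∧
      (∀ u ∈ S, ∃ w, Codes κ u w ∧ S' w.1 w.2) ∧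
      ∀ x ∈ P, ∃ y, PairCodes κ x y ∧ P' y.1 y.2 := by
  classical
  have hle := isMonoidPreorder_ratedLe (M := M)
  let S := (ratedCodes D).filter fun u => ∃ w, Codes κ u w ∧ S' w.1 w.2
  let P := (pairCodes D).filter fun x => ∃ y, PairCodes κ x y ∧ P' y.1 y.2
  have hS : ∀ u ∈ S, ∃ w, Codes κ u w ∧ S' w.1 w.2 := fun u hu => by
    simpa only [decide_eq_true_eq] using (List.mem_filter.1 hu).2
  have hP : ∀ x ∈ P, ∃ y, PairCodes κ x y ∧ P' y.1 y.2 := fun x hx => by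
    simpa only [decide_eq_true_eq] using (List.mem_filter.1 hx).2
  have hS' : ∀ m T, S' m T → ∃ u ∈ S, Codes κ u (m, T) := fun m T h => by
    obtain ⟨u, hu, huw⟩ := hD.exists_code (m, T)
    exact ⟨u, List.mem_filter.2 ⟨hu, decide_eq_true ⟨(m, T), huw, h⟩⟩, huw⟩
  have hP' : ∀ m Θ, P' m Θ → ∃ x ∈ P, PairCodes κ x (m, Θ) := fun m Θ h => by
    obtain ⟨x, hx, hxy⟩ := hD.exists_pairCode (m, Θ)
    exact ⟨x, List.mem_filter.2 ⟨hx, decide_eq_true ⟨(m, Θ), hxy, h⟩⟩, hxy⟩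
  have hSsub : S ∈ (ratedCodes D).sublists' := List.mem_sublists'.2 List.filter_sublist
  have hPsub : P ∈ (pairCodes D).sublists' := List.mem_sublists'.2 List.filter_sublist
  refine ⟨S, hSsub, P, hPsub, ⟨?_, ?_, ?_, ?_⟩, ⟨?_, ?_, ?_⟩, ?_, hS, hP⟩
  · obtain ⟨x, hx, hxy⟩ := hP' _ _ hSP.pol.one
    obtain ⟨u, hu, huw⟩ := hxy.2.2 1 rfl
    exact ⟨x, hx, by rw [hxy.1, hD.one], u, hu, (hD.codeLe_iff hD.codes_one huw).2 (hle.refl _)⟩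
  · intro c hc
    obtain ⟨a, rfl⟩ := (hD.vals c).1 hc
    obtain ⟨x, hx, hxy⟩ := hP' _ _ (hSP.pol.letter a)
    obtain ⟨u, hu, huw⟩ := hxy.2.2 _ rfl
    exact ⟨x, hx, hxy.1, u, hu, (hD.codeLe_iff (codes_singleton _ _) huw).2 (hle.refl _)⟩
  · intro x hx x' hx'
    obtain ⟨⟨m, Θ⟩, hxy, h⟩ := hP x hx
    obtain ⟨⟨m', Θ'⟩, hxy', h'⟩ := hP x' hx'
    obtain ⟨z, hz, hzy⟩ := hP' _ _ (hSP.pol.mul _ _ _ _ h h')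
    refine ⟨z, hz, by rw [hxy.1, hxy'.1, hzy.1, hD.mem_mul], fun u hu u' hu' => ?_⟩
    obtain ⟨w, hw, huw⟩ := hxy.2.1 u hu
    obtain ⟨w', hw', huw'⟩ := hxy'.2.1 u' hu'
    obtain ⟨u'', hu'', huw''⟩ := hzy.2.2 _ (Set.mul_mem_mul hw hw')
    exact ⟨u'', hu'', (hD.codeMulLe_iff huw huw' huw'').2 (hle.refl _)⟩
  · intro x hx he θ hθ hθx hθθ
    obtain ⟨⟨e, Θ₀⟩, hxy, h⟩ := hP x hx
    obtain ⟨Θ, hΘ1, hΘ2⟩ := hD.exists_decode_theta hθ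
    rw [hxy.1, hD.mem_mul] at he
    have hΘ : P' e Θ := by
      refine hSP.pol.down _ _ _ h fun w hw => ?_
      obtain ⟨u, hu, huw⟩ := hΘ2 w hw
      obtain ⟨u', hu', hl⟩ := hθx u hu
      obtain ⟨w', hw', huw'⟩ := hxy.2.1 u' hu'
      exact ⟨w', hw', (hD.codeLe_iff huw huw').1 hl⟩
    have hΘΘ : Dom ratedLe Θ (Θ * Θ) := by
      intro w hw
      obtain ⟨u, hu, huw⟩ := hΘ2 w hw
      obtain ⟨u₁, hu₁, u₂, hu₂, hl⟩ := hθθ u hu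
      obtain ⟨w₁, hw₁, huw₁⟩ := hΘ1 u₁ hu₁
      obtain ⟨w₂, hw₂, huw₂⟩ := hΘ1 u₂ hu₂
      exact ⟨w₁ * w₂, Set.mul_mem_mul hw₁ hw₂, (hD.codeLeMul_iff huw huw₁ huw₂).1 hl⟩
    obtain ⟨z, hz, hzy⟩ := hP' _ _ (hSP.pol.pump e Θ hΘ he hΘΘ)
    refine ⟨z, hz, by rw [hzy.1, hxy.1], fun u₁ hu₁ s hs hsame u₂ hu₂ => ?_⟩
    obtain ⟨w₁, hw₁, huw₁⟩ := hΘ1 u₁ hu₁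
    obtain ⟨w₂, hw₂, huw₂⟩ := hΘ1 u₂ hu₂
    obtain ⟨g, hsg, hg⟩ := hS s hs
    rw [hsg.1, hxy.1, hD.same] at hsame
    obtain ⟨u₃, hu₃, huw₃⟩ := hzy.2.2 _ (Set.mul_mem_mul (Set.mul_mem_mul hw₁
      (show g ∈ {w : M × Set M | S' w.1 w.2 ∧ same w.1 e} from ⟨hg, hsame⟩)) hw₂)
    obtain ⟨u, hu, huw⟩ := hD.exists_code (w₁ * g)
    exact ⟨u₃, hu₃, u, hu, (hD.codeMulLe_iff huw₁ hsg huw).2 (hle.refl _),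
      (hD.codeMulLe_iff huw huw₂ huw₃).2 (hle.refl _)⟩
  · obtain ⟨u, hu, huw⟩ := hS' _ _ hSP.one
    exact ⟨u, hu, (hD.codeLe_iff hD.codes_one huw).2 (hle.refl _)⟩
  · intro c hc
    obtain ⟨a, rfl⟩ := (hD.vals c).1 hc
    obtain ⟨u, hu, huw⟩ := hS' _ _ (hSP.letter a)
    exact ⟨u, hu, (hD.codeLe_iff (codes_singleton _ _) huw).2 (hle.refl _)⟩
  · intro u hu u' hu'
    obtain ⟨w, huw, h⟩ := hS u hu
    obtain ⟨w', huw', h'⟩ := hS u' hu'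
    obtain ⟨z, hz, hzw⟩ := hS' _ _ (hSP.mul _ _ _ _ h h')
    exact ⟨z, hz, (hD.codeMulLe_iff huw huw' hzw).2 (hle.refl _)⟩
  · intro hpump u hu he t ht htu htt
    obtain ⟨⟨e, T₀⟩, huw, h⟩ := hS u hu
    rw [huw.1, hD.mem_mul] at he
    obtain ⟨T, hT⟩ := hD.exists_decode_list ht
    have htw : Codes κ (u.1, t) (e, T) := ⟨huw.1, hT⟩
    have hT1 := ((hD.codeLe_iff htw huw).1 ⟨rfl, htu⟩).2
    have hT2 := (hD.subset_mul_iff htw htw htw).1 htt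
    obtain ⟨z, hz, hzw⟩ := hS' _ _ (hpump e T (hSP.down _ _ _ h hT1) he hT2)
    refine ⟨z, hz, by rw [hzw.1, huw.1], fun x hx hex c₁ hc₁ c₂ hc₂ => ?_⟩
    obtain ⟨⟨m, Θ⟩, hxy, hΘ⟩ := hP x hx
    obtain ⟨u', hu', hl⟩ := hex
    obtain ⟨⟨e', T'⟩, hw', huw'⟩ := hxy.2.1 u' hu'
    obtain ⟨rfl, hTT'⟩ : e = e' ∧ T ⊆ T' := (hD.codeLe_iff htw huw').1 hl
    obtain ⟨t₁, ht₁, rfl⟩ := (hT _).1 hc₁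
    obtain ⟨t₂, ht₂, rfl⟩ := (hT _).1 hc₂
    refine ⟨(κ t₁, κ m, κ (t₁ * m)), hD.mem_mul.2 rfl, (κ (t₁ * m), κ t₂, κ (t₁ * m * t₂)),
      hD.mem_mul.2 rfl, rfl, hxy.1.symm, rfl, rfl, (hD.mem_iff hzw).2 ?_⟩
    exact Set.mul_mem_mul (Set.mul_mem_mul ht₁ ⟨Θ, hΘ, T', hw', hTT'⟩) ht₂

theorem polDecide_iff (hD : Represents D κ α v same F₀ Fs) :
    polDecide D ↔ ∃ S P, NestedClosed α v same S P ∧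
    ∀ m Θ, P m Θ → m ∈ F₀ → ∃ F ∈ Fs, ∀ w ∈ Θ, w.1 ∉ F := by
  constructor
  · rintro ⟨S, hS, P, hP, hpol, hrated, hbad⟩
    refine ⟨_, _, hD.nestedClosed_of_check hS hP hpol hrated, ?_⟩
    rintro m Θ ⟨x, hx, y, hxy, rfl, hd⟩ hm
    obtain ⟨l, hl, h⟩ := hbad x hx (by rw [hxy.1, hD.start]; exact hm)
    refine ⟨_, (hD.targets _).2 ⟨l, hl, rfl⟩, fun w hw hwl => ?_⟩
    obtain ⟨w', hw', hle⟩ := hd w hw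
    obtain ⟨u, hu, huw⟩ := hxy.2.2 w' hw'
    refine h u hu ?_
    rw [huw.1, ← hle.1]
    exact hwl
  · rintro ⟨S', P', hSP, hbad⟩
    obtain ⟨S, hS, P, hP, hpol, hrated, -, -, hPd⟩ := hD.exists_check_of_nestedClosed hSP
    refine ⟨S, hS, P, hP, hpol, hrated, fun x hx hm => ?_⟩
    obtain ⟨y, hxy, hy⟩ := hPd x hx
    rw [hxy.1, hD.start] at hm
    obtain ⟨F, hF, h⟩ := hbad _ _ hy hm
    obtain ⟨l, hl, rfl⟩ := (hD.targets F).1 hF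
    refine ⟨l, hl, fun u hu hul => ?_⟩
    obtain ⟨w, hw, huw⟩ := hxy.2.1 u hu
    refine h w hw ?_
    rw [huw.1] at hul
    exact hul

theorem pbDecide_iff (hD : Represents D κ α v same F₀ Fs) :
    pbDecide D ↔ ∃ S P, NestedClosed α v same S P ∧ PumpClosed S P ∧
    ∀ m T, S m T → m ∈ F₀ → ∃ F ∈ Fs, ∀ t ∈ T, t ∉ F := by
  constructor
  · rintro ⟨S, hS, P, hP, hpol, hrated, hpump, hbad⟩
    refine ⟨_, _, hD.nestedClosed_of_check hS hP hpol hrated, hD.pumpClosed_of_check hS hpump, ?_⟩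
    rintro m T ⟨u, hu, w, huw, hle⟩ hm
    obtain rfl : m = w.1 := hle.1
    obtain ⟨l, hl, h⟩ := hbad u hu (by rw [huw.1, hD.start]; exact hm)
    exact ⟨_, (hD.targets _).2 ⟨l, hl, rfl⟩, fun t ht htl =>
      h _ ((hD.mem_iff huw).2 (hle.2 ht)) htl⟩
  · rintro ⟨S', P', hSP, hpump, hbad⟩
    obtain ⟨S, hS, P, hP, hpol, hrated, hpc, hSd, -⟩ := hD.exists_check_of_nestedClosed hSP
    refine ⟨S, hS, P, hP, hpol, hrated, hpc hpump, fun u hu hm => ?_⟩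
    obtain ⟨w, huw, hw⟩ := hSd u hu
    rw [huw.1, hD.start] at hm
    obtain ⟨F, hF, h⟩ := hbad _ _ hw hm
    obtain ⟨l, hl, rfl⟩ := (hD.targets F).1 hF
    refine ⟨l, hl, fun c hc hcl => ?_⟩
    obtain ⟨t, ht, rfl⟩ := (huw.2 c).1 hc
    exact h t ht hcl

end Represents

end Transfer

open scoped Pointwise

/-! ### Existence of a closed system versus existence of a level -/

section Semantic

variable {A M : Type*} [Monoid M] [Finite A] [Finite M] {α : List A → M} {same : M → M → Prop}
  {E : List A → List A → Prop} {F₀ : Set M} {Fs : Set (Set M)}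

/-- Forward: a closed system contains the data of every word at one level, and none of these defeats
all targets. Backward: the data realized at all levels are closed, and a sufficient level keeps out
the bad ones. The second coordinates play no role at this level; giving each letter the value 1
keeps them inside {1}, so the table format of the upper level can be reused. -/
theorem exists_pol_level_iff (hα : IsWordHom α) (hE : IsPrecongruence E)
    (hEα : ∀ x y, α x = α y → E x y) (hsame : ∀ x y, same (α x) (α y) ↔ E y x) :
    (∃ S P, NestedClosed α (fun _ => 1) same S P ∧
      ∀ m Θ, P m Θ → m ∈ F₀ → ∃ F ∈ Fs, ∀ w ∈ Θ, w.1 ∉ F) ↔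
    ∃ n, ∀ x, α x ∈ F₀ → ∃ F ∈ Fs, ∀ y, cutLe E n x y → α y ∉ F := by
  constructor
  · rintro ⟨S, P, hSP, hbad⟩
    have hSx : ∀ x, S (α x) {1} := by
      intro x
      induction x with
      | nil => rw [hα.nil]; exact hSP.one
      | cons a x ih =>
        have := hSP.mul _ _ _ _ (hSP.letter a) ih
        rwa [← hα.append, Set.singleton_mul_singleton, one_mul] at this
    obtain ⟨n, hn⟩ := hSP.pol.exists_level isMonoidPreorder_ratedLe hα hE
      (fun _ x w => α x = w.1 ∧ w.2 ⊆ {1}) (fun _ _ _ h => h)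
      (fun _ x x' w h => ⟨(α x, {1}), (α x', {1}), ⟨by rw [← h.1, hα.append]; rfl,
        h.2.trans (by simp)⟩, ⟨rfl, subset_rfl⟩, ⟨rfl, subset_rfl⟩⟩)
      (fun a w h => ⟨h.1.symm, h.2⟩)
      (fun y x w hyx h => ⟨(α x, {1}), ⟨hSx x, (hsame x y).2 hyx⟩, h.1.symm, h.2⟩)
    refine ⟨n, fun x hx => ?_⟩
    obtain ⟨F, hF, h⟩ := hbad _ _ (hn x) hx
    exact ⟨F, hF, fun y hy => h (α y, {1}) ⟨y, hy, rfl, subset_rfl⟩⟩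
  · rintro ⟨n, hn⟩
    refine ⟨fun m T => (∃ x, α x = m) ∧ T ⊆ {1}, _,
      ⟨polClosed_semantic (fun i : ℕ => i) (fun _ x (w : M × Set M) => α x = w.1 ∧ w.2 ⊆ {1})
        hα hE hEα ?_ ?_ ?_ ?_ ?_, ⟨⟨[], hα.nil⟩, subset_rfl⟩, fun a => ⟨⟨[a], rfl⟩, subset_rfl⟩,
        ?_, fun m T T' h hT => ⟨h.1, hT.trans h.2⟩⟩, ?_⟩
    · exact fun _ => ⟨hα.nil, by simp⟩
    · exact fun _ a => ⟨rfl, subset_rfl⟩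
    · exact fun _ x y u v hu hv => ⟨by rw [hα.append, hu.1, hv.1]; rfl,
        (Set.mul_subset_mul hu.2 hv.2).trans (by simp)⟩
    · exact fun _ x u v huv hv => ⟨hv.1.trans huv.1.symm, huv.2.trans hv.2⟩
    · rintro y w ⟨⟨⟨z, hz⟩, hw⟩, hwy⟩ i
      rw [← hz] at hwy
      exact ⟨z, (hsame z y).1 hwy, hz, hw⟩
    · rintro m T m' T' ⟨⟨x, rfl⟩, hT⟩ ⟨⟨x', rfl⟩, hT'⟩
      exact ⟨⟨x ++ x', hα.append _ _⟩, (Set.mul_subset_mul hT hT').trans (by simp)⟩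
    · intro m Θ h hm
      obtain ⟨x, rfl, hx⟩ := h n
      obtain ⟨F, hF, hd⟩ := hn x hm
      refine ⟨F, hF, fun w hw => ?_⟩
      obtain ⟨y, hy, hyw, -⟩ := hx w hw
      rw [← hyw]
      exact hd y hy

/-- The same equivalence for nested closure, with completeness from `PBClosed.exists_level` and
soundness from `pbClosed_semantic`. The targets are now read off S, whose sets T record the values
above a word. -/
theorem exists_pb_level_iff (hα : IsWordHom α) (hE : IsPrecongruence E)
    (hEfin : (Set.range (up E)).Finite)
    (hEα : ∀ x y, α x = α y → E x y) (hsame : ∀ x y, same (α x) (α y) ↔ E y x) :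
    (∃ S P, NestedClosed α (fun a => α [a]) same S P ∧ PumpClosed S P ∧
      ∀ m T, S m T → m ∈ F₀ → ∃ F ∈ Fs, ∀ t ∈ T, t ∉ F) ↔
    ∃ k n, ∀ x, α x ∈ F₀ → ∃ F ∈ Fs, ∀ y, sqLe E k n x y → α y ∉ F := by
  constructor
  · rintro ⟨S, P, hSP, hpump, hbad⟩
    obtain ⟨k, n, hn⟩ := (pbClosed_iff.2 ⟨hSP, hpump⟩).exists_level hα hE hEfin
      fun x y => (hsame x y).2
    refine ⟨k, n, fun x hx => ?_⟩
    obtain ⟨F, hF, h⟩ := hbad _ _ (hn x) hx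
    exact ⟨F, hF, fun y hy => h _ ⟨y, hy, rfl⟩⟩
  · rintro ⟨k, n, hn⟩
    obtain ⟨hSP, hpump⟩ := pbClosed_iff.1 (pbClosed_semantic hα hE hEα fun x y => (hsame x y).1)
    refine ⟨_, _, hSP, hpump, fun m T h hm => ?_⟩
    obtain ⟨x, rfl, hT⟩ := h k n
    obtain ⟨F, hF, hd⟩ := hn x hm
    refine ⟨F, hF, fun t ht => ?_⟩
    obtain ⟨y, hy, rfl⟩ := hT ht
    exact hd y hy

end Semantic

/-! ### The transition monoid of a list of automata -/

section Transition

variable {A : Type*}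

/-- The initial states and the targets of the transitions. -/
def codeStates (c : NFACode A) : List ℕ := c.2.1 ++ c.1.map fun t => t.2.2

/-- All pairs of states of the automata of a list, tagged by the automaton. -/
def triples (cs : List (NFACode A)) : List (NFACode A × ℕ × ℕ) :=
  cs.flatMap fun c => (codeStates c).flatMap fun q => (codeStates c).map fun r => (c, q, r)

theorem mem_triples {cs : List (NFACode A)} {t : NFACode A × ℕ × ℕ} :
    t ∈ triples cs ↔ t.1 ∈ cs ∧ t.2.1 ∈ codeStates t.1 ∧ t.2.2 ∈ codeStates t.1 := by
  obtain ⟨c, q, r⟩ := t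
  simp only [triples, List.mem_flatMap, List.mem_map, Prod.mk.injEq]
  constructor
  · rintro ⟨c', hc, q', hq, r', hr, rfl, rfl, rfl⟩
    exact ⟨hc, hq, hr⟩
  · rintro ⟨hc, hq, hr⟩
    exact ⟨c, hc, q, hq, r, hr, rfl, rfl, rfl⟩

/-- Families of relations on the states of the automata of a list. -/
def Trans (cs : List (NFACode A)) : Type _ :=
  {s : Set (NFACode A × ℕ × ℕ) // ∀ t ∈ s, t ∈ triples cs}

variable {cs : List (NFACode A)}

theorem Trans.ext {s s' : Trans cs} (h : ∀ t ∈ triples cs, t ∈ s.1 ↔ t ∈ s'.1) : s = s' :=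
  Subtype.ext (Set.ext fun t => ⟨fun ht => (h t (s.2 t ht)).1 ht, fun ht =>
    (h t (s'.2 t ht)).2 ht⟩)

instance : Finite (Trans cs) :=
  Set.Finite.to_subtype (s := {s : Set (NFACode A × ℕ × ℕ) | ∀ t ∈ s, t ∈ triples cs})
    (List.finite_toSet (triples cs)).finite_subsets

instance : One (Trans cs) := ⟨⟨{t | t ∈ triples cs ∧ t.2.1 = t.2.2}, fun _ h => h.1⟩⟩

instance : Mul (Trans cs) := ⟨fun s s' => ⟨{t | t ∈ triples cs ∧
  ∃ r, (t.1, t.2.1, r) ∈ s.1 ∧ (t.1, r, t.2.2) ∈ s'.1}, fun _ h => h.1⟩⟩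

theorem Trans.mem_one {t : NFACode A × ℕ × ℕ} (ht : t ∈ triples cs) :
    t ∈ (1 : Trans cs).1 ↔ t.2.1 = t.2.2 := and_iff_right ht

theorem Trans.mem_mul {s s' : Trans cs} {t : NFACode A × ℕ × ℕ} (ht : t ∈ triples cs) :
    t ∈ (s * s').1 ↔ ∃ r, (t.1, t.2.1, r) ∈ s.1 ∧ (t.1, r, t.2.2) ∈ s'.1 := and_iff_right ht

theorem Trans.mem_mul' {s s' : Trans cs} {c : NFACode A} {q q' : ℕ} :
    (c, q, q') ∈ (s * s').1 ↔ ∃ r, (c, q, r) ∈ s.1 ∧ (c, r, q') ∈ s'.1 := by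
  refine ⟨fun h => h.2, fun ⟨r, h, h'⟩ => ⟨mem_triples.2 ?_, r, h, h'⟩⟩
  have h₁ := mem_triples.1 (s.2 _ h)
  have h₂ := mem_triples.1 (s'.2 _ h')
  exact ⟨h₁.1, h₁.2.1, h₂.2.2⟩

instance : Monoid (Trans cs) where
  mul_assoc s₁ s₂ s₃ := Trans.ext fun t _ => by
    obtain ⟨c, q, q'⟩ := t
    simp only [Trans.mem_mul']
    constructor
    · rintro ⟨r, ⟨r', h₁, h₂⟩, h₃⟩
      exact ⟨r', h₁, r, h₂, h₃⟩
    · rintro ⟨r, h₁, r', h₂, h₃⟩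
      exact ⟨r', ⟨r, h₁, h₂⟩, h₃⟩
  one_mul s := Trans.ext fun t ht => by
    obtain ⟨c, q, q'⟩ := t
    rw [Trans.mem_mul']
    constructor
    · rintro ⟨r, h, h'⟩
      obtain rfl : q = r := h.2
      exact h'
    · intro h
      have := mem_triples.1 ht
      exact ⟨q, ⟨mem_triples.2 ⟨this.1, this.2.1, this.2.1⟩, rfl⟩, h⟩
  mul_one s := Trans.ext fun t ht => by
    obtain ⟨c, q, q'⟩ := t
    rw [Trans.mem_mul']
    constructor
    · rintro ⟨r, h, h'⟩
      obtain rfl : r = q' := h'.2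
      exact h
    · intro h
      have := mem_triples.1 ht
      exact ⟨q', h, mem_triples.2 ⟨this.1, this.2.2, this.2.2⟩, rfl⟩

theorem evalFrom_subset_codeStates (c : NFACode A) (x : List A) : ∀ {S : Set ℕ},
    (∀ q ∈ S, q ∈ codeStates c) → ∀ q ∈ (NFACode.toNFA c).evalFrom S x, q ∈ codeStates c := by
  induction x with
  | nil => intro S h; exact h
  | cons a x ih =>
    intro S _
    refine ih fun q hq => ?_
    obtain ⟨p, _, hp⟩ := NFA.mem_stepSet.1 hq
    exact List.mem_append_right _ (List.mem_map.2 ⟨_, hp, rfl⟩)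

/-- The transition morphism. -/
def transHom (cs : List (NFACode A)) (x : List A) : Trans cs :=
  ⟨{t | t ∈ triples cs ∧ t.2.2 ∈ (NFACode.toNFA t.1).evalFrom {t.2.1} x}, fun _ h => h.1⟩

theorem isWordHom_transHom (cs : List (NFACode A)) : IsWordHom (transHom cs) := by
  refine ⟨Trans.ext fun t ht => ?_, fun x y => Trans.ext fun t ht => ?_⟩
  · rw [Trans.mem_one ht]
    exact (and_iff_right ht).trans eq_comm
  · obtain ⟨c, q, q'⟩ := t
    rw [Trans.mem_mul']
    have hc := mem_triples.1 ht
    refine (and_iff_right ht).trans ?_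
    rw [NFA.evalFrom_append, NFA.mem_evalFrom_iff_exists]
    constructor
    · rintro ⟨r, hr, hq⟩
      have hrc := evalFrom_subset_codeStates c x (S := {q}) (by rintro _ rfl; exact hc.2.1) r hr
      exact ⟨r, ⟨mem_triples.2 ⟨hc.1, hc.2.1, hrc⟩, hr⟩, mem_triples.2 ⟨hc.1, hrc, hc.2.2⟩, hq⟩
    · rintro ⟨r, h, hr⟩
      exact ⟨r, h.2, hr.2⟩

/-- The accepting condition of an automaton, on lists of tagged pairs of states. -/
def codeAccepts (c : NFACode A) (m : List (NFACode A × ℕ × ℕ)) : Prop :=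
  ∃ i ∈ c.2.1, ∃ f ∈ c.2.2, (c, i, f) ∈ m

open Classical in
/-- The list coding a family of relations. -/
noncomputable def transCode (s : Trans cs) : List (NFACode A × ℕ × ℕ) :=
  (triples cs).filter fun t => t ∈ s.1

theorem mem_transCode {s : Trans cs} {t : NFACode A × ℕ × ℕ} : t ∈ transCode s ↔ t ∈ s.1 := by
  simp only [transCode, List.mem_filter, decide_eq_true_eq, and_iff_right_iff_imp]
  exact s.2 t

theorem transCode_injective : Function.Injective (transCode (cs := cs)) := fun s s' h =>
  Trans.ext fun t _ => by rw [← mem_transCode, h, mem_transCode]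

/-- All automata share one monoid, and tagging the state pairs by the automaton lets each acceptance
condition be read off a single element. -/
theorem codeAccepts_transHom {c : NFACode A} (hc : c ∈ cs) (x : List A) :
    codeAccepts c (transCode (transHom cs x)) ↔ x ∈ c.lang := by
  rw [NFACode.lang, NFA.mem_accepts]
  constructor
  · rintro ⟨i, hi, f, hf, h⟩
    exact ⟨f, hf, (NFA.mem_evalFrom_iff_exists).2 ⟨i, hi, (mem_transCode.1 h).2⟩⟩
  · rintro ⟨f, hf, h⟩
    obtain ⟨i, hi, h⟩ := (NFA.mem_evalFrom_iff_exists).1 h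
    have hi' : i ∈ codeStates c := List.mem_append_left _ hi
    have := evalFrom_subset_codeStates c x (S := {i}) (by rintro _ rfl; exact hi') f h
    exact ⟨i, hi, f, hf, mem_transCode.2 ⟨mem_triples.2 ⟨hc, hi', this⟩, h⟩⟩

open Classical in
/-- The codes of the families of relations. -/
noncomputable def transCodes (cs : List (NFACode A)) : List (List (NFACode A × ℕ × ℕ)) :=
  (triples cs).sublists'.map fun l => (triples cs).filter fun t => t ∈ l

/-- Distinct sublists of the list of triples may have the same members. Filtering the full list by
each sublist makes the code canonical, so that equality of codes is equality of elements. -/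
theorem mem_transCodes {l : List (NFACode A × ℕ × ℕ)} :
    l ∈ transCodes cs ↔ ∃ s : Trans cs, transCode s = l := by
  classical
  constructor
  · intro h
    obtain ⟨l', -, rfl⟩ := List.mem_map.1 h
    refine ⟨⟨{t | t ∈ triples cs ∧ t ∈ l'}, fun _ h => h.1⟩, List.filter_congr fun t ht => ?_⟩
    exact decide_eq_decide.2 (and_iff_right ht)
  · rintro ⟨s, rfl⟩
    refine List.mem_map.2 ⟨transCode s, List.mem_sublists'.2 List.filter_sublist,
      List.filter_congr fun t _ => decide_eq_decide.2 mem_transCode⟩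

open Classical in
/-- The code of the unit. -/
noncomputable def transOneCode (cs : List (NFACode A)) : List (NFACode A × ℕ × ℕ) :=
  (triples cs).filter fun t => t.2.1 = t.2.2

open Classical in
/-- The code of a letter. -/
noncomputable def transLetterCode (cs : List (NFACode A)) (a : A) : List (NFACode A × ℕ × ℕ) :=
  (triples cs).filter fun t => (t.2.1, a, t.2.2) ∈ t.1.1

open Classical in
/-- The code of a product. -/
noncomputable def transMulCode (cs : List (NFACode A)) (l l' : List (NFACode A × ℕ × ℕ)) :
    List (NFACode A × ℕ × ℕ) :=
  (triples cs).filter fun t => ∃ s ∈ l, s.1 = t.1 ∧ s.2.1 = t.2.1 ∧ (t.1, s.2.2, t.2.2) ∈ l'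

theorem transOneCode_eq : transOneCode cs = transCode (1 : Trans cs) := by
  classical
  exact List.filter_congr fun t ht => decide_eq_decide.2 (Trans.mem_one ht).symm

theorem transLetterCode_eq (a : A) : transLetterCode cs a = transCode (transHom cs [a]) := by
  classical
  refine List.filter_congr fun t ht => decide_eq_decide.2 (Iff.trans ?_ (and_iff_right ht).symm)
  rw [NFA.evalFrom_singleton, NFA.stepSet_singleton]
  exact Iff.rfl

theorem transMulCode_eq (s s' : Trans cs) :
    transMulCode cs (transCode s) (transCode s') = transCode (s * s') := by
  classical
  refine List.filter_congr fun t ht => decide_eq_decide.2 (Iff.trans ?_ (Trans.mem_mul ht).symm)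
  constructor
  · rintro ⟨⟨c, q, r⟩, h, h₁, h₂, h₃⟩
    refine ⟨r, ?_, mem_transCode.1 h₃⟩
    rw [← h₁, ← h₂]
    exact mem_transCode.1 h
  · rintro ⟨r, h, h'⟩
    exact ⟨_, mem_transCode.2 h, rfl, rfl, mem_transCode.2 h'⟩

open Classical in
/-- The table of the transition monoid of the automata `c₀ :: (l ++ CC)`, with the relation of
being accepted by the same automata of `CC`. -/
noncomputable def transTable (b : Bool) (as : List A) (CC : List (NFACode A))
    (x : NFACode A × List (NFACode A)) : Table (List (NFACode A × ℕ × ℕ)) :=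
  (transCodes (x.1 :: (x.2 ++ CC)), transOneCode (x.1 :: (x.2 ++ CC)),
    as.map fun a => (transLetterCode (x.1 :: (x.2 ++ CC)) a,
      bif b then transLetterCode (x.1 :: (x.2 ++ CC)) a else transOneCode (x.1 :: (x.2 ++ CC))),
    (transCodes (x.1 :: (x.2 ++ CC))).flatMap fun l => (transCodes (x.1 :: (x.2 ++ CC))).map
      fun l' => (l, l', transMulCode (x.1 :: (x.2 ++ CC)) l l'),
    ((transCodes (x.1 :: (x.2 ++ CC))).product (transCodes (x.1 :: (x.2 ++ CC)))).filter
      fun p => ∀ c ∈ CC, codeAccepts c p.1 ↔ codeAccepts c p.2,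
    (transCodes (x.1 :: (x.2 ++ CC))).filter fun l => codeAccepts x.1 l,
    x.2.map fun c => (transCodes (x.1 :: (x.2 ++ CC))).filter fun l => codeAccepts c l)

theorem represents_transTable (b : Bool) {as : List A} (has : ∀ a, a ∈ as)
    (CC : List (NFACode A)) (x : NFACode A × List (NFACode A)) :
    Represents (transTable b as CC x) (transCode (cs := x.1 :: (x.2 ++ CC))) (transHom _)
      (fun a => bif b then transHom _ [a] else 1)
      (fun m m' => ∀ c ∈ CC, codeAccepts c (transCode m) ↔ codeAccepts c (transCode m'))
      {m | codeAccepts x.1 (transCode m)}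
      {F | ∃ c ∈ x.2, F = {m | codeAccepts c (transCode m)}} := by
  classical
  refine ⟨transCode_injective, fun l => mem_transCodes, transOneCode_eq, fun l => ?_, fun l => ?_,
    fun m m' => ?_, fun m => ?_, fun F => ?_⟩
  · simp only [transTable, List.mem_map]
    constructor
    · rintro ⟨a, _, rfl⟩
      refine ⟨a, ?_⟩
      cases b <;> simp [transLetterCode_eq, transOneCode_eq]
    · rintro ⟨a, rfl⟩
      refine ⟨a, has a, ?_⟩
      cases b <;> simp [transLetterCode_eq, transOneCode_eq]
  · simp only [transTable, List.mem_flatMap, List.mem_map, mem_transCodes]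
    constructor
    · rintro ⟨_, ⟨m, rfl⟩, _, ⟨m', rfl⟩, rfl⟩
      exact ⟨m, m', by rw [transMulCode_eq]⟩
    · rintro ⟨m, m', rfl⟩
      exact ⟨_, ⟨m, rfl⟩, _, ⟨m', rfl⟩, by rw [transMulCode_eq]⟩
  · simp only [transTable, List.mem_filter, decide_eq_true_eq, and_iff_right_iff_imp]
    exact fun _ => List.pair_mem_product.2 ⟨mem_transCodes.2 ⟨m, rfl⟩, mem_transCodes.2 ⟨m', rfl⟩⟩
  · simp only [transTable, List.mem_filter, decide_eq_true_eq]
    exact and_iff_right (mem_transCodes.2 ⟨m, rfl⟩)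
  · simp only [transTable, List.mem_map, exists_exists_and_eq_and, List.mem_filter,
      decide_eq_true_eq, mem_transCodes, exists_apply_eq_apply, true_and]
    exact Iff.rfl

end Transition

/-! ### Correctness of the decision procedures on automata -/

section Correct

variable {A : Type*} {C : Set (Language A)}

/-- Because automata for all languages of C are adjoined to the input, equivalence modulo C becomes
a decidable relation on the transition monoid. -/
theorem transHom_classEquiv_iff {CC : List (NFACode A)} (hCC : ∀ L, L ∈ C ↔ ∃ c ∈ CC, c.lang = L)
    {cs : List (NFACode A)} (hcs : CC ⊆ cs) (u w : List A) :
    (∀ c ∈ CC, codeAccepts c (transCode (transHom cs u)) ↔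
      codeAccepts c (transCode (transHom cs w))) ↔ classEquiv C w u := by
  constructor
  · intro h L hL
    obtain ⟨c, hc, rfl⟩ := (hCC L).1 hL
    rw [← codeAccepts_transHom (hcs hc), ← codeAccepts_transHom (hcs hc)]
    exact (h c hc).symm
  · intro h c hc
    rw [codeAccepts_transHom (hcs hc), codeAccepts_transHom (hcs hc)]
    exact (h _ ((hCC _).2 ⟨c, hc, rfl⟩)).symm

/-- The covering condition, in terms of the transition monoid. -/
theorem forall_transHom_iff (CC : List (NFACode A)) (x : NFACode A × List (NFACode A))
    (R : List A → List A → Prop) :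
    (∀ w, transHom (x.1 :: (x.2 ++ CC)) w ∈ {m | codeAccepts x.1 (transCode m)} →
      ∃ F ∈ {F | ∃ c ∈ x.2, F = {m | codeAccepts c (transCode m)}}, ∀ y, R w y →
        transHom (x.1 :: (x.2 ++ CC)) y ∉ F) ↔
    ∀ w ∈ x.1.lang, ∃ L' ∈ {L | ∃ c ∈ x.2, L = c.lang}, ∀ y, R w y → y ∉ L' := by
  have hacc : ∀ c ∈ x.1 :: (x.2 ++ CC), ∀ w,
      transHom (x.1 :: (x.2 ++ CC)) w ∈ {m | codeAccepts c (transCode m)} ↔ w ∈ c.lang :=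
    fun c hc w => codeAccepts_transHom hc w
  refine forall_congr' fun w => imp_congr (hacc _ (by simp) w) ?_
  constructor
  · rintro ⟨_, ⟨c, hc, rfl⟩, h⟩
    exact ⟨_, ⟨c, hc, rfl⟩, fun y hy => by rw [← hacc c (by simp [hc])]; exact h y hy⟩
  · rintro ⟨_, ⟨c, hc, rfl⟩, h⟩
    exact ⟨_, ⟨c, hc, rfl⟩, fun y hy => by rw [hacc c (by simp [hc])]; exact h y hy⟩

theorem polDecide_transTable_iff [Finite A] (hfin : C.Finite) (hbool : IsBooleanAlgebra C)
    (hquot : IsQuotienting C) {as : List A} (has : ∀ a, a ∈ as) {CC : List (NFACode A)}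
    (hCC : ∀ L, L ∈ C ↔ ∃ c ∈ CC, c.lang = L) (x : NFACode A × List (NFACode A)) :
    polDecide (transTable false as CC x) ↔
      Coverable (Pol C) x.1.lang {L | ∃ c ∈ x.2, L = c.lang} := by
  have hsame := transHom_classEquiv_iff hCC (cs := x.1 :: (x.2 ++ CC)) (fun c hc => by simp [hc])
  rw [(represents_transTable false has CC x).polDecide_iff,
    coverable_pol_class_iff hfin hbool hquot]
  refine (exists_pol_level_iff (isWordHom_transHom _) (isPrecongruence_classEquiv hquot)
    (fun u w h => (hsame w u).1 (by rw [h]; exact fun _ _ => Iff.rfl)) hsame).trans ?_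
  exact exists_congr fun n => forall_transHom_iff CC x _

theorem pbDecide_transTable_iff [Finite A] (hfin : C.Finite) (hbool : IsBooleanAlgebra C)
    (hquot : IsQuotienting C) {as : List A} (has : ∀ a, a ∈ as) {CC : List (NFACode A)}
    (hCC : ∀ L, L ∈ C ↔ ∃ c ∈ CC, c.lang = L) (x : NFACode A × List (NFACode A)) :
    pbDecide (transTable true as CC x) ↔
      Coverable (PBPol C) x.1.lang {L | ∃ c ∈ x.2, L = c.lang} := by
  have hsame := transHom_classEquiv_iff hCC (cs := x.1 :: (x.2 ++ CC)) (fun c hc => by simp [hc])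
  rw [(represents_transTable true has CC x).pbDecide_iff, coverable_pbPol_iff hfin hbool hquot]
  refine (exists_pb_level_iff (isWordHom_transHom _) (isPrecongruence_classEquiv hquot)
    (finite_range_up_classEquiv hfin)
    (fun u w h => (hsame w u).1 (by rw [h]; exact fun _ _ => Iff.rfl)) hsame).trans ?_
  exact exists_congr fun k => exists_congr fun n => forall_transHom_iff CC x _

end Correct

/-! ### Computability -/

section Computability

attribute [fun_prop] Primrec Primrec.id Primrec.const Primrec.comp Primrec.fst Primrec.snd
  Primrec.pair

variable {α β σ : Type*} [Primcodable α] [Primcodable β] [Primcodable σ]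

theorem primrecPred_exists_mem {f : α → List β} {R : α → β → Prop} (hf : Primrec f)
    (hR : PrimrecPred fun z : α × β => R z.1 z.2) : PrimrecPred fun a => ∃ b ∈ f a, R a b := by
  have h : PrimrecRel fun (b : β) (a : α) => R a b :=
    hR.comp (f := fun z : β × α => (z.2, z.1)) (by fun_prop)
  exact h.exists_mem_list.comp hf Primrec.id

theorem primrecPred_forall_mem {f : α → List β} {R : α → β → Prop} (hf : Primrec f)
    (hR : PrimrecPred fun z : α × β => R z.1 z.2) : PrimrecPred fun a => ∀ b ∈ f a, R a b := by
  have h : PrimrecRel fun (b : β) (a : α) => R a b :=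
    hR.comp (f := fun z : β × α => (z.2, z.1)) (by fun_prop)
  exact h.forall_mem_list.comp hf Primrec.id

theorem primrecPred_imp {p q : α → Prop} (hp : PrimrecPred p) (hq : PrimrecPred q) :
    PrimrecPred fun a => p a → q a :=
  (hp.not.or hq).of_eq fun _ => Iff.symm imp_iff_not_or

theorem primrecPred_iff {p q : α → Prop} (hp : PrimrecPred p) (hq : PrimrecPred q) :
    PrimrecPred fun a => p a ↔ q a :=
  ((primrecPred_imp hp hq).and (primrecPred_imp hq hp)).of_eq fun _ => iff_def.symm

theorem primrecPred_eq {f g : α → β} (hf : Primrec f) (hg : Primrec g) :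
    PrimrecPred fun a => f a = g a := Primrec.eq.comp hf hg

theorem primrecPred_mem {f : α → β} {g : α → List β} (hf : Primrec f) (hg : Primrec g) :
    PrimrecPred fun a => f a ∈ g a :=
  (primrecPred_exists_mem (R := fun a b => b = f a) hg
    (primrecPred_eq Primrec.snd (hf.comp Primrec.fst))).of_eq fun _ =>
      ⟨fun ⟨_, hb, h⟩ => h ▸ hb, fun h => ⟨_, h, rfl⟩⟩

/-- The decidability instance is arbitrary, so filters defined with classical decidability are
covered. -/
theorem primrec_filter {f : α → List β} {R : α → β → Prop}
    {_ : ∀ a b, Decidable (R a b)} (hf : Primrec f) (hR : PrimrecPred fun z : α × β => R z.1 z.2) :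
    Primrec fun a => (f a).filter fun b => R a b := by
  have h : PrimrecRel fun (b : β) (a : α) => R a b :=
    hR.comp (f := fun z : β × α => (z.2, z.1)) (by fun_prop)
  classical
  exact (h.listFilter.comp hf Primrec.id).of_eq fun a =>
    List.filter_congr fun b _ => decide_eq_decide.2 Iff.rfl

@[fun_prop]
theorem primrec_sublists' {f : α → List β} (hf : Primrec f) :
    Primrec fun a => (f a).sublists' := by
  have h : Primrec fun l : List β => l.foldr (fun b r => r ++ r.map (List.cons b)) [[]] := by
    refine Primrec.list_foldr (h := fun _ (z : β × List (List β)) => z.2 ++ z.2.map (List.cons z.1))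
      Primrec.id (Primrec.const [[]]) ?_
    refine Primrec.list_append.comp (by fun_prop) (Primrec.list_map (by fun_prop) ?_)
    exact Primrec.list_cons.comp (by fun_prop) (by fun_prop)
  refine (h.comp hf).of_eq fun a => ?_
  induction f a with
  | nil => rfl
  | cons b l ih => rw [List.foldr_cons, ih, List.sublists'_cons]

@[fun_prop]
theorem primrec_product {f : α → List β} {g : α → List σ} (hf : Primrec f) (hg : Primrec g) :
    Primrec fun a => (f a).product (g a) := by
  refine Primrec.list_flatMap (g := fun a b => (g a).map fun c => (b, c)) hf
    (Primrec.list_map (by fun_prop) ?_)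
  exact (by fun_prop : Primrec fun z : (α × β) × σ => (z.1.2, z.2))

@[fun_prop]
theorem primrec_singleton {f : α → β} (hf : Primrec f) : Primrec fun a => [f a] :=
  Primrec.list_cons.comp hf (Primrec.const [])

variable {γ : Type*} [Primcodable γ]

instance : Primcodable (Table γ) := inferInstance

theorem primrec_table {f₁ : α → List γ} {f₂ : α → γ} {f₃ : α → List (γ × γ)}
    {f₄ : α → List (γ × γ × γ)} {f₅ : α → List (γ × γ)} {f₆ : α → List γ}
    {f₇ : α → List (List γ)} (h₁ : Primrec f₁) (h₂ : Primrec f₂) (h₃ : Primrec f₃)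
    (h₄ : Primrec f₄) (h₅ : Primrec f₅) (h₆ : Primrec f₆) (h₇ : Primrec f₇) :
    Primrec fun a => ((f₁ a, f₂ a, f₃ a, f₄ a, f₅ a, f₆ a, f₇ a) : Table γ) := by
  fun_prop

@[fun_prop]
theorem primrec_ratedCodes {f : α → Table γ} (hf : Primrec f) :
    Primrec fun a => ratedCodes (f a) := by
  unfold ratedCodes; fun_prop

@[fun_prop]
theorem primrec_pairCodes {f : α → Table γ} (hf : Primrec f) :
    Primrec fun a => pairCodes (f a) := by
  unfold pairCodes; fun_prop

theorem primrecPred_codeLe {f g : α → γ × List γ} (hf : Primrec f) (hg : Primrec g) :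
    PrimrecPred fun a => codeLe (f a) (g a) := by
  unfold codeLe listLe
  repeat' first
    | apply PrimrecPred.and | apply primrecPred_forall_mem | apply primrecPred_eq
    | apply primrecPred_mem | fun_prop

theorem primrecPred_codeMulLe {e : α → List (γ × γ × γ)} {f g h : α → γ × List γ}
    (he : Primrec e) (hf : Primrec f) (hg : Primrec g) (hh : Primrec h) :
    PrimrecPred fun a => codeMulLe (e a) (f a) (g a) (h a) := by
  unfold codeMulLe
  repeat' first
    | apply PrimrecPred.and | apply primrecPred_forall_mem | apply primrecPred_imp
    | apply primrecPred_mem | fun_prop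

theorem primrecPred_codeLeMul {e : α → List (γ × γ × γ)} {f g h : α → γ × List γ}
    (he : Primrec e) (hf : Primrec f) (hg : Primrec g) (hh : Primrec h) :
    PrimrecPred fun a => codeLeMul (e a) (f a) (g a) (h a) := by
  unfold codeLeMul
  repeat' first
    | apply PrimrecPred.and | apply primrecPred_forall_mem | apply primrecPred_exists_mem
    | apply primrecPred_eq | apply primrecPred_mem | fun_prop

theorem primrecPred_polCheck : PrimrecPred fun z : Table γ × List (γ × List γ) ×
    List (γ × List (γ × List γ)) => polCheck z.1 z.2.1 z.2.2 := by
  unfold polCheck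
  repeat' first
    | apply primrecPred_codeLe | apply primrecPred_codeMulLe | apply primrecPred_codeLeMul
    | apply PrimrecPred.and | apply primrecPred_forall_mem | apply primrecPred_exists_mem
    | apply primrecPred_imp | apply primrecPred_eq | apply primrecPred_mem | fun_prop

theorem primrecPred_ratedCheck : PrimrecPred fun z : Table γ × List (γ × List γ) =>
    ratedCheck z.1 z.2 := by
  unfold ratedCheck
  repeat' first
    | apply primrecPred_codeLe | apply primrecPred_codeMulLe | apply PrimrecPred.and
    | apply primrecPred_forall_mem | apply primrecPred_exists_mem | fun_prop

theorem primrecPred_pumpCheck : PrimrecPred fun z : Table γ × List (γ × List γ) ×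
    List (γ × List (γ × List γ)) => pumpCheck z.1 z.2.1 z.2.2 := by
  unfold pumpCheck listLe
  repeat' first
    | apply primrecPred_codeLe | apply PrimrecPred.and | apply primrecPred_forall_mem
    | apply primrecPred_exists_mem | apply primrecPred_imp | apply primrecPred_eq
    | apply primrecPred_mem | fun_prop

theorem primrecPred_polDecide : PrimrecPred fun D : Table γ => polDecide D := by
  unfold polDecide
  refine primrecPred_exists_mem (by fun_prop) (primrecPred_exists_mem (by fun_prop)
    (PrimrecPred.and ?_ (PrimrecPred.and ?_ ?_)))
  · exact primrecPred_polCheck.comp (f := fun z : (Table γ × List (γ × List γ)) ×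
      List (γ × List (γ × List γ)) => (z.1.1, z.1.2, z.2)) (by fun_prop)
  · exact primrecPred_ratedCheck.comp (f := fun z : (Table γ × List (γ × List γ)) ×
      List (γ × List (γ × List γ)) => (z.1.1, z.1.2)) (by fun_prop)
  · repeat' first
      | apply PrimrecPred.not | apply primrecPred_forall_mem | apply primrecPred_exists_mem
      | apply primrecPred_mem | apply primrecPred_imp | fun_prop

theorem primrecPred_pbDecide : PrimrecPred fun D : Table γ => pbDecide D := by
  unfold pbDecide
  refine primrecPred_exists_mem (by fun_prop) (primrecPred_exists_mem (by fun_prop)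
    (PrimrecPred.and ?_ (PrimrecPred.and ?_ (PrimrecPred.and ?_ ?_))))
  · exact primrecPred_polCheck.comp (f := fun z : (Table γ × List (γ × List γ)) ×
      List (γ × List (γ × List γ)) => (z.1.1, z.1.2, z.2)) (by fun_prop)
  · exact primrecPred_ratedCheck.comp (f := fun z : (Table γ × List (γ × List γ)) ×
      List (γ × List (γ × List γ)) => (z.1.1, z.1.2)) (by fun_prop)
  · exact primrecPred_pumpCheck.comp (f := fun z : (Table γ × List (γ × List γ)) ×
      List (γ × List (γ × List γ)) => (z.1.1, z.1.2, z.2)) (by fun_prop)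
  · repeat' first
      | apply PrimrecPred.not | apply primrecPred_forall_mem | apply primrecPred_exists_mem
      | apply primrecPred_mem | apply primrecPred_imp | fun_prop

variable {A : Type*} [Primcodable A]

@[fun_prop]
theorem primrec_codeStates {f : α → NFACode A} (hf : Primrec f) :
    Primrec fun a => codeStates (f a) := by
  refine Primrec.list_append.comp (by fun_prop) (Primrec.list_map (by fun_prop) ?_)
  exact (by fun_prop : Primrec fun z : α × (ℕ × A × ℕ) => z.2.2.2)

@[fun_prop]
theorem primrec_triples {f : α → List (NFACode A)} (hf : Primrec f) :
    Primrec fun a => triples (f a) := by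
  refine Primrec.list_flatMap hf (Primrec.list_flatMap (by fun_prop)
    (Primrec.list_map (by fun_prop) ?_))
  exact (by fun_prop : Primrec fun z : ((α × NFACode A) × ℕ) × ℕ => (z.1.1.2, z.1.2, z.2))

theorem primrecPred_codeAccepts {f : α → NFACode A} {g : α → List (NFACode A × ℕ × ℕ)}
    (hf : Primrec f) (hg : Primrec g) : PrimrecPred fun a => codeAccepts (f a) (g a) := by
  unfold codeAccepts
  repeat' first
    | apply primrecPred_exists_mem | apply primrecPred_mem | fun_prop

@[fun_prop]
theorem primrec_transCodes {f : α → List (NFACode A)} (hf : Primrec f) :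
    Primrec fun a => transCodes (f a) := by
  refine Primrec.list_map (by fun_prop) (primrec_filter (by fun_prop) ?_)
  exact primrecPred_mem (by fun_prop) (by fun_prop)

@[fun_prop]
theorem primrec_transOneCode {f : α → List (NFACode A)} (hf : Primrec f) :
    Primrec fun a => transOneCode (f a) :=
  primrec_filter (by fun_prop) (primrecPred_eq (by fun_prop) (by fun_prop))

@[fun_prop]
theorem primrec_transLetterCode {f : α → List (NFACode A)} {g : α → A} (hf : Primrec f)
    (hg : Primrec g) : Primrec fun a => transLetterCode (f a) (g a) :=
  primrec_filter (by fun_prop) (primrecPred_mem (by fun_prop) (by fun_prop))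

@[fun_prop]
theorem primrec_transMulCode {f : α → List (NFACode A)} {g h : α → List (NFACode A × ℕ × ℕ)}
    (hf : Primrec f) (hg : Primrec g) (hh : Primrec h) :
    Primrec fun a => transMulCode (f a) (g a) (h a) := by
  refine primrec_filter (by fun_prop) ?_
  repeat' first
    | apply PrimrecPred.and | apply primrecPred_exists_mem | apply primrecPred_eq
    | apply primrecPred_mem | fun_prop

/-- The letters and the automata for C are fixed constants; only the automata of the instance vary.
-/
theorem primrec_transTable (b : Bool) (as : List A) (CC : List (NFACode A)) :
    Primrec (transTable b as CC) := by
  have hcs : Primrec fun x : NFACode A × List (NFACode A) => x.1 :: (x.2 ++ CC) :=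
    Primrec.list_cons.comp Primrec.fst (Primrec.list_append.comp Primrec.snd (Primrec.const CC))
  unfold transTable
  refine primrec_table (by fun_prop) (by fun_prop) ?_ ?_ ?_ ?_ ?_
  · refine Primrec.list_map (Primrec.const as) ?_
    have hcs' : Primrec fun z : (NFACode A × List (NFACode A)) × A =>
      z.1.1 :: (z.1.2 ++ CC) := hcs.comp Primrec.fst
    cases b
    · exact (primrec_transLetterCode hcs' Primrec.snd).pair (primrec_transOneCode hcs')
    · exact (primrec_transLetterCode hcs' Primrec.snd).pair
        (primrec_transLetterCode hcs' Primrec.snd)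
  · refine Primrec.list_flatMap (by fun_prop) (Primrec.list_map
      (primrec_transCodes (hcs.comp Primrec.fst)) ?_)
    exact (Primrec.snd.comp Primrec.fst).pair (Primrec.snd.pair (primrec_transMulCode
      (hcs.comp (Primrec.fst.comp Primrec.fst)) (Primrec.snd.comp Primrec.fst) Primrec.snd))
  · refine primrec_filter (by fun_prop) ?_
    repeat' first
      | apply primrecPred_forall_mem | apply primrecPred_iff | apply primrecPred_codeAccepts
      | fun_prop
  · exact primrec_filter (by fun_prop) (primrecPred_codeAccepts (by fun_prop) (by fun_prop))
  · exact Primrec.list_map (by fun_prop) (primrec_filter (primrec_transCodes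
      (hcs.comp Primrec.fst)) (primrecPred_codeAccepts (by fun_prop) (by fun_prop)))

end Computability

/-! ### Assembling the decidability results -/

section Main

variable {A : Type*} {C : Set (Language A)}

theorem exists_codes [Finite A] (hfin : C.Finite) (hreg : ∀ L ∈ C, L.IsRegular) :
    ∃ CC : List (NFACode A), ∀ L, L ∈ C ↔ ∃ c ∈ CC, c.lang = L := by
  choose! code hcode using fun L hL => (isRegular_iff_exists_code L).1 (hreg L hL)
  refine ⟨hfin.toFinset.toList.map code, fun L => ⟨fun hL => ⟨code L, ?_, hcode L hL⟩, ?_⟩⟩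
  · exact List.mem_map.2 ⟨L, by simpa using hL, rfl⟩
  · rintro ⟨c, hc, rfl⟩
    obtain ⟨L, hL, rfl⟩ := List.mem_map.1 hc
    have hL : L ∈ C := by simpa using hL
    rwa [hcode L hL]

theorem exists_letters (A : Type*) [Finite A] : ∃ as : List A, ∀ a, a ∈ as := by
  have := Fintype.ofFinite A
  exact ⟨Finset.univ.toList, by simp⟩

theorem coveringDecidable_pol [Finite A] [Primcodable A]
    (hfin : C.Finite) (hreg : ∀ L ∈ C, L.IsRegular)
    (hbool : IsBooleanAlgebra C) (hquot : IsQuotienting C) : CoveringDecidable (Pol C) := by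
  obtain ⟨CC, hCC⟩ := exists_codes hfin hreg
  obtain ⟨as, has⟩ := exists_letters A
  exact ((primrecPred_polDecide.comp (primrec_transTable false as CC)).of_eq fun x =>
    polDecide_transTable_iff hfin hbool hquot has hCC x).computablePred

theorem coveringDecidable_pbPol [Finite A] [Primcodable A]
    (hfin : C.Finite) (hreg : ∀ L ∈ C, L.IsRegular)
    (hbool : IsBooleanAlgebra C) (hquot : IsQuotienting C) : CoveringDecidable (PBPol C) := by
  obtain ⟨CC, hCC⟩ := exists_codes hfin hreg
  obtain ⟨as, has⟩ := exists_letters A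
  exact ((primrecPred_pbDecide.comp (primrec_transTable true as CC)).of_eq fun x =>
    pbDecide_transTable_iff hfin hbool hquot has hCC x).computablePred

/-- Separation is covering against a single target, so the instance is mapped to one with a
one-element list. -/
theorem CoveringDecidable.separationDecidable [Primcodable A] {D : Set (Language A)} (hbot : ⊥ ∈ D)
    (h : CoveringDecidable (Pol D)) : SeparationDecidable (Pol D) := by
  have hf : Computable fun x : NFACode A × NFACode A => (x.1, [x.2]) :=
    (Primrec.fst.pair (Primrec.list_cons.comp Primrec.snd (Primrec.const []))).to_comp
  obtain ⟨f, hfc, hfe⟩ := ComputablePred.computable_iff.1 h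
  refine ComputablePred.computable_iff.2 ⟨_, hfc.comp hf, funext fun x => ?_⟩
  rw [← congrFun hfe (x.1, [x.2]), eq_iff_iff]
  rw [separable_pol_iff hbot]
  simp

end Main

end LangClass

theorem theorem3p5 {A : Type*} [Finite A] [Primcodable A] (C : Set (Language A))
    (hfin : C.Finite) (hreg : ∀ L ∈ C, L.IsRegular)
    (hbool : LangClass.IsBooleanAlgebra C) (hquot : LangClass.IsQuotienting C) :
    (LangClass.CoveringDecidable (LangClass.Pol C) ∧
      LangClass.SeparationDecidable (LangClass.Pol C)) ∧
    (LangClass.CoveringDecidable (LangClass.PBPol C) ∧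
      LangClass.SeparationDecidable (LangClass.PBPol C)) := by
  have h₁ := LangClass.coveringDecidable_pol hfin hreg hbool hquot
  have h₂ := LangClass.coveringDecidable_pbPol hfin hreg hbool hquot
  exact ⟨⟨h₁, h₁.separationDecidable hbool.empty_mem⟩,
    h₂, LangClass.CoveringDecidable.separationDecidable LangClass.BoolClosureMem.empty h₂⟩
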